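/- Let $G$ be a discrete group. **Conventions.** For a Fell bundle $\mathcal B=(B_g)_{g\in G}$ over $G$ with unit $e\in G$, let $C^*(\mathcal B)$ be its full cross-sectional $C^*$-algebra (the completion of the $*$-algebra $C_c(\mathcal B)$ of finitely supported sections in its largest $C^*$-seminorm), and let $C^*_r(\mathcal B)$ be its reduced cross-sectional $C^*$-algebra (the completion of $C_c(\mathcal B)$ in the operator norm of its action by left convolution on the Hilbert $B_e$-module $\ell^2(\mathcal B)$). We write $C^*(\mathcal B)=C^*_r(\mathcal B)$ if the left regular representation $\Lambda\colon C^*(\mathcal B)\to C^*_r(\mathcal B)$ is an isomorphism. The bundle $\mathcal B$ has *(Exel's) approximation property* if there is a net $(\xi_i\colon G\to B_e)_{i\in I}$ of finitely supported functions with $$\sup_{i}\Big\|\sum_{g\in G}\xi_i(g)^*\xi_i(g)\Big\|<\infty\qquad\text{and}\qquad \lim_i\sum_{h\in G}\xi_i(gh)^*\,b\,\xi_i(h)=b\quad\text{for all } g\in G,\ b\in B_g .$$ A $C^*$-algebra $A$ is *nuclear* if for every $C^*$-algebra $D$ the maximal and the minimal $C^*$-norm on the algebraic tensor product $A\odot D$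 coincide. Let $\mu\in\{\max,\min\}$. For Fell bundles $\mathcal A=(A_g)_{g\in G}$ and $\mathcal B=(B_g)_{g\in G}$, the Fell bundle $\mathcal A\otimes_\mu\mathcal B$ over $G$ has as its fibre at $g$ the completion $A_g\otimes_\mu B_g$ of $A_g\odot B_g$, realised as the closure of $A_g\odot B_g$ in $C^*(\mathcal A)\otimes_\mu C^*(\mathcal B)$; its operations extend $(a\otimes b)(a'\otimes b')=aa'\otimes bb'$ and $(a\otimes b)^*=a^*\otimes b^*$. A *partial action* $\alpha=(\{A_g\}_{g\in G},\{\alpha_g\}_{g\in G})$ of $G$ on a $C^*$-algebra $A$ consists of closed two-sided ideals $A_g$ of $A$ and $*$-isomorphisms $\alpha_g\colon A_{g^{-1}}\to A_g$ such that $A_e=A$, $\alpha_e=\mathrm{id}_A$, $\alpha_g(A_{g^{-1}}\cap A_h)\subseteq A_{gh}$, and $\alpha_g\circ\alpha_h=\alpha_{gh}$ on $A_{h^{-1}}\cap A_{(gh)^{-1}}$, for all $g,h\in G$. Its semidirect product bundle $\mathcal B_\alpha$ is the Fell bundle with fibres $A_g\delta_g$ (with the norm of $A_g$), product $(a\delta_g)(b\delta_h)=\alpha_g(\alpha_{g^{-1}}(a)b)\delta_{gh}$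 and involution $(a\delta_g)^*=\alpha_{g^{-1}}(a^*)\delta_{g^{-1}}$. We put $A\rtimes_\alpha G=C^*(\mathcal B_\alpha)$ and $A\rtimes_{\alpha,r}G=C^*_r(\mathcal B_\alpha)$, and we say that $\alpha$ has the approximation property if $\mathcal B_\alpha$ has it. **Proposition.** Let $\mathcal A$ and $\mathcal B$ be Fell bundles over $G$ with unit fibre algebras $A$ and $B$, and let $\mu\in\{\max,\min\}$. The norm of the unit fibre of $\mathcal A\otimes_\mu\mathcal B$ restricts to the maximal, respectively minimal, $C^*$-norm on $A\odot B$, so that this unit fibre is the $C^*$-algebra $A\otimes_\mu B$. If $\mathcal A$ has the approximation property, then 1. $\mathcal A\otimes_\mu\mathcal B$ has the approximation property; 2. $C^*(\mathcal A\otimes_\mu\mathcal B)=C^*_r(\mathcal A\otimes_\mu\mathcal B)$; 3. if, in addition, $A$ and $B$ are nuclear, then $C^*(\mathcal A\otimes_\mu\mathcal B)$ is nuclear. **Corollary.** Let $\alpha$ and $\beta$ be partial actions of $G$ on $C^*$-algebras $A$ and $B$, respectively, and let $\mu\in\{\max,\min\}$. There is a unique partial action $\alpha\otimes\beta$ of $G$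 on $A\otimes_\mu B$ (the *diagonal partial action*) whose ideal at each $g\in G$ is $A_g\otimes_\mu B_g$, the closed linear span of $\{a\otimes b: a\in A_g,\ b\in B_g\}$ in $A\otimes_\mu B$, and which satisfies $(\alpha\otimes\beta)_g(a\otimes b)=\alpha_g(a)\otimes\beta_g(b)$ for all $g\in G$, $a\in A_{g^{-1}}$ and $b\in B_{g^{-1}}$. If $\alpha$ has the approximation property, then 1. $\alpha\otimes\beta$ has the approximation property; 2. the left regular representation is an isomorphism $(A\otimes_\mu B)\rtimes_{\alpha\otimes\beta}G\to(A\otimes_\mu B)\rtimes_{\alpha\otimes\beta,r}G$; 3. if, in addition, $A$ and $B$ are nuclear, then $(A\otimes_\mu B)\rtimes_{\alpha\otimes\beta}G$ is nuclear. -/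

import Mathlib

universe u
open UniformSpace
open scoped TensorProduct

noncomputable section

/-- A C*-seminorm on a (not necessarily unital) complex *-algebra. -/
structure CStarSeminorm (R : Type u) [NonUnitalRing R] [StarRing R] [Module ℂ R]
    extends Seminorm ℂ R where
  mul_le' : ∀ x y : R, toFun (x * y) ≤ toFun x * toFun y
  star_mul_self' : ∀ x : R, toFun (star x * x) = toFun x * toFun x

namespace CStarSeminorm

variable {R : Type u} [NonUnitalRing R] [StarRing R] [Module ℂ R]

instance : CoeFun (CStarSeminorm R) (fun _ => R → ℝ) := ⟨fun p => p.toFun⟩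

theorem nonneg (p : CStarSeminorm R) (x : R) : 0 ≤ p x := apply_nonneg p.toSeminorm x

theorem add_le (p : CStarSeminorm R) (x y : R) : p (x + y) ≤ p x + p y := p.add_le' x y

theorem smul_eq (p : CStarSeminorm R) (c : ℂ) (x : R) : p (c • x) = ‖c‖ * p x := p.smul' c x

theorem star_eq (p : CStarSeminorm R) (x : R) : p (star x) = p x := by
  have key : ∀ y : R, p y ≤ p (star y) := by
    intro y
    have h1 : p y * p y ≤ p (star y) * p y := by
      rw [← p.star_mul_self']; exact p.mul_le' _ _
    rcases (p.nonneg y).eq_or_lt with h | h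
    · rw [← h]; exact p.nonneg _
    · exact le_of_mul_le_mul_right h1 h
  exact le_antisymm (by simpa using key (star x)) (key x)

/-- The pointwise supremum of a pointwise bounded family of C*-seminorms. -/
def sSup (S : Set (CStarSeminorm R)) (hS : ∀ x : R, ∃ M : ℝ, ∀ p ∈ S, p x ≤ M) :
    CStarSeminorm R where
  toFun x := ⨆ p : S, p.1 x
  map_zero' := by
    have : ∀ p : S, p.1 (0 : R) = 0 := fun p => p.1.map_zero'
    simp [this]
  add_le' x y := by
    have hb : ∀ z : R, BddAbove (Set.range fun p : S => p.1 z) := fun z => by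
      obtain ⟨M, hM⟩ := hS z; exact ⟨M, by rintro _ ⟨p, rfl⟩; exact hM p.1 p.2⟩
    refine Real.iSup_le (fun p => ?_)
      (add_nonneg (Real.iSup_nonneg fun p => p.1.nonneg x) (Real.iSup_nonneg fun p => p.1.nonneg y))
    exact (p.1.add_le x y).trans (add_le_add (le_ciSup (hb x) p) (le_ciSup (hb y) p))
  neg' x := by
    have : ∀ p : S, p.1 (-x) = p.1 x := fun p => p.1.neg' x
    simp [this]
  smul' c x := by
    have : ∀ p : S, p.1 (c • x) = ‖c‖ * p.1 x := fun p => p.1.smul' c x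
    simp only [this]
    exact (Real.mul_iSup_of_nonneg (norm_nonneg c) _).symm
  mul_le' x y := by
    have hb : ∀ z : R, BddAbove (Set.range fun p : S => p.1 z) := fun z => by
      obtain ⟨M, hM⟩ := hS z; exact ⟨M, by rintro _ ⟨p, rfl⟩; exact hM p.1 p.2⟩
    refine Real.iSup_le (fun p => ?_)
      (mul_nonneg (Real.iSup_nonneg fun p => p.1.nonneg x) (Real.iSup_nonneg fun p => p.1.nonneg y))
    exact (p.1.mul_le' x y).trans (mul_le_mul (le_ciSup (hb x) p) (le_ciSup (hb y) p)
      (p.1.nonneg y) (Real.iSup_nonneg fun p => p.1.nonneg x))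
  star_mul_self' x := by
    have hb : ∀ z : R, BddAbove (Set.range fun p : S => p.1 z) := fun z => by
      obtain ⟨M, hM⟩ := hS z; exact ⟨M, by rintro _ ⟨p, rfl⟩; exact hM p.1 p.2⟩
    have h0 : 0 ≤ ⨆ p : S, p.1 x := Real.iSup_nonneg fun p => p.1.nonneg x
    have h0' : 0 ≤ ⨆ p : S, p.1 (star x * x) := Real.iSup_nonneg fun p => p.1.nonneg _
    apply le_antisymm
    · refine Real.iSup_le (fun p => ?_) (mul_nonneg h0 h0)
      rw [p.1.star_mul_self' x]
      exact mul_le_mul (le_ciSup (hb x) p) (le_ciSup (hb x) p) (p.1.nonneg x) h0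
    · have : (⨆ p : S, p.1 x) ≤ √(⨆ p : S, p.1 (star x * x)) := by
        refine Real.iSup_le (fun p => ?_) (Real.sqrt_nonneg _)
        apply Real.le_sqrt_of_sq_le
        rw [pow_two, ← p.1.star_mul_self' x]
        exact le_ciSup (hb (star x * x)) p
      calc _ ≤ √(⨆ p : S, p.1 (star x * x)) * √(⨆ p : S, p.1 (star x * x)) :=
            mul_le_mul this this h0 (Real.sqrt_nonneg _)
        _ = _ := Real.mul_self_sqrt h0'

theorem le_sSup {S : Set (CStarSeminorm R)} {hS : ∀ x : R, ∃ M : ℝ, ∀ p ∈ S, p x ≤ M}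
    {p : CStarSeminorm R} (hp : p ∈ S) (x : R) : p x ≤ sSup S hS x := by
  obtain ⟨M, hM⟩ := hS x
  exact le_ciSup (f := fun p : S => p.1 x) ⟨M, by rintro _ ⟨p, rfl⟩; exact hM p.1 p.2⟩ ⟨p, hp⟩

theorem sSup_le {S : Set (CStarSeminorm R)} {hS : ∀ x : R, ∃ M : ℝ, ∀ p ∈ S, p x ≤ M}
    {x : R} {M : ℝ} (h0 : 0 ≤ M) (h : ∀ p ∈ S, p x ≤ M) : sSup S hS x ≤ M :=
  Real.iSup_le (fun p : S => h p.1 p.2) h0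

/-- The algebra `R`, regarded as a seminormed space by means of the C*-seminorm `p`. -/
@[nolint unusedArguments]
def Pre (_p : CStarSeminorm R) : Type u := R

variable (p : CStarSeminorm R)

instance : NonUnitalSeminormedRing p.Pre where
  __ := (inferInstanceAs (NonUnitalRing R) : NonUnitalRing p.Pre)
  __ := (AddGroupSeminorm.toSeminormedAddCommGroup (E := R) p.toAddGroupSeminorm :
    SeminormedAddCommGroup R)
  norm_mul_le x y := p.mul_le' x y

instance : StarRing p.Pre := inferInstanceAs (StarRing R)

instance : NormedSpace ℂ p.Pre where
  __ := (inferInstanceAs (Module ℂ R) : Module ℂ p.Pre)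
  norm_smul_le c x := (p.smul' c x).le

theorem pre_norm_star (x : p.Pre) : ‖star x‖ = ‖x‖ := p.star_eq x

theorem pre_norm_star_mul_self (x : p.Pre) : ‖star x * x‖ = ‖x‖ * ‖x‖ := p.star_mul_self' x

/-- The C*-algebra obtained from `R` by dividing out the null space of the C*-seminorm `p` and
completing. -/
def Alg : Type u := Completion p.Pre

instance : NormedAddCommGroup p.Alg := inferInstanceAs (NormedAddCommGroup (Completion p.Pre))
instance : NormedSpace ℂ p.Alg := inferInstanceAs (NormedSpace ℂ (Completion p.Pre))
instance : CompleteSpace p.Alg := inferInstanceAs (CompleteSpace (Completion p.Pre))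

/-- The canonical map from `R` to its completion. -/
def toAlg : R →ₗ[ℂ] p.Alg where
  toFun x := ((show p.Pre from x : p.Pre) : Completion p.Pre)
  map_add' x y := Completion.coe_add (α := p.Pre) x y
  map_smul' c x := Completion.coe_smul (X := p.Pre) c x

theorem norm_toAlg (x : R) : ‖p.toAlg x‖ = p x := Completion.norm_coe (E := p.Pre) x

theorem denseRange_toAlg : DenseRange p.toAlg := Completion.denseRange_coe (α := p.Pre)

@[elab_as_elim]
theorem alg_induction {P : p.Alg → Prop} (x : p.Alg) (hc : IsClosed {a | P a})
    (h : ∀ r : R, P (p.toAlg r)) : P x := Completion.induction_on (α := p.Pre) x hc h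

theorem isDenseInducing_pre : IsDenseInducing ((↑) : p.Pre → Completion p.Pre) :=
  Completion.isDenseInducing_coe

instance : Mul p.Alg :=
  ⟨Function.curry <| (p.isDenseInducing_pre.prodMap p.isDenseInducing_pre).extend
    (((↑) : p.Pre → Completion p.Pre) ∘ Function.uncurry (· * ·))⟩

instance : ContinuousMul p.Alg where
  continuous_mul := by
    let m := (AddMonoidHom.mul : p.Pre →+ p.Pre →+ p.Pre).compr₂ Completion.toCompl
    have : Continuous fun q : p.Pre × p.Pre => m q.1 q.2 :=
      (Completion.continuous_coe p.Pre).comp continuous_mul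
    have di : IsDenseInducing (Completion.toCompl : p.Pre → Completion p.Pre) :=
      Completion.isDenseInducing_coe
    exact (di.extend_Z_bilin di this :)

theorem toAlg_mul (x y : R) : p.toAlg (x * y) = p.toAlg x * p.toAlg y :=
  ((p.isDenseInducing_pre.prodMap p.isDenseInducing_pre).extend_eq
    ((Completion.continuous_coe p.Pre).comp (@continuous_mul p.Pre _ _ _)) (x, y)).symm

theorem isometry_star_pre : Isometry (star : p.Pre → p.Pre) :=
  AddMonoidHomClass.isometry_of_norm (starAddEquiv : p.Pre ≃+ p.Pre) p.pre_norm_star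

instance : Star p.Alg := ⟨Completion.map (star : p.Pre → p.Pre)⟩

theorem continuous_star_alg : Continuous (star : p.Alg → p.Alg) := Completion.continuous_map

theorem toAlg_star (x : R) : p.toAlg (star x) = star (p.toAlg x) :=
  (Completion.map_coe p.isometry_star_pre.uniformContinuous x).symm

@[elab_as_elim]
theorem alg_induction₂ {P : p.Alg → p.Alg → Prop} (x y : p.Alg)
    (hc : IsClosed {a : p.Alg × p.Alg | P a.1 a.2})
    (h : ∀ r s : R, P (p.toAlg r) (p.toAlg s)) : P x y :=
  Completion.induction_on₂ (α := p.Pre) (β := p.Pre) x y hc h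

@[elab_as_elim]
theorem alg_induction₃ {P : p.Alg → p.Alg → p.Alg → Prop} (x y z : p.Alg)
    (hc : IsClosed {a : p.Alg × p.Alg × p.Alg | P a.1 a.2.1 a.2.2})
    (h : ∀ r s t : R, P (p.toAlg r) (p.toAlg s) (p.toAlg t)) : P x y z :=
  Completion.induction_on₃ (α := p.Pre) (β := p.Pre) (γ := p.Pre) x y z hc h

instance : NonUnitalNormedRing p.Alg where
  __ := (inferInstance : NormedAddCommGroup p.Alg)
  __ := (inferInstance : Mul p.Alg)
  left_distrib a b c := by
    refine p.alg_induction₃ a b c (isClosed_eq (by fun_prop) (by fun_prop)) fun r s t => ?_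
    simp only [← map_add, ← toAlg_mul, mul_add]
  right_distrib a b c := by
    refine p.alg_induction₃ a b c (isClosed_eq (by fun_prop) (by fun_prop)) fun r s t => ?_
    simp only [← map_add, ← toAlg_mul, add_mul]
  zero_mul a := by
    refine p.alg_induction a (isClosed_eq (by fun_prop) (by fun_prop)) fun r => ?_
    rw [← map_zero p.toAlg, ← toAlg_mul, zero_mul]
  mul_zero a := by
    refine p.alg_induction a (isClosed_eq (by fun_prop) (by fun_prop)) fun r => ?_
    rw [← map_zero p.toAlg, ← toAlg_mul, mul_zero]
  mul_assoc a b c := by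
    refine p.alg_induction₃ a b c (isClosed_eq (by fun_prop) (by fun_prop)) fun r s t => ?_
    simp only [← toAlg_mul, mul_assoc]
  norm_mul_le a b := by
    refine p.alg_induction₂ a b (isClosed_le (by fun_prop) (by fun_prop)) fun r s => ?_
    simp only [← toAlg_mul, norm_toAlg]
    exact p.mul_le' r s

instance : ContinuousStar p.Alg := ⟨p.continuous_star_alg⟩

instance : StarRing p.Alg where
  star_involutive a := by
    refine p.alg_induction a (isClosed_eq (by fun_prop) (by fun_prop)) fun r => ?_
    rw [← toAlg_star, ← toAlg_star, star_star]
  star_mul a b := by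
    refine p.alg_induction₂ a b (isClosed_eq (by fun_prop) (by fun_prop)) fun r s => ?_
    simp only [← toAlg_star, ← toAlg_mul, star_mul]
  star_add a b := by
    refine p.alg_induction₂ a b (isClosed_eq (by fun_prop) (by fun_prop)) fun r s => ?_
    simp only [← map_add, ← toAlg_star, star_add]

instance : CStarRing p.Alg where
  norm_mul_self_le a := by
    refine p.alg_induction a (isClosed_le (by fun_prop) (by fun_prop)) fun r => ?_
    rw [← toAlg_star, ← toAlg_mul, norm_toAlg, norm_toAlg, p.star_mul_self']

theorem toAlg_smul (c : ℂ) (x : R) : p.toAlg (c • x) = c • p.toAlg x := map_smul _ _ _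

instance [IsScalarTower ℂ R R] : IsScalarTower ℂ p.Alg p.Alg where
  smul_assoc c a b := by
    change (c • a) * b = c • (a * b)
    refine p.alg_induction₂ a b (isClosed_eq ((continuous_fst.const_smul c).mul continuous_snd)
      (continuous_mul.const_smul c)) fun r s => ?_
    rw [← toAlg_smul, ← toAlg_mul, ← toAlg_mul, ← toAlg_smul, smul_mul_assoc]

instance [SMulCommClass ℂ R R] : SMulCommClass ℂ p.Alg p.Alg where
  smul_comm c a b := by
    change c • (a * b) = a * (c • b)
    refine p.alg_induction₂ a b (isClosed_eq (continuous_mul.const_smul c)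
      (continuous_fst.mul (continuous_snd.const_smul c))) fun r s => ?_
    rw [← toAlg_smul, ← toAlg_mul, ← toAlg_mul, ← toAlg_smul, mul_smul_comm]

instance [StarModule ℂ R] : StarModule ℂ p.Alg where
  star_smul c a := by
    refine p.alg_induction a (isClosed_eq (continuous_star.comp (continuous_const_smul c))
      (continuous_star.const_smul (star c))) fun r => ?_
    rw [← toAlg_smul, ← toAlg_star, ← toAlg_star, ← toAlg_smul, star_smul]

instance [IsScalarTower ℂ R R] [SMulCommClass ℂ R R] [StarModule ℂ R] :
    NonUnitalCStarAlgebra p.Alg where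

/-- For C*-seminorms `q ≤ p` on `R`, the *-homomorphism from the completion for `p` to the
completion for `q` that extends the identity of `R`. -/
def mapLE (p q : CStarSeminorm R) (h : ∀ x, q x ≤ p x) : p.Alg →⋆ₙₐ[ℂ] q.Alg where
  toFun := LinearMap.extendOfNorm q.toAlg p.toAlg
  map_smul' c a := map_smul _ c a
  map_zero' := map_zero _
  map_add' a b := map_add _ a b
  map_mul' a b := by
    have key : ∀ x, LinearMap.extendOfNorm q.toAlg p.toAlg (p.toAlg x) = q.toAlg x :=
      LinearMap.extendOfNorm_eq p.denseRange_toAlg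
        ⟨1, fun x => by rw [norm_toAlg, norm_toAlg, one_mul]; exact h x⟩
    refine p.alg_induction₂ a b (isClosed_eq (by fun_prop) (by fun_prop)) fun r s => ?_
    rw [← toAlg_mul, key, key, key, toAlg_mul]
  map_star' a := by
    have key : ∀ x, LinearMap.extendOfNorm q.toAlg p.toAlg (p.toAlg x) = q.toAlg x :=
      LinearMap.extendOfNorm_eq p.denseRange_toAlg
        ⟨1, fun x => by rw [norm_toAlg, norm_toAlg, one_mul]; exact h x⟩
    refine p.alg_induction a (isClosed_eq (by fun_prop) (by fun_prop)) fun r => ?_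
    rw [← toAlg_star, key, key, toAlg_star]

theorem mapLE_toAlg (p q : CStarSeminorm R) (h : ∀ x, q x ≤ p x) (x : R) :
    mapLE p q h (p.toAlg x) = q.toAlg x :=
  LinearMap.extendOfNorm_eq p.denseRange_toAlg
    ⟨1, fun x => by rw [norm_toAlg, norm_toAlg, one_mul]; exact h x⟩ x

end CStarSeminorm

/-! ### Tensor products of C*-algebras -/

section TensorStar

variable {A B : Type u} [NonUnitalRing A] [StarRing A] [Module ℂ A] [IsScalarTower ℂ A A]
  [SMulCommClass ℂ A A] [StarModule ℂ A] [NonUnitalRing B] [StarRing B] [Module ℂ B]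
  [IsScalarTower ℂ B B] [SMulCommClass ℂ B B] [StarModule ℂ B]

/-- The involution `(a ⊗ b)* = a* ⊗ b*` makes `A ⊗ B` a *-ring. -/
instance algebraicTensorStarRing : StarRing (A ⊗[ℂ] B) where
  star_mul x y := by
    induction x with
    | zero => simp
    | add x x' h h' => rw [add_mul, star_add, h, h', star_add, mul_add]
    | tmul a b =>
      induction y with
      | zero => simp
      | add y y' h h' => rw [mul_add, star_add, h, h', star_add, add_mul]
      | tmul c d => simp [Algebra.TensorProduct.tmul_mul_tmul]
  star_add := star_add

end TensorStar

section Tensor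

variable (A B : Type u) [NonUnitalCStarAlgebra A] [NonUnitalCStarAlgebra B]

/-- A C*-seminorm on `A ⊗ B` is subcross if it is at most `‖a‖ ‖b‖` on elementary tensors. -/
def CStarSeminorm.IsSubcross {A B : Type u} [NonUnitalCStarAlgebra A] [NonUnitalCStarAlgebra B]
    (p : CStarSeminorm (A ⊗[ℂ] B)) : Prop :=
  ∀ (a : A) (b : B), p (a ⊗ₜ b) ≤ ‖a‖ * ‖b‖

theorem CStarSeminorm.subcross_bounded {A B : Type u} [NonUnitalCStarAlgebra A]
    [NonUnitalCStarAlgebra B] (x : A ⊗[ℂ] B) :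
    ∃ M : ℝ, ∀ p ∈ {p : CStarSeminorm (A ⊗[ℂ] B) | p.IsSubcross}, p x ≤ M := by
  induction x with
  | zero => exact ⟨0, fun p _ => p.map_zero'.le⟩
  | tmul a b => exact ⟨‖a‖ * ‖b‖, fun p hp => hp a b⟩
  | add x y hx hy =>
    obtain ⟨M, hM⟩ := hx
    obtain ⟨N, hN⟩ := hy
    exact ⟨M + N, fun p hp => (p.add_le x y).trans (add_le_add (hM p hp) (hN p hp))⟩

/-- The maximal C*-norm on `A ⊗ B`: the largest C*-seminorm.  (Every C*-seminorm on `A ⊗ B` is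
automatically subcross, so that condition is no restriction.) -/
def maxTensorNorm : CStarSeminorm (A ⊗[ℂ] B) :=
  CStarSeminorm.sSup {p | p.IsSubcross} CStarSeminorm.subcross_bounded

variable {A B}

section Spatial

/-- Bounded operators on an inner product space. -/
abbrev BoundedOp (E : Type u) [NormedAddCommGroup E] [InnerProductSpace ℂ E] : Type u := E →L[ℂ] E

/-- The C*-seminorm `x ↦ ‖f x‖` defined by a *-representation `f` by bounded operators on an inner
product space. -/
def CStarSeminorm.ofRep {R E : Type u} [NonUnitalRing R] [StarRing R] [Module ℂ R]
    [NormedAddCommGroup E] [InnerProductSpace ℂ E] (f : R →ₗ[ℂ] BoundedOp E)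
    (hmul : ∀ x y, f (x * y) = f x * f y)
    (hstar : ∀ x v w, inner ℂ (f (star x) v) w = inner ℂ v (f x w)) : CStarSeminorm R where
  toFun x := ‖f x‖
  map_zero' := by simp
  add_le' x y := by rw [map_add]; exact norm_add_le _ _
  neg' x := by rw [map_neg, norm_neg]
  smul' c x := by rw [map_smul, norm_smul]
  mul_le' x y := by rw [hmul]; exact norm_mul_le _ _
  star_mul_self' := by
    have key : ∀ y : R, ‖f y‖ * ‖f y‖ ≤ ‖f (star y * y)‖ := by
      intro y
      have h1 : ‖f y‖ ≤ √‖f (star y * y)‖ := by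
        refine ContinuousLinearMap.opNorm_le_bound _ (Real.sqrt_nonneg _) fun v => ?_
        rw [← Real.sqrt_sq (norm_nonneg v), ← Real.sqrt_mul (norm_nonneg _)]
        apply Real.le_sqrt_of_sq_le
        calc ‖f y v‖ ^ 2 = ‖inner ℂ (f y v) (f y v)‖ := by
              rw [inner_self_eq_norm_sq_to_K]; simp
          _ = ‖inner ℂ (f (star y * y) v) v‖ := by
              rw [← hstar, hmul]; rfl
          _ ≤ ‖f (star y * y) v‖ * ‖v‖ := norm_inner_le_norm _ _
          _ ≤ ‖f (star y * y)‖ * ‖v‖ * ‖v‖ := by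
              gcongr; exact ContinuousLinearMap.le_opNorm _ _
          _ = _ := by ring
      calc _ ≤ √‖f (star y * y)‖ * √‖f (star y * y)‖ :=
            mul_le_mul h1 h1 (norm_nonneg _) (Real.sqrt_nonneg _)
        _ = _ := Real.mul_self_sqrt (norm_nonneg _)
    have key' : ∀ y : R, ‖f y‖ ≤ ‖f (star y)‖ := by
      intro y
      have h1 : ‖f y‖ * ‖f y‖ ≤ ‖f (star y)‖ * ‖f y‖ :=
        (key y).trans (by rw [hmul]; exact norm_mul_le _ _)
      rcases (norm_nonneg (f y)).eq_or_lt with h | h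
      · rw [← h]; exact norm_nonneg _
      · exact le_of_mul_le_mul_right h1 h
    intro x
    refine le_antisymm ?_ (key x)
    rw [hmul]
    refine (norm_mul_le _ _).trans ?_
    gcongr
    simpa using key' (star x)

variable {H K : Type u} [NormedAddCommGroup H] [InnerProductSpace ℂ H] [CompleteSpace H]
  [NormedAddCommGroup K] [InnerProductSpace ℂ K] [CompleteSpace K]

/-- The representation `a ⊗ b ↦ π a ⊗ ρ b` of `A ⊗ B` by bounded operators on the algebraic
tensor product `H ⊗ K`, with its inner product `⟪h ⊗ k, h' ⊗ k'⟫ = ⟪h, h'⟫ ⟪k, k'⟫`. -/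
def spatialRep (π : A →⋆ₙₐ[ℂ] (H →L[ℂ] H)) (ρ : B →⋆ₙₐ[ℂ] (K →L[ℂ] K)) :
    A ⊗[ℂ] B →ₗ[ℂ] BoundedOp (H ⊗[ℂ] K) :=
  TensorProduct.lift (LinearMap.mk₂ ℂ (fun a b => TensorProduct.mapL (π a) (ρ b))
    (fun a a' b => by simp [TensorProduct.mapL_add_left])
    (fun c a b => by simp [TensorProduct.mapL_smul_left])
    (fun a b b' => by simp [TensorProduct.mapL_add_right])
    (fun c a b => by simp [TensorProduct.mapL_smul_right]))

theorem spatialRep_tmul (π : A →⋆ₙₐ[ℂ] (H →L[ℂ] H)) (ρ : B →⋆ₙₐ[ℂ] (K →L[ℂ] K)) (a : A) (b : B) :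
    spatialRep π ρ (a ⊗ₜ b) = TensorProduct.mapL (π a) (ρ b) := rfl

theorem spatialRep_mul (π : A →⋆ₙₐ[ℂ] (H →L[ℂ] H)) (ρ : B →⋆ₙₐ[ℂ] (K →L[ℂ] K))
    (x y : A ⊗[ℂ] B) : spatialRep π ρ (x * y) = spatialRep π ρ x * spatialRep π ρ y := by
  induction x with
  | zero => simp
  | add x x' h h' => rw [add_mul, map_add, h, h', map_add, add_mul]
  | tmul a b =>
    induction y with
    | zero => simp
    | add y y' h h' => rw [mul_add, map_add, h, h', map_add, mul_add]
    | tmul c d =>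
      rw [Algebra.TensorProduct.tmul_mul_tmul]
      simp only [spatialRep_tmul, map_mul, TensorProduct.mapL_mul]

theorem spatialRep_star (π : A →⋆ₙₐ[ℂ] (H →L[ℂ] H)) (ρ : B →⋆ₙₐ[ℂ] (K →L[ℂ] K))
    (x : A ⊗[ℂ] B) (v w : H ⊗[ℂ] K) :
    inner ℂ (spatialRep π ρ (star x) v) w = inner ℂ v (spatialRep π ρ x w) := by
  induction x with
  | zero => simp
  | add x x' h h' =>
    simp only [star_add, map_add, add_apply, inner_add_left, inner_add_right,
      h, h']
  | tmul a b =>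
    induction v with
    | zero => simp
    | add v v' h h' => simp only [map_add, inner_add_left, h, h']
    | tmul h k =>
      induction w with
      | zero => simp
      | add w w' h h' => simp only [map_add, inner_add_right, h, h']
      | tmul h' k' =>
        simp only [TensorProduct.star_tmul, spatialRep_tmul, TensorProduct.mapL_tmul,
          TensorProduct.inner_tmul, map_star, ContinuousLinearMap.star_eq_adjoint,
          ContinuousLinearMap.adjoint_inner_left]

/-- The C*-seminorm `∑ aᵢ ⊗ bᵢ ↦ ‖∑ π aᵢ ⊗ ρ bᵢ‖` on `A ⊗ B` defined by representations `π` of `A`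
on `H` and `ρ` of `B` on `K`. (The operator norm on the algebraic tensor product `H ⊗ K` agrees
with the operator norm on its Hilbert space completion.) -/
def spatialSeminorm (π : A →⋆ₙₐ[ℂ] (H →L[ℂ] H)) (ρ : B →⋆ₙₐ[ℂ] (K →L[ℂ] K)) :
    CStarSeminorm (A ⊗[ℂ] B) :=
  CStarSeminorm.ofRep (spatialRep π ρ) (spatialRep_mul π ρ) (spatialRep_star π ρ)

theorem spatialSeminorm_isSubcross (π : A →⋆ₙₐ[ℂ] (H →L[ℂ] H)) (ρ : B →⋆ₙₐ[ℂ] (K →L[ℂ] K)) :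
    (spatialSeminorm π ρ).IsSubcross := by
  intro a b
  change ‖spatialRep π ρ (a ⊗ₜ b)‖ ≤ _
  rw [spatialRep_tmul]
  refine (TensorProduct.norm_mapL_le _ _).trans ?_
  gcongr
  · exact NonUnitalStarAlgHom.norm_apply_le π a
  · exact NonUnitalStarAlgHom.norm_apply_le ρ b

end Spatial

variable (A B)

/-- The spatial C*-seminorms on `A ⊗ B`, for all representations of `A` and `B` on Hilbert
spaces. -/
def spatialSeminorms : Set (CStarSeminorm (A ⊗[ℂ] B)) :=
  {p | ∃ (H K : Type u) (_ : NormedAddCommGroup H) (_ : InnerProductSpace ℂ H)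
    (_ : CompleteSpace H) (_ : NormedAddCommGroup K) (_ : InnerProductSpace ℂ K)
    (_ : CompleteSpace K) (π : A →⋆ₙₐ[ℂ] (H →L[ℂ] H)) (ρ : B →⋆ₙₐ[ℂ] (K →L[ℂ] K)),
    p = spatialSeminorm π ρ}

/-- The minimal (spatial) C*-norm on `A ⊗ B`: the supremum of `‖∑ π aᵢ ⊗ ρ bᵢ‖` over all
representations `π` of `A` and `ρ` of `B` on Hilbert spaces. -/
def minTensorNorm : CStarSeminorm (A ⊗[ℂ] B) :=
  CStarSeminorm.sSup (spatialSeminorms A B) fun x => by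
    obtain ⟨M, hM⟩ := CStarSeminorm.subcross_bounded x
    refine ⟨M, ?_⟩
    rintro p ⟨H, K, _, _, _, _, _, _, π, ρ, rfl⟩
    exact hM _ (spatialSeminorm_isSubcross π ρ)

/-- The two tensor products under consideration. -/
inductive TensorKind where
  | max
  | min

/-- The maximal or minimal C*-norm on `A ⊗ B`. -/
def tensorNorm (μ : TensorKind) : CStarSeminorm (A ⊗[ℂ] B) :=
  match μ with
  | .max => maxTensorNorm A B
  | .min => minTensorNorm A B

/-- The C*-algebra `A ⊗_μ B`, the completion of `A ⊗ B` in the maximal or minimal C*-norm. -/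
abbrev CStarTensor (μ : TensorKind) : Type u := (tensorNorm A B μ).Alg

/-- The element `a ⊗ b` of `A ⊗_μ B`. -/
def CStarTensor.mk {A B : Type u} [NonUnitalCStarAlgebra A] [NonUnitalCStarAlgebra B]
    (μ : TensorKind) (a : A) (b : B) : CStarTensor A B μ :=
  (tensorNorm A B μ).toAlg (a ⊗ₜ b)

/-- A C*-algebra `A` is nuclear if, for every C*-algebra `D`, the maximal and the minimal C*-norm
on `A ⊗ D` coincide. -/
def IsNuclear (A : Type u) [NonUnitalCStarAlgebra A] : Prop :=
  ∀ (D : Type u) [NonUnitalCStarAlgebra D] (x : A ⊗[ℂ] D),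
    tensorNorm A D .max x = tensorNorm A D .min x

end Tensor

/-! ### Fell bundles over discrete groups -/

open scoped DirectSum

/-- A Fell bundle over the discrete group `G`: Banach spaces `B_g` with bilinear multiplication maps
`B_g × B_h → B_{gh}` and conjugate-linear involutions `B_g → B_{g⁻¹}` satisfying the axioms below.
To avoid transporting elements along equations in `G`, the maps are indexed by the group elements
together with a proof of the relation between them. -/
structure FellBundle (G : Type u) [Group G] where
  fiber : G → Type u
  [normedFiber : ∀ g, NormedAddCommGroup (fiber g)]
  [spaceFiber : ∀ g, NormedSpace ℂ (fiber g)]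
  [completeFiber : ∀ g, CompleteSpace (fiber g)]
  mulMap : ∀ {g h k : G}, g * h = k → fiber g →ₗ[ℂ] fiber h →ₗ[ℂ] fiber k
  starMap : ∀ {g h : G}, g⁻¹ = h → fiber g →ₗ⋆[ℂ] fiber h
  assoc : ∀ {g h k l m n : G} (e₁ : g * h = l) (e₂ : l * k = n) (e₃ : h * k = m) (e₄ : g * m = n)
    (a : fiber g) (b : fiber h) (c : fiber k),
    mulMap e₂ (mulMap e₁ a b) c = mulMap e₄ a (mulMap e₃ b c)
  starMap_starMap : ∀ {g h : G} (e : g⁻¹ = h) (e' : h⁻¹ = g) (a : fiber g),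
    starMap e' (starMap e a) = a
  starMap_mulMap : ∀ {g h k g' h' k' : G} (e : g * h = k) (e₁ : k⁻¹ = k') (e₂ : g⁻¹ = g')
    (e₃ : h⁻¹ = h') (e₄ : h' * g' = k') (a : fiber g) (b : fiber h),
    starMap e₁ (mulMap e a b) = mulMap e₄ (starMap e₃ b) (starMap e₂ a)
  norm_mulMap_le : ∀ {g h k : G} (e : g * h = k) (a : fiber g) (b : fiber h),
    ‖mulMap e a b‖ ≤ ‖a‖ * ‖b‖
  norm_starMap : ∀ {g h : G} (e : g⁻¹ = h) (a : fiber g), ‖starMap e a‖ = ‖a‖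
  norm_starMap_mulMap_self : ∀ {g h : G} (e : g⁻¹ = h) (e' : h * g = 1) (a : fiber g),
    ‖mulMap e' (starMap e a) a‖ = ‖a‖ * ‖a‖
  /-- `a* a` is positive in the unit fibre. -/
  starMap_mulMap_self_pos : ∀ {g h : G} (e : g⁻¹ = h) (e' : h * g = 1) (a : fiber g),
    ∃ c : fiber 1, mulMap e' (starMap e a) a = mulMap (one_mul 1) (starMap inv_one c) c

attribute [instance] FellBundle.normedFiber FellBundle.spaceFiber FellBundle.completeFiber

namespace FellBundle

variable {G : Type u} [Group G] (B : FellBundle G)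

/-! The unit fibre is a C*-algebra. -/

instance : Mul (B.fiber 1) := ⟨fun a b => B.mulMap (one_mul 1) a b⟩

theorem unit_mul_def (a b : B.fiber 1) : a * b = B.mulMap (one_mul 1) a b := rfl

instance : Star (B.fiber 1) := ⟨fun a => B.starMap inv_one a⟩

theorem unit_star_def (a : B.fiber 1) : star a = B.starMap inv_one a := rfl

instance : NonUnitalNormedRing (B.fiber 1) where
  __ := (inferInstance : NormedAddCommGroup (B.fiber 1))
  __ := (inferInstance : Mul (B.fiber 1))
  left_distrib a b c := by simp [unit_mul_def]
  right_distrib a b c := by simp [unit_mul_def]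
  zero_mul a := by simp [unit_mul_def]
  mul_zero a := by simp [unit_mul_def]
  mul_assoc a b c := B.assoc _ _ _ _ a b c
  norm_mul_le a b := B.norm_mulMap_le _ a b

instance : StarRing (B.fiber 1) where
  star_involutive a := B.starMap_starMap _ _ a
  star_mul a b := B.starMap_mulMap _ _ _ _ _ a b
  star_add a b := map_add _ a b

instance : CStarRing (B.fiber 1) where
  norm_mul_self_le a := (B.norm_starMap_mulMap_self inv_one (one_mul 1) a).ge

instance : NonUnitalCStarAlgebra (B.fiber 1) where
  smul_assoc c a b := by
    change B.mulMap _ (c • a) b = c • B.mulMap _ a b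
    simp
  smul_comm c a b := by
    change c • B.mulMap _ a b = B.mulMap _ a (c • b)
    simp
  star_smul c a := by
    change B.starMap _ (c • a) = star c • B.starMap _ a
    simp

/-! ### The *-algebra of finitely supported sections -/

/-- The space `C_c(B)` of finitely supported sections of `B`. -/
def Sec : Type u := ⨁ g, B.fiber g

instance : AddCommGroup B.Sec := inferInstanceAs (AddCommGroup (⨁ g, B.fiber g))
instance : Module ℂ B.Sec := inferInstanceAs (Module ℂ (⨁ g, B.fiber g))

open Classical in
/-- The section `a δ_g` supported at `g`. -/
def single (g : G) : B.fiber g →ₗ[ℂ] B.Sec := DirectSum.lof ℂ G B.fiber g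

/-- The value of a section at `g`. -/
def eval (g : G) : B.Sec →ₗ[ℂ] B.fiber g := DirectSum.component ℂ G B.fiber g

theorem eval_single_same (g : G) (a : B.fiber g) : B.eval g (B.single g a) = a := by
  classical exact DirectSum.component.lof_self ℂ g a

theorem eval_single_ne {g h : G} (hgh : g ≠ h) (a : B.fiber g) : B.eval h (B.single g a) = 0 := by
  classical
  exact DirectSum.of_eq_of_ne (β := B.fiber) g h a (Ne.symm hgh)

theorem single_congr {g h k l : G} (e : g * h = k) (e' : g * h = l) (a : B.fiber g)
    (b : B.fiber h) : B.single k (B.mulMap e a b) = B.single l (B.mulMap e' a b) := by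
  subst e; subst e'; rfl

theorem single_starMap_congr {g h k : G} (e : g⁻¹ = h) (e' : g⁻¹ = k) (a : B.fiber g) :
    B.single h (B.starMap e a) = B.single k (B.starMap e' a) := by
  subst e; subst e'; rfl

@[elab_as_elim]
theorem sec_induction {P : B.Sec → Prop} (x : B.Sec) (h0 : P 0)
    (h1 : ∀ g (a : B.fiber g), P (B.single g a)) (h2 : ∀ x y, P x → P y → P (x + y)) : P x := by
  classical exact DirectSum.induction_on x h0 h1 h2

open Classical in
/-- Left convolution `(a δ_g) · x`. -/
def convolutionLeft (g : G) : B.fiber g →ₗ[ℂ] B.Sec →ₗ[ℂ] B.Sec :=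
  LinearMap.flip <| DirectSum.toModule ℂ G _ fun h =>
    LinearMap.flip ((B.mulMap (rfl : g * h = g * h)).compr₂ (B.single (g * h)))

open Classical in
/-- The convolution product, `(a δ_g)(b δ_h) = (ab) δ_{gh}`. -/
def convolution : B.Sec →ₗ[ℂ] B.Sec →ₗ[ℂ] B.Sec :=
  DirectSum.toModule ℂ G _ B.convolutionLeft

theorem convolution_single {g h k : G} (e : g * h = k) (a : B.fiber g) (b : B.fiber h) :
    B.convolution (B.single g a) (B.single h b) = B.single k (B.mulMap e a b) := by
  classical
  subst e
  have h1 : B.convolution (B.single g a) = B.convolutionLeft g a :=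
    DirectSum.toModule_lof ℂ (φ := B.convolutionLeft) g a
  rw [h1]
  exact LinearMap.congr_fun (DirectSum.toModule_lof ℂ (φ := fun h => LinearMap.flip
    ((B.mulMap (rfl : g * h = g * h)).compr₂ (B.single (g * h)))) h b) a

open Classical in
/-- The involution `(a δ_g)* = a* δ_{g⁻¹}`. -/
def involution : B.Sec →+ B.Sec :=
  DirectSum.toAddMonoid fun g =>
    (B.single g⁻¹).toAddMonoidHom.comp (B.starMap (rfl : g⁻¹ = g⁻¹)).toAddMonoidHom

theorem involution_single {g h : G} (e : g⁻¹ = h) (a : B.fiber g) :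
    B.involution (B.single g a) = B.single h (B.starMap e a) := by
  classical
  subst e
  exact DirectSum.toAddMonoid_of (β := B.fiber) (fun g => (B.single g⁻¹).toAddMonoidHom.comp
    (B.starMap (rfl : g⁻¹ = g⁻¹)).toAddMonoidHom) g a

instance : Mul B.Sec := ⟨fun x y => B.convolution x y⟩

theorem mul_def (x y : B.Sec) : x * y = B.convolution x y := rfl

instance : Star B.Sec := ⟨fun x => B.involution x⟩

theorem star_def (x : B.Sec) : star x = B.involution x := rfl

theorem single_mul_single {g h k : G} (e : g * h = k) (a : B.fiber g) (b : B.fiber h) :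
    B.single g a * B.single h b = B.single k (B.mulMap e a b) := B.convolution_single e a b

theorem star_single {g h : G} (e : g⁻¹ = h) (a : B.fiber g) :
    star (B.single g a) = B.single h (B.starMap e a) := B.involution_single e a

instance : NonUnitalNonAssocRing B.Sec where
  __ := (inferInstance : AddCommGroup B.Sec)
  __ := (inferInstance : Mul B.Sec)
  left_distrib x y z := by simp [mul_def]
  right_distrib x y z := by simp [mul_def]
  zero_mul x := by simp [mul_def]
  mul_zero x := by simp [mul_def]

instance : NonUnitalRing B.Sec where
  mul_assoc x y z := by
    refine B.sec_induction x (by simp) (fun g a => ?_) fun x x' h h' => by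
      simp only [add_mul, h, h']
    refine B.sec_induction y (by simp) (fun h b => ?_) fun y y' h h' => by
      simp only [add_mul, mul_add, h, h']
    refine B.sec_induction z (by simp) (fun k c => ?_) fun z z' h h' => by
      simp only [mul_add, h, h']
    rw [B.single_mul_single rfl, B.single_mul_single rfl, B.single_mul_single rfl,
      B.single_mul_single (mul_assoc g h k).symm, B.assoc rfl rfl rfl (mul_assoc g h k).symm]

instance : IsScalarTower ℂ B.Sec B.Sec where
  smul_assoc c x y := by
    change B.convolution (c • x) y = c • B.convolution x y
    simp

instance : SMulCommClass ℂ B.Sec B.Sec where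
  smul_comm c x y := by
    change c • B.convolution x y = B.convolution x (c • y)
    simp

instance : StarRing B.Sec where
  star_add x y := by simp [star_def]
  star_involutive x := by
    refine B.sec_induction x (by simp [star_def]) (fun g a => ?_) fun x y h h' => by
      rw [star_def] at h h' ⊢
      simp only [star_def, map_add] at h h' ⊢
      rw [h, h']
    rw [B.star_single rfl, B.star_single (inv_inv g), B.starMap_starMap]
  star_mul x y := by
    refine B.sec_induction x (by simp [star_def]) (fun g a => ?_) fun x x' h h' => by
      simp only [star_def] at h h' ⊢
      simp only [add_mul, map_add, mul_add, h, h']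
    refine B.sec_induction y (by simp [star_def]) (fun h b => ?_) fun y y' h h' => by
      simp only [star_def] at h h' ⊢
      simp only [add_mul, map_add, mul_add, h, h']
    rw [B.single_mul_single rfl, B.star_single rfl, B.star_single rfl, B.star_single rfl,
      B.single_mul_single (mul_inv_rev g h).symm,
      B.starMap_mulMap rfl rfl rfl rfl (mul_inv_rev g h).symm]

instance : StarModule ℂ B.Sec where
  star_smul c x := by
    refine B.sec_induction x (by simp) (fun g a => ?_) fun x y h h' => by
      simp only [star_def] at h h' ⊢
      simp only [smul_add, map_add, h, h']
    rw [← map_smul, B.star_single rfl, B.star_single rfl, ← map_smul, LinearMap.map_smulₛₗ]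
    rfl

end FellBundle

namespace FellBundle

variable {G : Type u} [Group G] (B : FellBundle G)

/-! ### The full and the reduced cross-sectional C*-algebras -/

/-- A C*-seminorm on `C_c(B)` is contractive on fibres if it is at most the given norm on each
fibre. -/
def FibreContractive (p : CStarSeminorm B.Sec) : Prop :=
  ∀ (g : G) (a : B.fiber g), p (B.single g a) ≤ ‖a‖

theorem fibreContractive_bounded (x : B.Sec) :
    ∃ M : ℝ, ∀ p ∈ {p : CStarSeminorm B.Sec | B.FibreContractive p}, p x ≤ M := by
  refine B.sec_induction x ⟨0, fun p _ => p.map_zero'.le⟩ (fun g a => ⟨‖a‖, fun p hp => hp g a⟩) ?_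
  rintro x y ⟨M, hM⟩ ⟨N, hN⟩
  exact ⟨M + N, fun p hp => (p.add_le x y).trans (add_le_add (hM p hp) (hN p hp))⟩

/-- The universal C*-seminorm on `C_c(B)`: the largest C*-seminorm. (Every C*-seminorm on `C_c(B)`
is automatically contractive on the unit fibre, which is a C*-algebra, and hence on all fibres, so
that the condition on fibres is no restriction.) -/
def fullNorm : CStarSeminorm B.Sec :=
  CStarSeminorm.sSup {p | B.FibreContractive p} B.fibreContractive_bounded

/-- The (full) cross-sectional C*-algebra `C*(B)`. -/
abbrev FullAlg : Type u := B.fullNorm.Alg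

/-- The `B_e`-valued inner product `⟪x, y⟫ = ∑ g, x(g)* y(g)` on `C_c(B)`, which is the value at the
unit of the convolution `x* y`. -/
def innerSec (x y : B.Sec) : B.fiber 1 := B.eval 1 (star x * y)

/-- The norm `‖⟪x, x⟫‖^{1/2}` of `x`, regarded as an element of the Hilbert `B_e`-module `ℓ²(B)`. -/
def moduleNorm (x : B.Sec) : ℝ := √‖B.innerSec x x‖

theorem eval_star (x : B.Sec) : B.eval 1 (star x) = star (B.eval 1 x) := by
  refine B.sec_induction x (by simp) (fun g a => ?_) fun x y h h' => by
    simp only [star_add, map_add, h, h']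
  rw [B.star_single rfl]
  by_cases hg : g = 1
  · subst hg
    rw [B.single_starMap_congr rfl inv_one, B.eval_single_same, B.eval_single_same]
    rfl
  · rw [B.eval_single_ne (by simpa using hg), B.eval_single_ne hg, star_zero]

theorem eval_mul_unit (x : B.Sec) (w : B.fiber 1) :
    B.eval 1 (x * B.single 1 w) = B.eval 1 x * w := by
  refine B.sec_induction x (by simp) (fun g a => ?_) fun x y h h' => by
    simp only [add_mul, map_add, h, h']
  rw [B.single_mul_single (mul_one g)]
  by_cases hg : g = 1
  · subst hg
    rw [B.eval_single_same, B.eval_single_same]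
    rfl
  · rw [B.eval_single_ne hg, B.eval_single_ne hg, zero_mul]

theorem eval_unit_mul (x : B.Sec) (w : B.fiber 1) :
    B.eval 1 (B.single 1 w * x) = w * B.eval 1 x := by
  have := congrArg star (B.eval_mul_unit (star x) (star w))
  rw [star_mul, ← B.eval_star, ← B.eval_star, star_mul, star_star, star_star] at this
  rwa [B.star_single inv_one, ← B.unit_star_def, star_star] at this

theorem innerSec_star (x y : B.Sec) : star (B.innerSec x y) = B.innerSec y x := by
  rw [innerSec, ← B.eval_star, star_mul, star_star, innerSec]

theorem innerSec_single_same {g : G} (a b : B.fiber g) :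
    B.innerSec (B.single g a) (B.single g b) =
      B.mulMap (inv_mul_cancel g) (B.starMap rfl a) b := by
  rw [innerSec, B.star_single rfl, B.single_mul_single (inv_mul_cancel g), B.eval_single_same]

theorem eval_single_star_mul_single_ne {g h : G} (hgh : g ≠ h) (a : B.fiber g) (b : B.fiber h) :
    B.eval 1 (star (B.single g a) * B.single h b) = 0 := by
  rw [B.star_single rfl, B.single_mul_single rfl, B.eval_single_ne]
  intro e
  exact hgh (inv_mul_eq_one.mp e)

/-- Sections are finite sums of their values. -/
theorem sec_eq_sum (x : B.Sec) : ∃ s : Finset G, x = ∑ g ∈ s, B.single g (B.eval g x) := by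
  classical exact ⟨DFinsupp.support x, (DirectSum.sum_support_of x).symm⟩

theorem single_unit_mul {g : G} (c : B.fiber 1) (a : B.fiber g) :
    B.single 1 c * B.single g a = B.single g (B.mulMap (one_mul g) c a) :=
  B.single_mul_single _ _ _

/-- The diagonal form of `⟪x, c y⟫` for `c` in the unit fibre. -/
theorem innerSec_sum (s : Finset G) (a : ∀ g, B.fiber g) (c : B.fiber 1) :
    B.innerSec (∑ g ∈ s, B.single g (a g)) (B.single 1 c * ∑ g ∈ s, B.single g (a g)) =
      ∑ g ∈ s, B.innerSec (B.single g (a g)) (B.single 1 c * B.single g (a g)) := by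
  simp only [innerSec, star_sum, Finset.mul_sum, Finset.sum_mul, map_sum]
  refine Finset.sum_congr rfl fun g hg => ?_
  rw [Finset.sum_eq_single g]
  · intro h _ hne
    rw [B.single_unit_mul, B.eval_single_star_mul_single_ne hne]
  · exact fun h => absurd hg h

section Order

attribute [local instance] CStarAlgebra.spectralOrder CStarAlgebra.spectralOrderedRing

theorem innerSec_single_nonneg {g : G} (a : B.fiber g) :
    0 ≤ B.innerSec (B.single g a) (B.single g a) := by
  rw [B.innerSec_single_same]
  obtain ⟨c, hc⟩ := B.starMap_mulMap_self_pos rfl (inv_mul_cancel g) a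
  rw [hc]
  exact star_mul_self_nonneg c

theorem innerSec_self_sum (s : Finset G) (a : ∀ g, B.fiber g) :
    B.innerSec (∑ g ∈ s, B.single g (a g)) (∑ g ∈ s, B.single g (a g)) =
      ∑ g ∈ s, B.innerSec (B.single g (a g)) (B.single g (a g)) := by
  simp only [innerSec, star_sum, Finset.mul_sum, Finset.sum_mul, map_sum]
  refine Finset.sum_congr rfl fun g hg => ?_
  rw [Finset.sum_eq_single g]
  · intro h _ hne
    rw [B.eval_single_star_mul_single_ne hne]
  · exact fun h => absurd hg h

theorem innerSec_self_nonneg (x : B.Sec) : 0 ≤ B.innerSec x x := by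
  obtain ⟨s, hs⟩ := B.sec_eq_sum x
  rw [hs, B.innerSec_self_sum]
  exact Finset.sum_nonneg fun g _ => B.innerSec_single_nonneg _

theorem norm_innerSec_single {g : G} (a : B.fiber g) :
    ‖B.innerSec (B.single g a) (B.single g a)‖ = ‖a‖ * ‖a‖ := by
  rw [B.innerSec_single_same]
  exact B.norm_starMap_mulMap_self _ _ a

theorem continuous_mulMap {g h k : G} (e : g * h = k) :
    Continuous fun q : B.fiber g × B.fiber h => B.mulMap e q.1 q.2 :=
  ((B.mulMap e).mkContinuous₂ 1 fun a b => by
    rw [one_mul]; exact B.norm_mulMap_le e a b).continuous₂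

theorem continuous_starMap {g h : G} (e : g⁻¹ = h) : Continuous (B.starMap e) :=
  (AddMonoidHomClass.isometry_of_norm (B.starMap e) (B.norm_starMap e)).continuous

theorem norm_mulMap_starMap_self {g : G} (a : B.fiber g) :
    ‖B.mulMap (mul_inv_cancel g) a (B.starMap rfl a)‖ = ‖a‖ * ‖a‖ := by
  have h := B.norm_starMap_mulMap_self (inv_inv g) (mul_inv_cancel g) (B.starMap rfl a)
  rwa [B.starMap_starMap, B.norm_starMap] at h

/-- Left multiplication by an approximate unit of `B_e` converges on each fibre. -/
theorem tendsto_unit_mul {g : G} (a : B.fiber g) :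
    Filter.Tendsto (fun c : B.fiber 1 => B.mulMap (one_mul g) c a)
      (CStarAlgebra.approximateUnit (B.fiber 1)) (nhds a) := by
  have hu := CStarAlgebra.increasingApproximateUnit (B.fiber 1)
  set d : B.fiber 1 := B.mulMap (mul_inv_cancel g) a (B.starMap rfl a) with hd
  have key : ∀ c : B.fiber 1, ‖c‖ ≤ 1 →
      ‖B.mulMap (one_mul g) c a - a‖ ≤ √(2 * ‖c * d - d‖) := by
    intro c hc
    apply Real.le_sqrt_of_sq_le
    rw [pow_two, ← B.norm_mulMap_starMap_self, map_sub (B.starMap rfl),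
      B.starMap_mulMap (one_mul g) rfl inv_one rfl (mul_one g⁻¹)]
    have h1 : B.mulMap (mul_inv_cancel g) (B.mulMap (one_mul g) c a - a)
        (B.mulMap (mul_one g⁻¹) (B.starMap rfl a) (B.starMap inv_one c) - B.starMap rfl a) =
        (c * d - d) * star c - (c * d - d) := by
      have h2 : ∀ b : B.fiber g, B.mulMap (mul_inv_cancel g) b
          (B.mulMap (mul_one g⁻¹) (B.starMap rfl a) (B.starMap inv_one c)) =
          B.mulMap (mul_inv_cancel g) b (B.starMap rfl a) * star c := fun b =>
        (B.assoc (mul_inv_cancel g) (mul_one 1) (mul_one g⁻¹) (mul_inv_cancel g) _ _ _).symm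
      have h3 : B.mulMap (mul_inv_cancel g) (B.mulMap (one_mul g) c a) (B.starMap rfl a) = c * d :=
        B.assoc (one_mul g) (mul_inv_cancel g) (mul_inv_cancel g) (one_mul 1) _ _ _
      rw [map_sub, h2, map_sub, LinearMap.sub_apply, h3]
    rw [h1]
    calc _ ≤ ‖(c * d - d) * star c‖ + ‖c * d - d‖ := norm_sub_le _ _
      _ ≤ ‖c * d - d‖ * ‖star c‖ + ‖c * d - d‖ := by gcongr; exact norm_mul_le _ _
      _ ≤ ‖c * d - d‖ * 1 + ‖c * d - d‖ := by rw [norm_star]; gcongr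
      _ = _ := by ring
  rw [tendsto_iff_norm_sub_tendsto_zero]
  have h0 : Filter.Tendsto (fun c : B.fiber 1 => √(2 * ‖c * d - d‖))
      (CStarAlgebra.approximateUnit (B.fiber 1)) (nhds 0) := by
    have h1 := tendsto_iff_norm_sub_tendsto_zero.mp (hu.tendsto_mul_right d)
    have h2 := (Real.continuous_sqrt.tendsto _).comp (h1.const_mul 2)
    rw [mul_zero, Real.sqrt_zero] at h2
    exact h2
  refine squeeze_zero' (Filter.Eventually.of_forall fun c => norm_nonneg _) ?_ h0
  filter_upwards [hu.eventually_norm] with c hc using key c hc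

theorem innerSec_mul_unit_self {g : G} (a : B.fiber g) (c d : B.fiber 1) :
    B.innerSec (B.single g (B.mulMap (one_mul g) c a))
      (B.single 1 d * B.single g (B.mulMap (one_mul g) c a)) =
    B.innerSec (B.single g a) (B.single 1 (star c * d * c) * B.single g a) := by
  have h : B.single 1 (star c * d * c) = star (B.single 1 c) * B.single 1 d * B.single 1 c := by
    rw [B.star_single inv_one, B.single_mul_single (one_mul 1), B.single_mul_single (one_mul 1)]
    rfl
  rw [h, ← B.single_unit_mul, innerSec, innerSec, star_mul]
  simp only [mul_assoc]

theorem innerSec_single_mul_nonneg {g : G} (a : B.fiber g) (c : B.fiber 1) (hc : 0 ≤ c) :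
    0 ≤ B.innerSec (B.single g a) (B.single 1 c * B.single g a) := by
  obtain ⟨s, rfl⟩ := CStarAlgebra.nonneg_iff_eq_star_mul_self.mp hc
  have h : B.single 1 (star s * s) = star (B.single 1 s) * B.single 1 s := by
    rw [B.star_single inv_one, B.single_mul_single (one_mul 1)]
    rfl
  have h' := B.innerSec_single_nonneg (B.mulMap (one_mul g) s a)
  rw [← B.single_unit_mul, innerSec, star_mul] at h'
  rw [h, innerSec]
  simpa only [mul_assoc] using h'

theorem innerSec_single_mul_le {g : G} (a : B.fiber g) (c : B.fiber 1) (hc : 0 ≤ c) :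
    B.innerSec (B.single g a) (B.single 1 c * B.single g a) ≤
      ‖c‖ • B.innerSec (B.single g a) (B.single g a) := by
  have hu := CStarAlgebra.increasingApproximateUnit (B.fiber 1)
  let F : B.fiber g → B.fiber 1 := fun b =>
    ‖c‖ • B.innerSec (B.single g b) (B.single g b) -
      B.innerSec (B.single g b) (B.single 1 c * B.single g b)
  have hF : Continuous F := by
    have h1 : F = fun b => ‖c‖ • B.mulMap (inv_mul_cancel g) (B.starMap rfl b) b -
        B.mulMap (inv_mul_cancel g) (B.starMap rfl b) (B.mulMap (one_mul g) c b) := by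
      funext b
      simp only [F, B.single_unit_mul, B.innerSec_single_same]
    rw [h1]
    refine Continuous.sub (Continuous.const_smul ?_ _) ?_
    · exact (B.continuous_mulMap _).comp ((B.continuous_starMap rfl).prodMk continuous_id)
    · exact (B.continuous_mulMap _).comp ((B.continuous_starMap rfl).prodMk
        ((B.continuous_mulMap _).comp (continuous_const.prodMk continuous_id)))
  have hlim : Filter.Tendsto (fun u => F (B.mulMap (one_mul g) u a))
      (CStarAlgebra.approximateUnit (B.fiber 1)) (nhds (F a)) :=
    (hF.tendsto a).comp (B.tendsto_unit_mul a)
  have hpos : ∀ u : B.fiber 1, 0 ≤ F (B.mulMap (one_mul g) u a) := by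
    intro u
    have h1 := B.innerSec_mul_unit_self a u c
    have h2 : B.innerSec (B.single g (B.mulMap (one_mul g) u a))
        (B.single g (B.mulMap (one_mul g) u a)) =
        B.innerSec (B.single g a) (B.single 1 (star u * u) * B.single g a) := by
      have h : B.single 1 (star u * u) = star (B.single 1 u) * B.single 1 u := by
        rw [B.star_single inv_one, B.single_mul_single (one_mul 1)]
        rfl
      rw [h, ← B.single_unit_mul, innerSec, innerSec, star_mul]
      simp only [mul_assoc]
    have h3 : F (B.mulMap (one_mul g) u a) = B.innerSec (B.single g a)
        (B.single 1 (‖c‖ • (star u * u) - star u * c * u) * B.single g a) := by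
      simp only [F]
      rw [h1, h2]
      have h4 : B.single 1 (‖c‖ • (star u * u) - star u * c * u) =
          (‖c‖ : ℂ) • B.single 1 (star u * u) - B.single 1 (star u * c * u) := by
        rw [map_sub, ← map_smul]
        rfl
      rw [h4, sub_mul, smul_mul_assoc]
      simp only [innerSec, mul_sub, map_sub, mul_smul_comm, map_smul]
      rfl
    rw [h3]
    refine B.innerSec_single_mul_nonneg a _ (sub_nonneg.mpr ?_)
    exact CStarAlgebra.star_left_conjugate_le_norm_smul (hb := IsSelfAdjoint.of_nonneg hc)
  exact sub_nonneg.mp (ge_of_tendsto' hlim hpos)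

theorem innerSec_add_add (x y : B.Sec) : B.innerSec (x + y) (x + y) =
    B.innerSec x x + B.innerSec x y + B.innerSec y x + B.innerSec y y := by
  simp only [innerSec, star_add, add_mul, mul_add, map_add]
  abel

/-- The Cauchy-Schwarz inequality. -/
theorem norm_innerSec_le (x y : B.Sec) : ‖B.innerSec x y‖ ≤ B.moduleNorm x * B.moduleNorm y := by
  set w := B.innerSec x y with hw
  have hyx : B.innerSec y x = star w := (B.innerSec_star x y).symm
  have hq : ∀ t : ℝ, (2 * t) • (star w * w) ≤
      star w * B.innerSec x x * w + (t * t) • B.innerSec y y := by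
    intro t
    have h0 := B.innerSec_self_nonneg (x * B.single 1 w - (t : ℂ) • y)
    have h1 : B.innerSec (x * B.single 1 w - (t : ℂ) • y) (x * B.single 1 w - (t : ℂ) • y) =
        star w * B.innerSec x x * w + (t * t) • B.innerSec y y - (2 * t) • (star w * w) := by
      have e1 : B.eval 1 (star (B.single 1 w) * star x * (x * B.single 1 w)) =
          star w * B.innerSec x x * w := by
        rw [B.star_single inv_one, ← B.unit_star_def, mul_assoc, ← mul_assoc (star x),
          B.eval_unit_mul, B.eval_mul_unit, mul_assoc]
        rfl
      have e2 : B.eval 1 (star (B.single 1 w) * star x * y) = star w * w := by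
        rw [B.star_single inv_one, ← B.unit_star_def, mul_assoc, B.eval_unit_mul]
        rfl
      have e3 : B.eval 1 (star y * (x * B.single 1 w)) = star w * w := by
        rw [← mul_assoc, B.eval_mul_unit, ← hyx]
        rfl
      have e4 : B.eval 1 (star y * y) = B.innerSec y y := rfl
      have ht : star (t : ℂ) = (t : ℂ) := Complex.conj_ofReal t
      rw [innerSec]
      simp only [star_sub, star_mul, star_smul, sub_mul, mul_sub, map_sub, ht,
        smul_mul_assoc, mul_smul_comm, map_smul, e1, e2, e3, e4]
      rw [← Complex.coe_smul, ← Complex.coe_smul]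
      push_cast
      module
    rw [h1] at h0
    exact sub_nonneg.mp h0
  have hX : star w * B.innerSec x x * w ≤ ‖B.innerSec x x‖ • (star w * w) :=
    CStarAlgebra.star_left_conjugate_le_norm_smul
      (hb := IsSelfAdjoint.of_nonneg (B.innerSec_self_nonneg x))
  have hn : ∀ t : ℝ, 0 ≤ t → 2 * t * (‖w‖ * ‖w‖) ≤
      ‖B.innerSec x x‖ * (‖w‖ * ‖w‖) + t * t * ‖B.innerSec y y‖ := by
    intro t ht
    have h1 : (2 * t) • (star w * w) ≤
        ‖B.innerSec x x‖ • (star w * w) + (t * t) • B.innerSec y y :=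
      (hq t).trans (by gcongr)
    have h2 := CStarAlgebra.norm_le_norm_of_nonneg_of_le
      (smul_nonneg (by positivity) (star_mul_self_nonneg w)) h1
    calc 2 * t * (‖w‖ * ‖w‖) = ‖(2 * t) • (star w * w)‖ := by
          rw [norm_smul, CStarRing.norm_star_mul_self, Real.norm_of_nonneg (by positivity)]
      _ ≤ _ := h2
      _ ≤ ‖‖B.innerSec x x‖ • (star w * w)‖ + ‖(t * t) • B.innerSec y y‖ := norm_add_le _ _
      _ = _ := by
          rw [norm_smul, norm_smul, CStarRing.norm_star_mul_self,
            Real.norm_of_nonneg (norm_nonneg _), Real.norm_of_nonneg (by positivity)]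
  have hfin : ‖w‖ * ‖w‖ ≤ ‖B.innerSec x x‖ * ‖B.innerSec y y‖ := by
    have hw0 : 0 ≤ ‖w‖ * ‖w‖ := by positivity
    have hy0 : 0 ≤ ‖B.innerSec y y‖ := norm_nonneg _
    rcases (norm_nonneg (B.innerSec x x)).eq_or_lt with hx | hx
    · rw [← hx] at hn ⊢
      by_contra hc
      rw [zero_mul, not_le] at hc
      have h3 := hn (‖w‖ * ‖w‖ / (‖B.innerSec y y‖ + 1)) (by positivity)
      rw [zero_mul, zero_add] at h3
      have h4 : ‖w‖ * ‖w‖ / (‖B.innerSec y y‖ + 1) * ‖B.innerSec y y‖ ≤ ‖w‖ * ‖w‖ := by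
        rw [div_mul_eq_mul_div, div_le_iff₀ (by positivity)]
        nlinarith
      have h5 : 0 < ‖w‖ * ‖w‖ / (‖B.innerSec y y‖ + 1) := by positivity
      nlinarith
    · have h3 := hn ‖B.innerSec x x‖ hx.le
      have h4 : ‖B.innerSec x x‖ * (‖w‖ * ‖w‖) ≤
          ‖B.innerSec x x‖ * (‖B.innerSec x x‖ * ‖B.innerSec y y‖) := by nlinarith
      exact le_of_mul_le_mul_left h4 hx
  rw [moduleNorm, moduleNorm, ← Real.sqrt_mul (norm_nonneg _)]
  exact Real.le_sqrt_of_sq_le (by rw [pow_two]; exact hfin)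

theorem moduleNorm_nonneg (x : B.Sec) : 0 ≤ B.moduleNorm x := Real.sqrt_nonneg _

theorem moduleNorm_mul_self (x : B.Sec) :
    B.moduleNorm x * B.moduleNorm x = ‖B.innerSec x x‖ := Real.mul_self_sqrt (norm_nonneg _)

theorem moduleNorm_add_le (x y : B.Sec) :
    B.moduleNorm (x + y) ≤ B.moduleNorm x + B.moduleNorm y := by
  refine Real.sqrt_le_iff.mpr ⟨add_nonneg (B.moduleNorm_nonneg x) (B.moduleNorm_nonneg y), ?_⟩
  rw [B.innerSec_add_add]
  have h1 := B.norm_innerSec_le x y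
  have h2 := B.norm_innerSec_le y x
  have h3 := B.moduleNorm_mul_self x
  have h4 := B.moduleNorm_mul_self y
  have h5 : ‖B.innerSec x x + B.innerSec x y + B.innerSec y x + B.innerSec y y‖ ≤
      ‖B.innerSec x x‖ + ‖B.innerSec x y‖ + ‖B.innerSec y x‖ + ‖B.innerSec y y‖ := norm_add₄_le
  nlinarith

theorem moduleNorm_smul (c : ℂ) (x : B.Sec) : B.moduleNorm (c • x) = ‖c‖ * B.moduleNorm x := by
  have h : B.innerSec (c • x) (c • x) = (star c * c) • B.innerSec x x := by
    simp only [innerSec, star_smul, smul_mul_assoc, mul_smul_comm, map_smul, smul_smul]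
    rw [mul_comm]
  rw [moduleNorm, h, norm_smul, norm_mul, norm_star, Real.sqrt_mul (by positivity),
    Real.sqrt_mul_self (norm_nonneg c)]
  rfl

theorem moduleNorm_single_mul_le {g : G} (a : B.fiber g) (x : B.Sec) :
    B.moduleNorm (B.single g a * x) ≤ ‖a‖ * B.moduleNorm x := by
  set c : B.fiber 1 := B.mulMap (inv_mul_cancel g) (B.starMap rfl a) a with hc
  have hc0 : 0 ≤ c := by
    have := B.innerSec_single_nonneg a
    rwa [B.innerSec_single_same] at this
  have hcn : ‖c‖ = ‖a‖ * ‖a‖ := B.norm_starMap_mulMap_self rfl _ a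
  have h1 : B.innerSec (B.single g a * x) (B.single g a * x) =
      B.innerSec x (B.single 1 c * x) := by
    rw [innerSec, innerSec, star_mul, hc, ← B.single_mul_single (inv_mul_cancel g),
      ← B.star_single rfl]
    simp only [mul_assoc]
  have h2 : B.innerSec x (B.single 1 c * x) ≤ ‖c‖ • B.innerSec x x := by
    obtain ⟨s, hs⟩ := B.sec_eq_sum x
    rw [hs, B.innerSec_sum, B.innerSec_self_sum, Finset.smul_sum]
    exact Finset.sum_le_sum fun h _ => B.innerSec_single_mul_le _ c hc0
  have h3 := CStarAlgebra.norm_le_norm_of_nonneg_of_le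
    (by rw [← h1]; exact B.innerSec_self_nonneg _) h2
  rw [norm_smul, Real.norm_of_nonneg (norm_nonneg c), hcn] at h3
  rw [moduleNorm, h1, moduleNorm, ← Real.sqrt_mul_self (norm_nonneg a),
    ← Real.sqrt_mul (by positivity)]
  exact Real.sqrt_le_sqrt h3

end Order

/-- The operators of left convolution are bounded. -/
theorem exists_moduleNorm_mul_le (f : B.Sec) :
    ∃ M : ℝ, 0 ≤ M ∧ ∀ x, B.moduleNorm (f * x) ≤ M * B.moduleNorm x := by
  refine B.sec_induction f ⟨0, le_rfl, fun x => ?_⟩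
    (fun g a => ⟨‖a‖, norm_nonneg a, B.moduleNorm_single_mul_le a⟩) ?_
  · simp [moduleNorm, innerSec]
  · rintro f f' ⟨M, hM, h⟩ ⟨M', hM', h'⟩
    refine ⟨M + M', add_nonneg hM hM', fun x => ?_⟩
    rw [add_mul, add_mul]
    exact (B.moduleNorm_add_le _ _).trans (add_le_add (h x) (h' x))

/-- The norm of `f` in the reduced cross-sectional algebra: the operator norm of the left
convolution operator `Λ f : x ↦ f * x` on the Hilbert module `ℓ²(B)`, in which `C_c(B)` is dense. -/
def convolutionNorm (f : B.Sec) : ℝ :=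
  sInf {M : ℝ | 0 ≤ M ∧ ∀ x, B.moduleNorm (f * x) ≤ M * B.moduleNorm x}

theorem convolutionNorm_le {f : B.Sec} {M : ℝ} (h0 : 0 ≤ M)
    (h : ∀ x, B.moduleNorm (f * x) ≤ M * B.moduleNorm x) : B.convolutionNorm f ≤ M :=
  csInf_le ⟨0, fun _ h => h.1⟩ ⟨h0, h⟩

theorem convolutionNorm_nonneg (f : B.Sec) : 0 ≤ B.convolutionNorm f :=
  Real.sInf_nonneg fun _ h => h.1

theorem moduleNorm_mul_le (f x : B.Sec) :
    B.moduleNorm (f * x) ≤ B.convolutionNorm f * B.moduleNorm x := by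
  obtain ⟨M, hM⟩ := B.exists_moduleNorm_mul_le f
  rcases (B.moduleNorm_nonneg x).eq_or_lt with h | h
  · rw [← h, mul_zero]
    have := hM.2 x
    rwa [← h, mul_zero] at this
  · rw [← div_le_iff₀ h]
    exact le_csInf ⟨M, hM⟩ fun N hN => (div_le_iff₀ h).mpr (hN.2 x)

/-- The reduced C*-norm on `C_c(B)`. -/
def redNorm : CStarSeminorm B.Sec where
  toFun := B.convolutionNorm
  map_zero' := le_antisymm
    (B.convolutionNorm_le le_rfl fun x => by simp [moduleNorm, innerSec])
    (B.convolutionNorm_nonneg 0)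
  add_le' f f' := B.convolutionNorm_le
    (add_nonneg (B.convolutionNorm_nonneg f) (B.convolutionNorm_nonneg f')) fun x => by
      rw [add_mul, add_mul]
      exact (B.moduleNorm_add_le _ _).trans
        (add_le_add (B.moduleNorm_mul_le f x) (B.moduleNorm_mul_le f' x))
  neg' f := by
    have h : ∀ x, B.moduleNorm (-f * x) = B.moduleNorm (f * x) := fun x => by
      rw [neg_mul]
      simp [moduleNorm, innerSec]
    simp only [convolutionNorm, h]
  smul' c f := by
    have key : ∀ (c : ℂ) (f : B.Sec), B.convolutionNorm (c • f) ≤ ‖c‖ * B.convolutionNorm f :=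
      fun c f => B.convolutionNorm_le (mul_nonneg (norm_nonneg c) (B.convolutionNorm_nonneg f))
        fun x => by
          rw [smul_mul_assoc, B.moduleNorm_smul, mul_assoc]
          exact mul_le_mul_of_nonneg_left (B.moduleNorm_mul_le f x) (norm_nonneg c)
    refine le_antisymm (key c f) ?_
    rcases eq_or_ne c 0 with rfl | hc
    · rw [norm_zero, zero_mul]
      exact B.convolutionNorm_nonneg _
    · have h := key c⁻¹ (c • f)
      rw [smul_smul, inv_mul_cancel₀ hc, one_smul, norm_inv] at h
      rwa [inv_mul_eq_div, le_div_iff₀' (norm_pos_iff.mpr hc)] at h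
  mul_le' f f' := B.convolutionNorm_le
    (mul_nonneg (B.convolutionNorm_nonneg f) (B.convolutionNorm_nonneg f')) fun x => by
      rw [mul_assoc, mul_assoc]
      exact (B.moduleNorm_mul_le f _).trans
        (mul_le_mul_of_nonneg_left (B.moduleNorm_mul_le f' x) (B.convolutionNorm_nonneg f))
  star_mul_self' := by
    have hmul : ∀ f f' : B.Sec,
        B.convolutionNorm (f * f') ≤ B.convolutionNorm f * B.convolutionNorm f' :=
      fun f f' => B.convolutionNorm_le
        (mul_nonneg (B.convolutionNorm_nonneg f) (B.convolutionNorm_nonneg f')) fun x => by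
          rw [mul_assoc, mul_assoc]
          exact (B.moduleNorm_mul_le f _).trans
            (mul_le_mul_of_nonneg_left (B.moduleNorm_mul_le f' x) (B.convolutionNorm_nonneg f))
    have key : ∀ f : B.Sec, B.convolutionNorm f * B.convolutionNorm f ≤
        B.convolutionNorm (star f * f) := by
      intro f
      have h : B.convolutionNorm f ≤ √(B.convolutionNorm (star f * f)) := by
        refine B.convolutionNorm_le (Real.sqrt_nonneg _) fun x => ?_
        have h1 : B.innerSec (f * x) (f * x) = B.innerSec x (star f * f * x) := by
          rw [innerSec, innerSec, star_mul]
          simp only [mul_assoc]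
        have h2 : ‖B.innerSec (f * x) (f * x)‖ ≤
            B.convolutionNorm (star f * f) * (B.moduleNorm x * B.moduleNorm x) := by
          rw [h1]
          refine (B.norm_innerSec_le _ _).trans ?_
          calc _ ≤ B.moduleNorm x * (B.convolutionNorm (star f * f) * B.moduleNorm x) :=
                mul_le_mul_of_nonneg_left (B.moduleNorm_mul_le _ x) (B.moduleNorm_nonneg x)
            _ = _ := by ring
        rw [← Real.sqrt_mul_self (B.moduleNorm_nonneg x),
          ← Real.sqrt_mul (B.convolutionNorm_nonneg _)]
        exact Real.sqrt_le_sqrt h2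
      calc _ ≤ √(B.convolutionNorm (star f * f)) * √(B.convolutionNorm (star f * f)) :=
            mul_le_mul h h (B.convolutionNorm_nonneg f) (Real.sqrt_nonneg _)
        _ = _ := Real.mul_self_sqrt (B.convolutionNorm_nonneg _)
    have key' : ∀ f : B.Sec, B.convolutionNorm f ≤ B.convolutionNorm (star f) := by
      intro f
      have h1 := (key f).trans (hmul _ _)
      rcases (B.convolutionNorm_nonneg f).eq_or_lt with h | h
      · rw [← h]; exact B.convolutionNorm_nonneg _
      · exact le_of_mul_le_mul_right h1 h
    intro f
    refine le_antisymm ((hmul _ _).trans ?_) (key f)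
    refine mul_le_mul_of_nonneg_right ?_ (B.convolutionNorm_nonneg f)
    simpa using key' (star f)

/-- The reduced cross-sectional C*-algebra `C*_r(B)`, that is, the closure of `{Λ f | f ∈ C_c(B)}`
in the adjointable operators on `ℓ²(B)`. -/
abbrev RedAlg : Type u := B.redNorm.Alg

theorem redNorm_le_fullNorm (f : B.Sec) : B.redNorm f ≤ B.fullNorm f := by
  have h : B.redNorm ∈ {p : CStarSeminorm B.Sec | B.FibreContractive p} := fun g a =>
    B.convolutionNorm_le (norm_nonneg a) (B.moduleNorm_single_mul_le a)
  exact CStarSeminorm.le_sSup h f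

/-- The left regular representation `Λ : C*(B) → C*_r(B)`. -/
def regularRep : B.FullAlg →⋆ₙₐ[ℂ] B.RedAlg :=
  CStarSeminorm.mapLE B.fullNorm B.redNorm B.redNorm_le_fullNorm

/-- Exel's approximation property: there is a net `(ξ i)` of finitely supported functions
`G → B_e` with `sup_i ‖∑ g, ξ_i(g)* ξ_i(g)‖ < ∞` such that `∑ h, ξ_i(gh)* a ξ_i(h)` converges to `a`
for all `g` and all `a ∈ B_g`. -/
def HasAP : Prop :=
  ∃ (I : Type u) (_ : Preorder I) (_ : IsDirectedOrder I) (_ : Nonempty I)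
    (ξ : I → G →₀ B.fiber 1),
    (∃ M : ℝ, ∀ i, ‖(ξ i).sum fun _ b => star b * b‖ ≤ M) ∧
    ∀ (g : G) (a : B.fiber g), Filter.Tendsto
      (fun i => (ξ i).sum fun h b =>
        B.mulMap (mul_one g) (B.mulMap (one_mul g) (star (ξ i (g * h))) a) b)
      Filter.atTop (nhds a)

end FellBundle

/-! ### Tensor products of Fell bundles -/

section OfSubspaces

variable {C : Type u} [NonUnitalCStarAlgebra C]

attribute [local instance] CStarAlgebra.spectralOrder CStarAlgebra.spectralOrderedRing in
/-- A closed *-subalgebra contains a square root of each `x* x` that belongs to it. -/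
theorem exists_mem_star_mul_self_eq (S : Submodule ℂ C) (hS : IsClosed (S : Set C))
    (hmul : ∀ a ∈ S, ∀ b ∈ S, a * b ∈ S) (hstar : ∀ a ∈ S, star a ∈ S) (x : C)
    (hx : star x * x ∈ S) : ∃ c ∈ S, star x * x = star c * c := by
  have h0 : 0 ≤ star x * x := star_mul_self_nonneg x
  let T : NonUnitalStarSubalgebra ℝ C :=
    { carrier := S
      add_mem' := S.add_mem
      zero_mem' := S.zero_mem
      mul_mem' := fun ha hb => hmul _ ha _ hb
      smul_mem' := fun r a ha => S.smul_mem (r : ℂ) ha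
      star_mem' := fun ha => hstar _ ha }
  have hT : CFC.sqrt (star x * x) ∈ T := by
    rw [CFC.sqrt_eq_real_sqrt (star x * x)]
    exact NonUnitalStarAlgebra.elemental.le_of_mem hS hx
      (cfcₙ_mem_elemental (𝕜 := ℝ) (p := IsSelfAdjoint) Real.sqrt (star x * x) )
  refine ⟨CFC.sqrt (star x * x), hT, ?_⟩
  rw [(IsSelfAdjoint.of_nonneg (CFC.sqrt_nonneg (star x * x))).star_eq, CFC.sqrt_mul_sqrt_self _ h0]

/-- The Fell bundle given by closed subspaces `E g` of a C*-algebra such that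
`E g * E h ⊆ E (g * h)` and `(E g)* ⊆ E g⁻¹`, with the operations of the C*-algebra. -/
def FellBundle.ofSubspaces {G : Type u} [Group G] (E : G → Submodule ℂ C)
    (hclosed : ∀ g, IsClosed (E g : Set C))
    (hmul : ∀ g h, ∀ a ∈ E g, ∀ b ∈ E h, a * b ∈ E (g * h))
    (hstar : ∀ g, ∀ a ∈ E g, star a ∈ E g⁻¹) : FellBundle G where
  fiber g := E g
  completeFiber g := (hclosed g).completeSpace_coe
  mulMap {g h k} e := LinearMap.mk₂ ℂ (fun a b => ⟨a.1 * b.1, e ▸ hmul g h _ a.2 _ b.2⟩)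
    (fun a a' b => Subtype.ext (add_mul _ _ _)) (fun c a b => Subtype.ext (smul_mul_assoc _ _ _))
    (fun a b b' => Subtype.ext (mul_add _ _ _)) (fun c a b => Subtype.ext (mul_smul_comm _ _ _))
  starMap {g h} e :=
    { toFun := fun a => ⟨star a.1, e ▸ hstar g _ a.2⟩
      map_add' := fun a b => Subtype.ext (star_add _ _)
      map_smul' := fun c a => Subtype.ext (star_smul _ _) }
  assoc _ _ _ _ a b c := Subtype.ext (mul_assoc _ _ _)
  starMap_starMap _ _ a := Subtype.ext (star_star _)
  starMap_mulMap _ _ _ _ _ a b := Subtype.ext (star_mul _ _)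
  norm_mulMap_le _ a b := norm_mul_le a.1 b.1
  norm_starMap _ a := norm_star a.1
  norm_starMap_mulMap_self _ _ a := CStarRing.norm_star_mul_self (x := a.1)
  starMap_mulMap_self_pos {g h} e e' a := by
    obtain ⟨c, hc, h⟩ := exists_mem_star_mul_self_eq (E 1) (hclosed 1)
      (fun a ha b hb => by simpa using hmul 1 1 a ha b hb)
      (fun a ha => by simpa using hstar 1 a ha) a.1
      (by subst e; exact e' ▸ hmul _ _ _ (hstar g _ a.2) _ a.2)
    exact ⟨⟨c, hc⟩, Subtype.ext h⟩

end OfSubspaces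

namespace FellBundle

variable {G : Type u} [Group G]

section TensorBundle

variable (μ : TensorKind) (𝒜 ℬ : FellBundle G)

/-- The element of `C*(B)` given by an element of the fibre `B_g`. -/
def toFull (B : FellBundle G) (g : G) : B.fiber g →ₗ[ℂ] B.FullAlg :=
  B.fullNorm.toAlg ∘ₗ B.single g

theorem toFull_mul (B : FellBundle G) {g h k : G} (e : g * h = k) (a : B.fiber g) (b : B.fiber h) :
    B.toFull g a * B.toFull h b = B.toFull k (B.mulMap e a b) := by
  change B.fullNorm.toAlg _ * B.fullNorm.toAlg _ = B.fullNorm.toAlg _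
  rw [← CStarSeminorm.toAlg_mul, B.single_mul_single e]

theorem toFull_star (B : FellBundle G) {g h : G} (e : g⁻¹ = h) (a : B.fiber g) :
    star (B.toFull g a) = B.toFull h (B.starMap e a) := by
  change star (B.fullNorm.toAlg _) = B.fullNorm.toAlg _
  rw [← CStarSeminorm.toAlg_star, B.star_single e]

/-- The map `A_g ⊗ B_g → C*(𝒜) ⊗_μ C*(ℬ)`. -/
def tensorIncl (g : G) : 𝒜.fiber g ⊗[ℂ] ℬ.fiber g →ₗ[ℂ] CStarTensor 𝒜.FullAlg ℬ.FullAlg μ :=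
  (tensorNorm 𝒜.FullAlg ℬ.FullAlg μ).toAlg ∘ₗ TensorProduct.map (𝒜.toFull g) (ℬ.toFull g)

theorem tensorIncl_mul {g h k : G} (e : g * h = k) (a : 𝒜.fiber g) (b : ℬ.fiber g)
    (a' : 𝒜.fiber h) (b' : ℬ.fiber h) :
    tensorIncl μ 𝒜 ℬ g (a ⊗ₜ b) * tensorIncl μ 𝒜 ℬ h (a' ⊗ₜ b') =
      tensorIncl μ 𝒜 ℬ k (𝒜.mulMap e a a' ⊗ₜ ℬ.mulMap e b b') := by
  change (tensorNorm _ _ μ).toAlg (_ ⊗ₜ _) * (tensorNorm _ _ μ).toAlg (_ ⊗ₜ _) =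
    (tensorNorm _ _ μ).toAlg (_ ⊗ₜ _)
  rw [← CStarSeminorm.toAlg_mul, Algebra.TensorProduct.tmul_mul_tmul, 𝒜.toFull_mul e,
    ℬ.toFull_mul e]

theorem tensorIncl_star {g h : G} (e : g⁻¹ = h) (a : 𝒜.fiber g) (b : ℬ.fiber g) :
    star (tensorIncl μ 𝒜 ℬ g (a ⊗ₜ b)) =
      tensorIncl μ 𝒜 ℬ h (𝒜.starMap e a ⊗ₜ ℬ.starMap e b) := by
  change star ((tensorNorm _ _ μ).toAlg (_ ⊗ₜ _)) = (tensorNorm _ _ μ).toAlg (_ ⊗ₜ _)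
  rw [← CStarSeminorm.toAlg_star, TensorProduct.star_tmul, 𝒜.toFull_star e, ℬ.toFull_star e]

/-- The fibre `A_g ⊗_μ B_g`: the closure of the image of `A_g ⊗ B_g` in `C*(𝒜) ⊗_μ C*(ℬ)`. -/
def tensorFiber (g : G) : Submodule ℂ (CStarTensor 𝒜.FullAlg ℬ.FullAlg μ) :=
  (LinearMap.range (tensorIncl μ 𝒜 ℬ g)).topologicalClosure

theorem tensorFiber_mul (g h : G) : ∀ a ∈ tensorFiber μ 𝒜 ℬ g, ∀ b ∈ tensorFiber μ 𝒜 ℬ h,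
    a * b ∈ tensorFiber μ 𝒜 ℬ (g * h) := by
  intro a ha b hb
  refine map_mem_closure₂ continuous_mul ha hb ?_
  rintro _ ⟨x, rfl⟩ _ ⟨y, rfl⟩
  induction x with
  | zero => rw [map_zero, zero_mul]; exact zero_mem _
  | add x x' h h' => rw [map_add, add_mul]; exact add_mem h h'
  | tmul a b =>
    induction y with
    | zero => rw [map_zero, mul_zero]; exact zero_mem _
    | add y y' h h' => rw [map_add, mul_add]; exact add_mem h h'
    | tmul c d => exact ⟨_, (tensorIncl_mul μ 𝒜 ℬ rfl a b c d).symm⟩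

theorem tensorFiber_star (g : G) : ∀ a ∈ tensorFiber μ 𝒜 ℬ g,
    star a ∈ tensorFiber μ 𝒜 ℬ g⁻¹ := by
  intro a ha
  refine map_mem_closure continuous_star ha ?_
  rintro _ ⟨x, rfl⟩
  induction x with
  | zero => rw [map_zero, star_zero]; exact zero_mem _
  | add x x' h h' => rw [map_add, star_add]; exact add_mem h h'
  | tmul a b => exact ⟨_, (tensorIncl_star μ 𝒜 ℬ rfl a b).symm⟩

/-- The maximal or minimal tensor product `𝒜 ⊗_μ ℬ` of two Fell bundles over `G`, restricted to the
diagonal of `G × G`. Its fibre at `g` is the completion `A_g ⊗_μ B_g` of `A_g ⊗ B_g`, and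
`(a ⊗ b)(a' ⊗ b') = aa' ⊗ bb'` and `(a ⊗ b)* = a* ⊗ b*`. -/
def tensor : FellBundle G :=
  FellBundle.ofSubspaces (tensorFiber μ 𝒜 ℬ)
    (fun _ => Submodule.isClosed_topologicalClosure _)
    (tensorFiber_mul μ 𝒜 ℬ) (tensorFiber_star μ 𝒜 ℬ)

/-- The canonical map `A_g ⊗ B_g → A_g ⊗_μ B_g` into the fibre of `𝒜 ⊗_μ ℬ`. -/
def tensorMk (g : G) : 𝒜.fiber g ⊗[ℂ] ℬ.fiber g →ₗ[ℂ] (tensor μ 𝒜 ℬ).fiber g :=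
  (tensorIncl μ 𝒜 ℬ g).codRestrict (tensorFiber μ 𝒜 ℬ g)
    fun x => Submodule.le_topologicalClosure _ ⟨x, rfl⟩

theorem tensorMk_mul {g h k : G} (e : g * h = k) (a : 𝒜.fiber g) (b : ℬ.fiber g)
    (a' : 𝒜.fiber h) (b' : ℬ.fiber h) :
    (tensor μ 𝒜 ℬ).mulMap e (tensorMk μ 𝒜 ℬ g (a ⊗ₜ b)) (tensorMk μ 𝒜 ℬ h (a' ⊗ₜ b')) =
      tensorMk μ 𝒜 ℬ k (𝒜.mulMap e a a' ⊗ₜ ℬ.mulMap e b b') :=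
  Subtype.ext (tensorIncl_mul μ 𝒜 ℬ e a b a' b')

theorem tensorMk_star {g h : G} (e : g⁻¹ = h) (a : 𝒜.fiber g) (b : ℬ.fiber g) :
    (tensor μ 𝒜 ℬ).starMap e (tensorMk μ 𝒜 ℬ g (a ⊗ₜ b)) =
      tensorMk μ 𝒜 ℬ h (𝒜.starMap e a ⊗ₜ ℬ.starMap e b) :=
  Subtype.ext (tensorIncl_star μ 𝒜 ℬ e a b)

end TensorBundle

end FellBundle

/-! ### Partial actions -/

/-- A partial action `α = ({A_g}, {α_g})` of the discrete group `G` on the C*-algebra `A`: closed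
two-sided ideals `A_g = dom g` (closed two-sided ideals are automatically self-adjoint) and
*-isomorphisms `α_g = act g : A_{g⁻¹} → A_g`. -/
structure PartialAction (G : Type u) [Group G] (A : Type u) [NonUnitalCStarAlgebra A] where
  dom : G → NonUnitalStarSubalgebra ℂ A
  isClosed_dom : ∀ g, IsClosed (dom g : Set A)
  mul_mem_dom_left : ∀ g (a b : A), b ∈ dom g → a * b ∈ dom g
  mul_mem_dom_right : ∀ g (a b : A), a ∈ dom g → a * b ∈ dom g
  act : ∀ g, dom g⁻¹ ≃⋆ₐ[ℂ] dom g
  dom_one : dom 1 = ⊤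
  act_one : ∀ a : dom 1⁻¹, (act 1 a : A) = a
  /-- `α_g(A_{g⁻¹} ∩ A_h) ⊆ A_{gh}` -/
  act_mem : ∀ g h (a : dom g⁻¹), (a : A) ∈ dom h → (act g a : A) ∈ dom (g * h)
  /-- `α_g ∘ α_h = α_{gh}` on `A_{h⁻¹} ∩ A_{(gh)⁻¹}` -/
  act_act : ∀ g h (a : A) (ha : a ∈ dom h⁻¹) (ha' : a ∈ dom (g * h)⁻¹)
    (hb : (act h ⟨a, ha⟩ : A) ∈ dom g⁻¹),
    (act g ⟨act h ⟨a, ha⟩, hb⟩ : A) = act (g * h) ⟨a, ha'⟩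

namespace PartialAction

variable {G A : Type u} [Group G] [NonUnitalCStarAlgebra A] (α : PartialAction G A)

open Classical in
/-- The element `α_g(a)` of `A`, for `a ∈ A_{g⁻¹}` (with the value `0` for other `a`). -/
def app (g : G) (a : A) : A := if ha : a ∈ α.dom g⁻¹ then α.act g ⟨a, ha⟩ else 0

theorem app_of_mem {g : G} {a : A} (ha : a ∈ α.dom g⁻¹) : α.app g a = α.act g ⟨a, ha⟩ :=
  dif_pos ha

theorem mem_dom_one (a : A) : a ∈ α.dom 1 := by rw [α.dom_one]; trivial

theorem app_one (a : A) : α.app 1 a = a := by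
  rw [α.app_of_mem (by rw [inv_one]; exact α.mem_dom_one a), α.act_one]

theorem app_mem {g : G} {a : A} (ha : a ∈ α.dom g⁻¹) : α.app g a ∈ α.dom g := by
  rw [α.app_of_mem ha]
  exact (α.act g ⟨a, ha⟩).2

theorem app_mem_mul {g h k : G} (e : g * h = k) {a : A} (ha : a ∈ α.dom g⁻¹)
    (hb : a ∈ α.dom h) : α.app g a ∈ α.dom k := by
  subst e
  rw [α.app_of_mem ha]
  exact α.act_mem g h ⟨a, ha⟩ hb

theorem app_app {g h k : G} (e : g * h = k) {a : A} (ha : a ∈ α.dom h⁻¹)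
    (hb : a ∈ α.dom k⁻¹) : α.app g (α.app h a) = α.app k a := by
  subst e
  have hc : α.app h a ∈ α.dom g⁻¹ := α.app_mem_mul (by group) ha hb
  rw [α.app_of_mem hc, α.app_of_mem hb, ← α.act_act g h a ha hb (by rwa [← α.app_of_mem ha])]
  congr 2
  exact Subtype.ext (α.app_of_mem ha)

theorem app_inv_mem {g : G} {a : A} (ha : a ∈ α.dom g) : α.app g⁻¹ a ∈ α.dom g⁻¹ :=
  α.app_mem (by rwa [inv_inv])

theorem app_app_inv {g : G} {a : A} (ha : a ∈ α.dom g) : α.app g (α.app g⁻¹ a) = a := by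
  rw [α.app_app (mul_inv_cancel g) (by rwa [inv_inv])
    (by rw [inv_one]; exact α.mem_dom_one a), α.app_one]

theorem app_add {g : G} {a b : A} (ha : a ∈ α.dom g⁻¹) (hb : b ∈ α.dom g⁻¹) :
    α.app g (a + b) = α.app g a + α.app g b := by
  rw [α.app_of_mem ha, α.app_of_mem hb, α.app_of_mem (add_mem ha hb)]
  exact congrArg Subtype.val (map_add (α.act g) ⟨a, ha⟩ ⟨b, hb⟩)

theorem app_mul {g : G} {a b : A} (ha : a ∈ α.dom g⁻¹) (hb : b ∈ α.dom g⁻¹) :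
    α.app g (a * b) = α.app g a * α.app g b := by
  rw [α.app_of_mem ha, α.app_of_mem hb, α.app_of_mem (mul_mem ha hb)]
  exact congrArg Subtype.val (map_mul (α.act g) ⟨a, ha⟩ ⟨b, hb⟩)

theorem app_smul {g : G} (c : ℂ) {a : A} (ha : a ∈ α.dom g⁻¹) :
    α.app g (c • a) = c • α.app g a := by
  rw [α.app_of_mem ha, α.app_of_mem (SMulMemClass.smul_mem c ha)]
  exact congrArg Subtype.val (map_smul (α.act g) c ⟨a, ha⟩)

theorem app_star {g : G} {a : A} (ha : a ∈ α.dom g⁻¹) :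
    α.app g (star a) = star (α.app g a) := by
  rw [α.app_of_mem ha, α.app_of_mem (star_mem ha)]
  exact congrArg Subtype.val (map_star (α.act g) ⟨a, ha⟩)

theorem norm_app {g : G} {a : A} (ha : a ∈ α.dom g⁻¹) : ‖α.app g a‖ = ‖a‖ := by
  have := α.isClosed_dom g
  have := α.isClosed_dom g⁻¹
  rw [α.app_of_mem ha]
  exact NonUnitalStarAlgHom.norm_map (α.act g) (α.act g).injective ⟨a, ha⟩

theorem mul_app_eq {h : G} (a c : A) {b : A} (hb : b ∈ α.dom h) :
    α.app h (α.app h⁻¹ (a * b) * c) = a * α.app h (α.app h⁻¹ b * c) := by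
  have hab : a * b ∈ α.dom h := α.mul_mem_dom_left h a b hb
  have m1 : ∀ {x : A}, x ∈ α.dom h → α.app h⁻¹ x * c ∈ α.dom h⁻¹ := fun hx =>
    α.mul_mem_dom_right _ _ _ (α.app_inv_mem hx)
  have key : ∀ f ∈ α.dom h, f * α.app h (α.app h⁻¹ (a * b) * c) =
      f * (a * α.app h (α.app h⁻¹ b * c)) := by
    have aux : ∀ f ∈ α.dom h, ∀ x ∈ α.dom h, f * α.app h (α.app h⁻¹ x * c) =
        α.app h (α.app h⁻¹ (f * x) * c) := by
      intro f hf x hx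
      rw [α.app_mul (a := f) (by rwa [inv_inv]) (by rwa [inv_inv]), mul_assoc,
        α.app_mul (α.app_inv_mem hf) (m1 hx), α.app_app_inv hf]
    intro f hf
    rw [aux f hf _ hab, ← mul_assoc, ← mul_assoc,
      aux _ (α.mul_mem_dom_right h f a hf) b hb]
  rw [← sub_eq_zero]
  set d := α.app h (α.app h⁻¹ (a * b) * c) - a * α.app h (α.app h⁻¹ b * c) with hd
  have hdm : d ∈ α.dom h :=
    sub_mem (α.app_mem (m1 hab)) (α.mul_mem_dom_left h _ _ (α.app_mem (m1 hb)))
  have h0 : star d * d = 0 := by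
    nth_rewrite 2 [hd]
    rw [mul_sub, key _ (star_mem hdm), sub_self]
  exact CStarRing.star_mul_self_eq_zero_iff d |>.mp h0

/-- The semidirect product bundle `B_α` of the partial action `α`, with fibre `A_g δ_g` at `g`, and
with the operations `(a δ_g)(b δ_h) = α_g(α_{g⁻¹}(a) b) δ_{gh}` and
`(a δ_g)* = α_{g⁻¹}(a*) δ_{g⁻¹}`. -/
def bundle : FellBundle G where
  fiber g := α.dom g
  completeFiber g := (α.isClosed_dom g).completeSpace_coe
  mulMap {g h k} e := LinearMap.mk₂ ℂ
    (fun a b => ⟨α.app g (α.app g⁻¹ a.1 * b.1), α.app_mem_mul e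
      (α.mul_mem_dom_right _ _ _ (α.app_inv_mem a.2)) (α.mul_mem_dom_left _ _ _ b.2)⟩)
    (fun a a' b => Subtype.ext <| by
      change α.app g (α.app g⁻¹ (a.1 + a'.1) * b.1) = _
      rw [α.app_add (by rw [inv_inv]; exact a.2) (by rw [inv_inv]; exact a'.2), add_mul,
        α.app_add (α.mul_mem_dom_right _ _ _ (α.app_inv_mem a.2))
          (α.mul_mem_dom_right _ _ _ (α.app_inv_mem a'.2))]
      rfl)
    (fun c a b => Subtype.ext <| by
      change α.app g (α.app g⁻¹ (c • a.1) * b.1) = _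
      rw [α.app_smul c (by rw [inv_inv]; exact a.2), smul_mul_assoc,
        α.app_smul c (α.mul_mem_dom_right _ _ _ (α.app_inv_mem a.2))]
      rfl)
    (fun a b b' => Subtype.ext <| by
      change α.app g (α.app g⁻¹ a.1 * (b.1 + b'.1)) = _
      rw [mul_add, α.app_add (α.mul_mem_dom_right _ _ _ (α.app_inv_mem a.2))
          (α.mul_mem_dom_right _ _ _ (α.app_inv_mem a.2))]
      rfl)
    (fun c a b => Subtype.ext <| by
      change α.app g (α.app g⁻¹ a.1 * (c • b.1)) = _
      rw [mul_smul_comm, α.app_smul c (α.mul_mem_dom_right _ _ _ (α.app_inv_mem a.2))]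
      rfl)
  starMap {g h} e :=
    { toFun := fun a => ⟨α.app g⁻¹ (star a.1), by
        subst e; exact α.app_inv_mem (star_mem a.2)⟩
      map_add' := fun a b => Subtype.ext <| by
        change α.app g⁻¹ (star (a.1 + b.1)) = _
        rw [star_add, α.app_add (by rw [inv_inv]; exact star_mem a.2)
          (by rw [inv_inv]; exact star_mem b.2)]
        rfl
      map_smul' := fun c a => Subtype.ext <| by
        change α.app g⁻¹ (star (c • a.1)) = _
        rw [star_smul, α.app_smul _ (by rw [inv_inv]; exact star_mem a.2)]
        rfl }
  assoc {g h k l m n} e₁ e₂ e₃ e₄ a b c := Subtype.ext <| by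
    subst e₁ e₃ e₄
    change α.app (g * h) (α.app (g * h)⁻¹ (α.app g (α.app g⁻¹ a.1 * b.1)) * c.1) =
      α.app g (α.app g⁻¹ a.1 * α.app h (α.app h⁻¹ b.1 * c.1))
    have hx : α.app g⁻¹ a.1 * b.1 ∈ α.dom g⁻¹ :=
      α.mul_mem_dom_right _ _ _ (α.app_inv_mem a.2)
    have hx' : α.app g⁻¹ a.1 * b.1 ∈ α.dom h := α.mul_mem_dom_left _ _ _ b.2
    rw [α.app_app (k := h⁻¹) (by group) hx (by rwa [inv_inv]), ← α.mul_app_eq _ _ b.2]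
    refine (α.app_app rfl (α.mul_mem_dom_right _ _ _ (α.app_inv_mem hx'))
      (α.mul_mem_dom_right _ _ _ ?_)).symm
    exact α.app_mem_mul (h := g⁻¹) (by group) (by rwa [inv_inv]) hx
  starMap_starMap {g h} e e' a := Subtype.ext <| by
    subst e
    change α.app g⁻¹⁻¹ (star (α.app g⁻¹ (star a.1))) = a.1
    rw [α.app_star (a := a.1) (by rw [inv_inv]; exact a.2), star_star, inv_inv,
      α.app_app_inv a.2]
  starMap_mulMap {g h k g' h' k'} e e₁ e₂ e₃ e₄ a b := Subtype.ext <| by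
    subst e e₁ e₂ e₃
    change α.app (g * h)⁻¹ (star (α.app g (α.app g⁻¹ a.1 * b.1))) =
      α.app h⁻¹ (α.app h⁻¹⁻¹ (α.app h⁻¹ (star b.1)) * α.app g⁻¹ (star a.1))
    have hx : α.app g⁻¹ a.1 * b.1 ∈ α.dom g⁻¹ :=
      α.mul_mem_dom_right _ _ _ (α.app_inv_mem a.2)
    have hx' : α.app g⁻¹ a.1 * b.1 ∈ α.dom h := α.mul_mem_dom_left _ _ _ b.2
    rw [← α.app_star hx, α.app_app (k := h⁻¹) (by group) (star_mem hx)
      (by rw [inv_inv]; exact star_mem hx'), inv_inv, α.app_app_inv (star_mem b.2),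
      α.app_star (a := a.1) (by rw [inv_inv]; exact a.2), star_mul]
  norm_mulMap_le {g h k} e a b := by
    change ‖α.app g (α.app g⁻¹ a.1 * b.1)‖ ≤ ‖a.1‖ * ‖b.1‖
    rw [α.norm_app (α.mul_mem_dom_right _ _ _ (α.app_inv_mem a.2)),
      ← α.norm_app (g := g⁻¹) (a := a.1) (by rw [inv_inv]; exact a.2)]
    exact norm_mul_le _ _
  norm_starMap {g h} e a := by
    change ‖α.app g⁻¹ (star a.1)‖ = ‖a.1‖
    rw [α.norm_app (by rw [inv_inv]; exact star_mem a.2), norm_star]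
  norm_starMap_mulMap_self {g h} e e' a := by
    subst e
    change ‖α.app g⁻¹ (α.app g⁻¹⁻¹ (α.app g⁻¹ (star a.1)) * a.1)‖ = ‖a.1‖ * ‖a.1‖
    rw [inv_inv, α.app_app_inv (star_mem a.2),
      α.norm_app (by rw [inv_inv]; exact mul_mem (star_mem a.2) a.2),
      CStarRing.norm_star_mul_self]
  starMap_mulMap_self_pos {g h} e e' a := by
    subst e
    refine ⟨⟨α.app g⁻¹ a.1, α.mem_dom_one _⟩, Subtype.ext ?_⟩
    change α.app g⁻¹ (α.app g⁻¹⁻¹ (α.app g⁻¹ (star a.1)) * a.1) =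
      α.app 1 (α.app 1⁻¹ (α.app 1⁻¹ (star (α.app g⁻¹ a.1))) * α.app g⁻¹ a.1)
    rw [inv_inv, α.app_app_inv (star_mem a.2), inv_one, α.app_one, α.app_one, α.app_one,
      α.app_mul (by rw [inv_inv]; exact star_mem a.2) (by rw [inv_inv]; exact a.2),
      α.app_star (by rw [inv_inv]; exact a.2)]

/-- The partial crossed product `A ⋊_α G`. -/
abbrev CrossedProduct : Type u := α.bundle.FullAlg

/-- The reduced partial crossed product `A ⋊_{α,r} G`. -/
abbrev ReducedCrossedProduct : Type u := α.bundle.RedAlg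

/-- The left regular representation `Λ : A ⋊_α G → A ⋊_{α,r} G`. -/
def regularRep : α.CrossedProduct →⋆ₙₐ[ℂ] α.ReducedCrossedProduct := α.bundle.regularRep

/-- A partial action has the approximation property if its semidirect product bundle has it. -/
def HasAP : Prop := α.bundle.HasAP

/-- `γ` is the diagonal partial action `({A_g ⊗_μ B_g}, {α_g ⊗ β_g})` on `A ⊗_μ B`: the ideal
`A_g ⊗_μ B_g` is the closed linear span of the elements `a ⊗ b` with `a ∈ A_g` and `b ∈ B_g`, and
`γ_g(a ⊗ b) = α_g(a) ⊗ β_g(b)` for `a ∈ A_{g⁻¹}` and `b ∈ B_{g⁻¹}`. -/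
def IsDiagonal {B : Type u} [NonUnitalCStarAlgebra B] (α : PartialAction G A)
    (β : PartialAction G B) (μ : TensorKind) (γ : PartialAction G (CStarTensor A B μ)) : Prop :=
  (∀ g, (γ.dom g : Set (CStarTensor A B μ)) = closure (Submodule.span ℂ
    {x | ∃ a ∈ α.dom g, ∃ b ∈ β.dom g, x = CStarTensor.mk μ a b} : Set (CStarTensor A B μ))) ∧
  ∀ g, ∀ a : α.dom g⁻¹, ∀ b : β.dom g⁻¹,
    ∃ h : CStarTensor.mk μ (a : A) (b : B) ∈ γ.dom g⁻¹,
      (γ.act g ⟨_, h⟩ : CStarTensor A B μ) = CStarTensor.mk μ (α.act g a : A) (β.act g b : B)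

end PartialAction

end

set_option linter.unusedSectionVars false

noncomputable section

/-! ### Generalities on C*-seminorms -/

/-! The approximation property enters through one picture. Let `Φ` be a *-homomorphism from `C_c(B)`
into a C*-algebra `P`. The coaction `a δ_g ↦ Φ(a δ_g) δ_g` lets `C_c(B)` act on the Hilbert module
of the trivial bundle `P × G`, and Exel's map `a ↦ ∑ h, ξ(gh)* a ξ(h)`, seen through `Φ`, is the
compression of this action by the single vector `ζ = Φ ∘ ξ`, with `‖ζ‖² = ‖Φ(∑ ξ* ξ)‖`
(`map_single_apMap`). For the canonical `Φ` into `C*(B)` the compressions of `f` tend to `Φ f`. On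
`ζ` the operator of `f` is bounded by the reduced norm of `f`, as in Fell's absorption principle.
Hence the full norm is at most a multiple of the reduced norm, and for C*-seminorms the multiple can
be removed (`HasAP.fullNorm_eq_redNorm`).

Nuclearity of `C*(B)` is the same argument with `Φ` replaced by `C_c(B) ⊗ D → C*(B) ⊗_max D`. The
operators are now controlled on `ℓ²(B) ⊗ D`, whose inner product takes values in `B_e ⊗ D`; there
the maximal norm may be replaced by the minimal one if `B_e` is nuclear (`HasAP.isNuclear`). The
nuclearity of `A ⊗_μ B` comes from regrouping `(A ⊗ B) ⊗ D` as `A ⊗ (B ⊗ D)`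
(`IsNuclear.of_tensor`).

The approximation property passes to tensor products by means of `ξ(g) ⊗ e`, with `e` in an
approximate unit of the second unit fibre. Convergence is clear on elementary tensors and spreads by
uniform boundedness. `HasAP.of_tensor` admits every bundle that contains the algebraic tensor
product densely, so that it serves both `𝒜 ⊗_μ ℬ` and the semidirect product bundle of a diagonal
action.

For the norm of the unit fibre, the conditional expectation `E` of `C_c(B)` onto `B_e` gives a form
`(E ⊗ id)(z* w)` on which `C_c(B) ⊗ D` acts with norm at most that of `C*(B) ⊗_μ D`
(`tensorNorm_condExp_mul_le`); restricting to the unit fibre shows that `B_e ⊗_μ D` embeds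
isometrically. For `max` the action defines a C*-seminorm, which lies below the maximal one; for
`min` one induces representations on Hilbert spaces. Positivity of the forms comes from approximate
frames: `⟪x, y⟫` is a limit of sums `∑ ⟪u, x⟫* ⟪u, y⟫` (`tendsto_frame`).

For partial actions, `α_g ⊗ β_g` must be isometric in the norm of `A ⊗_μ B`. Inside the tensor
product bundle, an element and its image have norms computed from `X X*` and `X* X` for one and the
same `X` (`tensorNorm_actVal`).

One device recurs: if `K x ^ 2 ≤ N * K (x* x)`, then any crude bound of `K` by a multiple of a
C*-seminorm `q` improves to `N * q`. It allows estimates to be made on elementary vectors, with any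
constants, and summed carelessly. -/

/-- If `K` is dominated by a multiple of a function `q` with `q (φ x) = q x ^ 2` and satisfies
`K x ^ 2 ≤ N * K (φ x)`, then it is dominated by `N * q`. -/
theorem le_mul_of_sq_le_mul {R : Type*} {K q : R → ℝ} {φ : R → R} {N C : ℝ} (hN : 0 ≤ N)
    (hq : ∀ x, 0 ≤ q x) (hφ : ∀ x, q (φ x) = q x * q x)
    (hsq : ∀ x, K x ^ 2 ≤ N * K (φ x)) (hC : ∀ x, K x ≤ C * q x) (x : R) : K x ≤ N * q x := by
  set S : Set ℝ := {C | 0 ≤ C ∧ ∀ x, K x ≤ C * q x} with hS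
  have hne : S.Nonempty := ⟨max C 0, le_max_right _ _, fun x =>
    (hC x).trans (mul_le_mul_of_nonneg_right (le_max_left _ _) (hq x))⟩
  have hbd : BddBelow S := ⟨0, fun _ h => h.1⟩
  -- The infimum of the admissible constants is itself admissible. Where `q x = 0`, every admissible
  -- constant says `K x ≤ 0`.
  have hm : sInf S ∈ S := by
    refine ⟨Real.sInf_nonneg fun _ h => h.1, fun x => ?_⟩
    rcases (hq x).eq_or_lt with h0 | h0
    · obtain ⟨C, hC⟩ := hne
      have := hC.2 x
      rwa [← h0, mul_zero] at this ⊢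
    · rw [← div_le_iff₀ h0]
      exact le_csInf hne fun C hC => (div_le_iff₀ h0).mpr (hC.2 x)
  set c := sInf S with hc
  -- Inserting `K (φ x) ≤ c * q x ^ 2` into the hypothesis improves the constant `c` to `√(N * c)`.
  -- Minimality of `c` then forces `c ≤ N`.
  have hsqrt : √(N * c) ∈ S := by
    refine ⟨Real.sqrt_nonneg _, fun x => ?_⟩
    have h1 : K x ^ 2 ≤ (N * c) * (q x * q x) := by
      refine (hsq x).trans ?_
      rw [mul_assoc, ← hφ]
      exact mul_le_mul_of_nonneg_left (hm.2 _) hN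
    calc K x ≤ √((N * c) * (q x * q x)) := Real.le_sqrt_of_sq_le h1
      _ = _ := by rw [Real.sqrt_mul (mul_nonneg hN hm.1), Real.sqrt_mul_self (hq x)]
  have hle : c ≤ N := by
    have h1 : c ≤ √(N * c) := csInf_le hbd hsqrt
    have h2 : c * c ≤ N * c := by
      rw [← Real.mul_self_sqrt (mul_nonneg hN hm.1)]
      exact mul_self_le_mul_self hm.1 h1
    rcases hm.1.eq_or_lt with h | h
    · rw [← h]; exact hN
    · exact le_of_mul_le_mul_right h2 h
  exact (hm.2 x).trans (mul_le_mul_of_nonneg_right hle (hq x))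

namespace CStarSeminorm

variable {R S : Type u} [NonUnitalRing R] [StarRing R] [Module ℂ R] [NonUnitalRing S] [StarRing S]
  [Module ℂ S]

/-- The pullback of a C*-seminorm along a *-homomorphism. -/
def comap (p : CStarSeminorm S) (φ : R →⋆ₙₐ[ℂ] S) : CStarSeminorm R where
  toFun x := p (φ x)
  map_zero' := by rw [map_zero]; exact p.map_zero'
  add_le' x y := by rw [map_add]; exact p.add_le _ _
  neg' x := by rw [map_neg]; exact p.neg' _
  smul' c x := by rw [map_smul]; exact p.smul_eq _ _
  mul_le' x y := by rw [map_mul]; exact p.mul_le' _ _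
  star_mul_self' x := by rw [map_mul, map_star]; exact p.star_mul_self' _

theorem comap_apply (p : CStarSeminorm S) (φ : R →⋆ₙₐ[ℂ] S) (x : R) : p.comap φ x = p (φ x) := rfl

/-- The norm of a C*-algebra. -/
def ofNorm (P : Type u) [NonUnitalCStarAlgebra P] : CStarSeminorm P where
  toFun x := ‖x‖
  map_zero' := norm_zero
  add_le' := norm_add_le
  neg' := norm_neg
  smul' := norm_smul
  mul_le' := norm_mul_le
  star_mul_self' _ := CStarRing.norm_star_mul_self

theorem ofNorm_apply {P : Type u} [NonUnitalCStarAlgebra P] (x : P) : ofNorm P x = ‖x‖ := rfl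

/-- The canonical map into the completion as a *-homomorphism. -/
def toAlgHom (p : CStarSeminorm R) : R →⋆ₙₐ[ℂ] p.Alg where
  toFun := p.toAlg
  map_smul' := p.toAlg_smul
  map_zero' := map_zero _
  map_add' := map_add _
  map_mul' := p.toAlg_mul
  map_star' := p.toAlg_star

theorem norm_toAlgHom (p : CStarSeminorm R) (x : R) : ‖p.toAlgHom x‖ = p x := p.norm_toAlg x

theorem mul_star_self (p : CStarSeminorm R) (x : R) : p (x * star x) = p x * p x := by
  have h := p.star_mul_self' (star x)
  rwa [star_star, show p.toFun (star x) = p.toFun x from p.star_eq x] at h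

theorem map_zero_eq (p : CStarSeminorm R) : p 0 = 0 := p.map_zero'

/-- C*-seminorms are compared up to constants. -/
theorem le_of_le_mul {p q : CStarSeminorm R} {C : ℝ} (h : ∀ x, p x ≤ C * q x) (x : R) :
    p x ≤ q x := by
  -- The C*-identity of `p` is the quadratic hypothesis with `N = 1`, so `C` drops out.
  have := le_mul_of_sq_le_mul (K := p) (q := q) (φ := fun x => star x * x) (N := 1) (C := C)
    zero_le_one q.nonneg q.star_mul_self'
    (fun x => by rw [one_mul, pow_two]; exact (p.star_mul_self' x).ge) h x
  rwa [one_mul] at this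

end CStarSeminorm

/-- Extension of a *-homomorphism from a dense *-subalgebra. -/
theorem exists_starAlgHom_extend {R C P : Type*} [NonUnitalRing R] [StarRing R] [Module ℂ R]
    [NonUnitalCStarAlgebra C] [NonUnitalCStarAlgebra P] (m : R →⋆ₙₐ[ℂ] C) (hm : DenseRange m)
    (f : R →⋆ₙₐ[ℂ] P) (h : ∀ x, ‖f x‖ ≤ ‖m x‖) :
    ∃ F : C →⋆ₙₐ[ℂ] P, ∀ x, F (m x) = f x := by
  let e : R →ₗ[ℂ] C := (m : R →ₗ[ℂ] C)
  let f' : R →ₗ[ℂ] P := (f : R →ₗ[ℂ] P)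
  have key : ∀ x, LinearMap.extendOfNorm f' e (m x) = f x :=
    LinearMap.extendOfNorm_eq (e := e) (f := f') hm ⟨1, fun x => by rw [one_mul]; exact h x⟩
  refine ⟨{ toFun := LinearMap.extendOfNorm f' e
            map_smul' := fun c a => map_smul _ c a
            map_zero' := map_zero _
            map_add' := fun a b => map_add _ a b
            map_mul' := fun a b => ?_
            map_star' := fun a => ?_ }, key⟩
  · refine hm.induction_on₂ (p := fun a b => LinearMap.extendOfNorm f' e (a * b) =
      LinearMap.extendOfNorm f' e a * LinearMap.extendOfNorm f' e b)
      (isClosed_eq (by fun_prop) (by fun_prop)) (fun r s => ?_) a b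
    rw [← map_mul, key, key, key, map_mul]
  · refine hm.induction_on (p := fun a => LinearMap.extendOfNorm f' e (star a) =
      star (LinearMap.extendOfNorm f' e a)) a
      (isClosed_eq (by fun_prop) (by fun_prop)) (fun r => ?_)
    rw [← map_star, key, key, map_star]

/-! ### Homomorphisms between algebraic tensor products -/

section TensorHom

variable {A B A' B' D : Type u}
  [NonUnitalRing A] [StarRing A] [Module ℂ A] [IsScalarTower ℂ A A] [SMulCommClass ℂ A A]
  [StarModule ℂ A]
  [NonUnitalRing B] [StarRing B] [Module ℂ B] [IsScalarTower ℂ B B] [SMulCommClass ℂ B B]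
  [StarModule ℂ B]
  [NonUnitalRing A'] [StarRing A'] [Module ℂ A'] [IsScalarTower ℂ A' A'] [SMulCommClass ℂ A' A']
  [StarModule ℂ A']
  [NonUnitalRing B'] [StarRing B'] [Module ℂ B'] [IsScalarTower ℂ B' B'] [SMulCommClass ℂ B' B']
  [StarModule ℂ B']
  [NonUnitalRing D] [StarRing D] [Module ℂ D] [IsScalarTower ℂ D D] [SMulCommClass ℂ D D]
  [StarModule ℂ D]

/-- A linear map on `A ⊗ B` that respects products and adjoints of elementary tensors is a
*-homomorphism. -/
def tensorStarHom {P : Type*} [NonUnitalRing P] [StarRing P] [Module ℂ P]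
    (f : A ⊗[ℂ] B →ₗ[ℂ] P)
    (hmul : ∀ a b a' b', f ((a * a') ⊗ₜ (b * b')) = f (a ⊗ₜ b) * f (a' ⊗ₜ b'))
    (hstar : ∀ a b, f (star a ⊗ₜ star b) = star (f (a ⊗ₜ b))) : A ⊗[ℂ] B →⋆ₙₐ[ℂ] P where
  toFun := f
  map_smul' := map_smul f
  map_zero' := map_zero f
  map_add' := map_add f
  map_mul' x y := by
    induction x with
    | zero => simp
    | add x x' h h' => rw [add_mul, map_add, h, h', map_add, add_mul]
    | tmul a b =>
      induction y with
      | zero => simp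
      | add y y' h h' => rw [mul_add, map_add, h, h', map_add, mul_add]
      | tmul c d => rw [Algebra.TensorProduct.tmul_mul_tmul, hmul]
  map_star' x := by
    induction x with
    | zero => simp
    | add x x' h h' => rw [star_add, map_add, h, h', map_add, star_add]
    | tmul a b => rw [TensorProduct.star_tmul, hstar]

/-- The *-homomorphism `φ ⊗ ψ`. -/
def tensorMapHom (φ : A →⋆ₙₐ[ℂ] A') (ψ : B →⋆ₙₐ[ℂ] B') : A ⊗[ℂ] B →⋆ₙₐ[ℂ] A' ⊗[ℂ] B' :=
  tensorStarHom (TensorProduct.map (φ : A →ₗ[ℂ] A') (ψ : B →ₗ[ℂ] B'))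
    (fun a b a' b' => by simp) (fun a b => by
      change φ (star a) ⊗ₜ ψ (star b) = star (φ a ⊗ₜ ψ b)
      rw [map_star, map_star, TensorProduct.star_tmul])

theorem tensorMapHom_tmul (φ : A →⋆ₙₐ[ℂ] A') (ψ : B →⋆ₙₐ[ℂ] B') (a : A) (b : B) :
    tensorMapHom φ ψ (a ⊗ₜ b) = φ a ⊗ₜ ψ b := rfl

variable (A B D) in
/-- The flip `A ⊗ B → B ⊗ A`. -/
def tensorCommHom : A ⊗[ℂ] B →⋆ₙₐ[ℂ] B ⊗[ℂ] A :=
  tensorStarHom (TensorProduct.comm ℂ A B).toLinearMap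
    (fun a b a' b' => by simp) (fun a b => by simp)

theorem tensorCommHom_tmul (a : A) (b : B) : tensorCommHom A B (a ⊗ₜ b) = b ⊗ₜ a := rfl

theorem tensorCommHom_comm (x : A ⊗[ℂ] B) : tensorCommHom B A (tensorCommHom A B x) = x :=
  (TensorProduct.comm ℂ A B).symm_apply_apply x

variable (A B D) in
/-- The associativity map `A ⊗ (B ⊗ D) → (A ⊗ B) ⊗ D`. -/
def tensorAssocHom : A ⊗[ℂ] (B ⊗[ℂ] D) →⋆ₙₐ[ℂ] (A ⊗[ℂ] B) ⊗[ℂ] D :=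
  let f : A ⊗[ℂ] (B ⊗[ℂ] D) →ₗ[ℂ] (A ⊗[ℂ] B) ⊗[ℂ] D := (TensorProduct.assoc ℂ A B D).symm
  have hf : ∀ a b d, f (a ⊗ₜ (b ⊗ₜ d)) = (a ⊗ₜ b) ⊗ₜ d := fun _ _ _ => rfl
  tensorStarHom (A := A) (B := B ⊗[ℂ] D) (P := (A ⊗[ℂ] B) ⊗[ℂ] D) f
    (fun a y a' y' => by
      induction y with
      | zero => simp
      | add y y₂ h h' => rw [add_mul, TensorProduct.tmul_add, map_add, h, h',
          TensorProduct.tmul_add, map_add, add_mul]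
      | tmul b d =>
        induction y' with
        | zero => simp
        | add y y₂ h h' => rw [mul_add, TensorProduct.tmul_add, map_add, h, h',
            TensorProduct.tmul_add, map_add, mul_add]
        | tmul b' d' => simp [hf])
    (fun a y => by
      induction y with
      | zero => simp
      | add y y₂ h h' => rw [star_add, TensorProduct.tmul_add, map_add, h, h',
          TensorProduct.tmul_add, map_add, star_add]
      | tmul b d => simp [hf])

end TensorHom

/-! ### Comparison of C*-norms on tensor products -/

section TensorNorm

variable {A B A' B' : Type u} [NonUnitalCStarAlgebra A] [NonUnitalCStarAlgebra B]
  [NonUnitalCStarAlgebra A'] [NonUnitalCStarAlgebra B']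

theorem le_maxTensorNorm {p : CStarSeminorm (A ⊗[ℂ] B)} (hp : p.IsSubcross) (x : A ⊗[ℂ] B) :
    p x ≤ tensorNorm A B .max x :=
  CStarSeminorm.le_sSup (hS := CStarSeminorm.subcross_bounded) hp x

theorem spatial_le_minTensorNorm {H K : Type u} [NormedAddCommGroup H] [InnerProductSpace ℂ H]
    [CompleteSpace H] [NormedAddCommGroup K] [InnerProductSpace ℂ K] [CompleteSpace K]
    (π : A →⋆ₙₐ[ℂ] (H →L[ℂ] H)) (ρ : B →⋆ₙₐ[ℂ] (K →L[ℂ] K)) (x : A ⊗[ℂ] B) :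
    ‖spatialRep π ρ x‖ ≤ tensorNorm A B .min x := by
  change spatialSeminorm π ρ x ≤ minTensorNorm A B x
  unfold minTensorNorm
  refine CStarSeminorm.le_sSup (p := spatialSeminorm π ρ) ?_ x
  exact ⟨H, K, _, _, _, _, _, _, π, ρ, rfl⟩

theorem minTensorNorm_le {x : A ⊗[ℂ] B} {M : ℝ} (h0 : 0 ≤ M)
    (h : ∀ (H K : Type u) [NormedAddCommGroup H] [InnerProductSpace ℂ H] [CompleteSpace H]
      [NormedAddCommGroup K] [InnerProductSpace ℂ K] [CompleteSpace K]
      (π : A →⋆ₙₐ[ℂ] (H →L[ℂ] H)) (ρ : B →⋆ₙₐ[ℂ] (K →L[ℂ] K)), ‖spatialRep π ρ x‖ ≤ M) :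
    tensorNorm A B .min x ≤ M := by
  change minTensorNorm A B x ≤ M
  unfold minTensorNorm
  refine CStarSeminorm.sSup_le h0 ?_
  rintro p ⟨H, K, _, _, _, _, _, _, π, ρ, rfl⟩
  exact h H K π ρ

theorem maxTensorNorm_le {x : A ⊗[ℂ] B} {M : ℝ} (h0 : 0 ≤ M)
    (h : ∀ p : CStarSeminorm (A ⊗[ℂ] B), p.IsSubcross → p x ≤ M) :
    tensorNorm A B .max x ≤ M :=
  CStarSeminorm.sSup_le (hS := CStarSeminorm.subcross_bounded) h0 h

theorem tensorNorm_isSubcross (μ : TensorKind) : (tensorNorm A B μ).IsSubcross := by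
  intro a b
  cases μ with
  | max => exact maxTensorNorm_le (by positivity) fun p hp => hp a b
  | min => exact minTensorNorm_le (by positivity) fun H K _ _ _ _ _ _ π ρ =>
      spatialSeminorm_isSubcross π ρ a b

theorem min_le_max_tensorNorm (x : A ⊗[ℂ] B) : tensorNorm A B .min x ≤ tensorNorm A B .max x :=
  le_maxTensorNorm (tensorNorm_isSubcross .min) x

/-- The maximal and the minimal norm are functorial. -/
theorem tensorNorm_map_le (μ : TensorKind) (φ : A →⋆ₙₐ[ℂ] A') (ψ : B →⋆ₙₐ[ℂ] B')
    (x : A ⊗[ℂ] B) : tensorNorm A' B' μ (tensorMapHom φ ψ x) ≤ tensorNorm A B μ x := by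
  cases μ with
  | max =>
    refine le_maxTensorNorm (p := (tensorNorm A' B' .max).comap (tensorMapHom φ ψ)) ?_ x
    intro a b
    rw [CStarSeminorm.comap_apply, tensorMapHom_tmul]
    refine (tensorNorm_isSubcross .max _ _).trans ?_
    gcongr
    · exact NonUnitalStarAlgHom.norm_apply_le φ a
    · exact NonUnitalStarAlgHom.norm_apply_le ψ b
  | min =>
    refine minTensorNorm_le (CStarSeminorm.nonneg _ _) fun H K _ _ _ _ _ _ π ρ => ?_
    have h : spatialRep π ρ (tensorMapHom φ ψ x) = spatialRep (π.comp φ) (ρ.comp ψ) x := by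
      induction x with
      | zero => simp
      | add x y hx hy => simp only [map_add, hx, hy]
      | tmul a b => rfl
    rw [h]
    exact spatial_le_minTensorNorm _ _ x

/-- For the minimal norm: the flip of the Hilbert spaces is isometric and intertwines the two
spatial representations. -/
theorem tensorNorm_comm_le (μ : TensorKind) (x : A ⊗[ℂ] B) :
    tensorNorm B A μ (tensorCommHom A B x) ≤ tensorNorm A B μ x := by
  cases μ with
  | max =>
    refine le_maxTensorNorm (p := (tensorNorm B A .max).comap (tensorCommHom A B)) ?_ x
    intro a b
    rw [CStarSeminorm.comap_apply, tensorCommHom_tmul, mul_comm]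
    exact tensorNorm_isSubcross .max _ _
  | min =>
    refine minTensorNorm_le (CStarSeminorm.nonneg _ _) fun H K _ _ _ _ _ _ π ρ => ?_
    refine (ContinuousLinearMap.opNorm_le_bound _ (norm_nonneg _) fun v => ?_).trans
      (spatial_le_minTensorNorm ρ π x)
    have h : spatialRep π ρ (tensorCommHom A B x) v =
        TensorProduct.comm ℂ K H (spatialRep ρ π x (TensorProduct.comm ℂ H K v)) := by
      induction x with
      | zero => simp
      | add x y hx hy => simp only [map_add, add_apply, hx, hy]
      | tmul a b =>
        rw [tensorCommHom_tmul, spatialRep_tmul, spatialRep_tmul]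
        induction v with
        | zero => simp
        | add v w hv hw => simp only [map_add, hv, hw]
        | tmul h k => simp
    rw [h, TensorProduct.norm_comm]
    refine (ContinuousLinearMap.le_opNorm _ _).trans ?_
    rw [TensorProduct.norm_comm]

theorem tensorNorm_comm (μ : TensorKind) (x : A ⊗[ℂ] B) :
    tensorNorm B A μ (tensorCommHom A B x) = tensorNorm A B μ x := by
  refine le_antisymm (tensorNorm_comm_le μ x) ?_
  have := tensorNorm_comm_le μ (tensorCommHom A B x)
  rwa [tensorCommHom_comm] at this

end TensorNorm

/-! ### Order and norm in C*-algebras -/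

section Order

attribute [local instance] CStarAlgebra.spectralOrder CStarAlgebra.spectralOrderedRing

/-- The two inequalities confine the spectrum of `x` to `[-‖y‖, ‖y‖]`, and the functional calculus
bounds the norm of a self-adjoint element by its spectrum. The non-unital case follows in the
unitization. -/
theorem norm_le_norm_of_neg_le_of_le_unital {P : Type*} [CStarAlgebra P] {x y : P}
    (hx : IsSelfAdjoint x) (hy : IsSelfAdjoint y) (h₁ : -y ≤ x) (h₂ : x ≤ y) : ‖x‖ ≤ ‖y‖ := by
  have hy' : y ≤ algebraMap ℝ P ‖y‖ := hy.le_algebraMap_norm_self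
  have h3 : x ≤ algebraMap ℝ P ‖y‖ := h₂.trans hy'
  have h4 : algebraMap ℝ P (-‖y‖) ≤ x := by
    rw [map_neg]
    exact (neg_le_neg hy').trans h₁
  rw [le_algebraMap_iff_spectrum_le] at h3
  rw [algebraMap_le_iff_le_spectrum] at h4
  have := norm_cfc_le (f := fun t : ℝ => t) (a := x) (norm_nonneg y)
    (fun t ht => abs_le.mpr ⟨h4 t ht, h3 t ht⟩)
  rwa [cfc_id' ℝ x] at this

theorem norm_le_norm_of_neg_le_of_le {P : Type*} [NonUnitalCStarAlgebra P] {x y : P}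
    (hx : IsSelfAdjoint x) (hy : IsSelfAdjoint y) (h₁ : -y ≤ x) (h₂ : x ≤ y) : ‖x‖ ≤ ‖y‖ := by
  rw [← Unitization.norm_inr (𝕜 := ℂ) x, ← Unitization.norm_inr (𝕜 := ℂ) y]
  refine norm_le_norm_of_neg_le_of_le_unital ?_ ?_ ?_ ?_
  · exact hx.map (Unitization.inrNonUnitalStarAlgHom ℂ P)
  · exact hy.map (Unitization.inrNonUnitalStarAlgHom ℂ P)
  · rw [← Unitization.inr_neg, Unitization.inr_le_iff _ _ hy.neg hx]
    exact h₁
  · rwa [Unitization.inr_le_iff _ _ hx hy]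

/-! ### Positive maps on *-algebras -/

section PositiveMap

variable {R P : Type*} [NonUnitalRing R] [StarRing R] [Module ℂ R] [IsScalarTower ℂ R R]
  [SMulCommClass ℂ R R] [StarModule ℂ R] [NonUnitalCStarAlgebra P]

/-- The seminorm `‖T (x* x)‖^{1/2}` defined by a positive map `T`. -/
def posNorm (T : R →ₗ[ℂ] P) (x : R) : ℝ := √‖T (star x * x)‖

theorem posNorm_nonneg (T : R →ₗ[ℂ] P) (x : R) : 0 ≤ posNorm T x := Real.sqrt_nonneg _

theorem posNorm_mul_self (T : R →ₗ[ℂ] P) (x : R) :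
    posNorm T x * posNorm T x = ‖T (star x * x)‖ := Real.mul_self_sqrt (norm_nonneg _)

theorem posNorm_smul (T : R →ₗ[ℂ] P) (c : ℂ) (x : R) : posNorm T (c • x) = ‖c‖ * posNorm T x := by
  rw [posNorm, star_smul, smul_mul_smul_comm, map_smul, norm_smul, norm_mul, norm_star,
    Real.sqrt_mul (by positivity), Real.sqrt_mul_self (norm_nonneg c), posNorm]

variable {T : R →ₗ[ℂ] P} (hT : ∀ x, 0 ≤ T (star x * x))
include hT

/-- Positivity of `T` at `s x ± s⁻¹ y` sandwiches the symmetrised term between `±(s² T(x* x) + s⁻²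
T(y* y))`; then `s` is optimised. The symmetrised term is all that the triangle inequality for
`posNorm` needs, so mere positivity of `T` suffices. -/
theorem norm_add_star_le_posNorm (x y : R) :
    ‖T (star x * y) + T (star y * x)‖ ≤ 2 * (posNorm T x * posNorm T y) := by
  have hP : ∀ x, IsSelfAdjoint (T (star x * x)) := fun x => .of_nonneg (hT x)
  have e1 : ∀ a b : ℝ, T (star ((a : ℂ) • x + (b : ℂ) • y) * ((a : ℂ) • x + (b : ℂ) • y)) =
      (a * a) • T (star x * x) + (b * b) • T (star y * y) +
        (a * b) • (T (star x * y) + T (star y * x)) := by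
    intro a b
    have ha : ∀ a : ℝ, star (a : ℂ) = (a : ℂ) := Complex.conj_ofReal
    simp only [star_add, star_smul, add_mul, mul_add, smul_mul_smul_comm, map_add, map_smul, ha,
      ← Complex.coe_smul, Complex.ofReal_mul]
    module
  have hX : IsSelfAdjoint (T (star x * y) + T (star y * x)) := by
    have h1 := hP (((1 : ℝ) : ℂ) • x + ((1 : ℝ) : ℂ) • y)
    rw [e1] at h1
    have h2 := (h1.sub (hP x)).sub (hP y)
    rw [mul_one, one_smul, one_smul, one_smul] at h2
    convert h2 using 1
    abel
  have key : ∀ s : ℝ, 0 < s → ‖T (star x * y) + T (star y * x)‖ ≤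
      s * s * (posNorm T x * posNorm T x) + s⁻¹ * s⁻¹ * (posNorm T y * posNorm T y) := by
    intro s hs
    have h1 := hT ((s : ℂ) • x + ((s⁻¹ : ℝ) : ℂ) • y)
    have h2 := hT ((s : ℂ) • x + ((-s⁻¹ : ℝ) : ℂ) • y)
    rw [e1] at h1 h2
    rw [mul_inv_cancel₀ hs.ne', one_smul] at h1
    rw [neg_mul_neg, mul_neg, mul_inv_cancel₀ hs.ne', neg_smul, one_smul, ← sub_eq_add_neg,
      sub_nonneg] at h2
    rw [← neg_le_iff_add_nonneg'] at h1
    refine (norm_le_norm_of_neg_le_of_le hX ?_ h1 h2).trans ?_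
    · exact ((IsSelfAdjoint.all (s * s)).smul (hP x)).add
        ((IsSelfAdjoint.all (s⁻¹ * s⁻¹)).smul (hP y))
    · refine (norm_add_le _ _).trans_eq ?_
      rw [norm_smul, norm_smul, posNorm_mul_self, posNorm_mul_self,
        Real.norm_of_nonneg (by positivity), Real.norm_of_nonneg (by positivity)]
  have hx0 := posNorm_nonneg T x
  have hy0 := posNorm_nonneg T y
  refine le_of_forall_pos_le_add fun ε hε => ?_
  set a := posNorm T x
  set b := posNorm T y
  -- The optimal choice is `s² = b / a`. If `a` or `b` vanishes, `s` is instead chosen so that the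
  -- surviving term is at most `ε`.
  rcases hx0.eq_or_lt with hx | hx
  · have h := key ((b + 1) / √ε) (by positivity)
    refine h.trans ?_
    rw [← hx]
    have h1 : ((b + 1) / √ε)⁻¹ * ((b + 1) / √ε)⁻¹ * (b * b) = ε * ((b * b) / ((b + 1) * (b + 1))) := by
      field_simp
      rw [Real.sq_sqrt hε.le]
    have h2 : (b * b) / ((b + 1) * (b + 1)) ≤ 1 := by
      rw [div_le_one (by positivity)]; nlinarith
    rw [h1]
    nlinarith
  rcases hy0.eq_or_lt with hy | hy
  · have h := key (√ε / (a + 1)) (by positivity)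
    refine h.trans ?_
    rw [← hy]
    have h1 : (√ε / (a + 1)) * (√ε / (a + 1)) * (a * a) = ε * ((a * a) / ((a + 1) * (a + 1))) := by
      field_simp
      rw [Real.sq_sqrt hε.le]
    have h2 : (a * a) / ((a + 1) * (a + 1)) ≤ 1 := by
      rw [div_le_one (by positivity)]; nlinarith
    rw [h1]
    nlinarith
  · have h := key (√(b / a)) (by positivity)
    rw [← mul_inv, Real.mul_self_sqrt (by positivity)] at h
    refine h.trans (le_of_eq_of_le ?_ (le_add_of_nonneg_right hε.le))
    field_simp
    ring

theorem posNorm_add_le (x y : R) : posNorm T (x + y) ≤ posNorm T x + posNorm T y := by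
  have hx0 := posNorm_nonneg T x
  have hy0 := posNorm_nonneg T y
  refine Real.sqrt_le_iff.mpr ⟨by positivity, ?_⟩
  have e : T (star (x + y) * (x + y)) = T (star x * x) + T (star y * y) +
      (T (star x * y) + T (star y * x)) := by
    simp only [star_add, add_mul, mul_add, map_add]
    abel
  rw [e]
  have h1 := norm_add_star_le_posNorm hT x y
  have h2 := posNorm_mul_self T x
  have h3 := posNorm_mul_self T y
  have h4 : ‖T (star x * x) + T (star y * y) + (T (star x * y) + T (star y * x))‖ ≤
    ‖T (star x * x)‖ + ‖T (star y * y)‖ + ‖T (star x * y) + T (star y * x)‖ := norm_add₃_le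
  nlinarith

/-- For symmetric `star x * y` the symmetrised term is `2 T(x* y)`, which gives the Cauchy-Schwarz
inequality without an extra factor. -/
theorem norm_le_posNorm_of_eq {x y : R} (h : star y * x = star x * y) :
    ‖T (star x * y)‖ ≤ posNorm T x * posNorm T y := by
  have := norm_add_star_le_posNorm hT x y
  rw [h, ← two_smul ℝ, norm_smul, Real.norm_of_nonneg zero_le_two] at this
  linarith

/-- If `L` is an operator with `(L x)* (L x) = x* M x = (M x)* x`, then
`‖L x‖² ≤ ‖x‖ ‖M x‖`. -/
theorem posNorm_sq_le {x y z : R} (h₁ : star y * y = star x * z) (h₂ : star z * x = star x * z) :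
    posNorm T y ^ 2 ≤ posNorm T x * posNorm T z := by
  rw [pow_two, posNorm_mul_self, h₁]
  exact norm_le_posNorm_of_eq hT h₂

end PositiveMap

end Order

/-! ### C*-seminorms defined by left multiplication -/

section OpSeminorm

variable {R : Type u} [NonUnitalRing R] [StarRing R] [Module ℂ R] [IsScalarTower ℂ R R]

/-- The operator norm of left multiplication by `f` with respect to `N`. -/
def leftMulNorm (N : Seminorm ℂ R) (f : R) : ℝ :=
  sInf {M : ℝ | 0 ≤ M ∧ ∀ x, N (f * x) ≤ M * N x}

theorem leftMulNorm_le {N : Seminorm ℂ R} {f : R} {M : ℝ} (h0 : 0 ≤ M)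
    (h : ∀ x, N (f * x) ≤ M * N x) : leftMulNorm N f ≤ M :=
  csInf_le ⟨0, fun _ h => h.1⟩ ⟨h0, h⟩

theorem leftMulNorm_nonneg (N : Seminorm ℂ R) (f : R) : 0 ≤ leftMulNorm N f :=
  Real.sInf_nonneg fun _ h => h.1

theorem le_leftMulNorm {N : Seminorm ℂ R} {f : R} (hb : ∃ M : ℝ, 0 ≤ M ∧ ∀ x, N (f * x) ≤ M * N x)
    (x : R) : N (f * x) ≤ leftMulNorm N f * N x := by
  obtain ⟨M, hM⟩ := hb
  rcases (apply_nonneg N x).eq_or_lt with h | h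
  · rw [← h, mul_zero]
    have := hM.2 x
    rwa [← h, mul_zero] at this
  · rw [← div_le_iff₀ h]
    exact le_csInf ⟨M, hM⟩ fun N' hN => (div_le_iff₀ h).mpr (hN.2 x)

/-- The C*-seminorm given by the operators of left multiplication. -/
def CStarSeminorm.leftMul (N : Seminorm ℂ R)
    (hsq : ∀ f x, N (f * x) ^ 2 ≤ N x * N (star f * f * x))
    (hb : ∀ f, ∃ M : ℝ, 0 ≤ M ∧ ∀ x, N (f * x) ≤ M * N x) : CStarSeminorm R where
  toFun := leftMulNorm N
  map_zero' := le_antisymm (leftMulNorm_le le_rfl fun x => by simp) (leftMulNorm_nonneg _ _)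
  add_le' f g := leftMulNorm_le (add_nonneg (leftMulNorm_nonneg _ _) (leftMulNorm_nonneg _ _))
    fun x => by
      rw [add_mul, add_mul]
      exact (map_add_le_add N _ _).trans
        (add_le_add (le_leftMulNorm (hb f) x) (le_leftMulNorm (hb g) x))
  neg' f := by simp only [leftMulNorm, neg_mul, map_neg_eq_map]
  smul' c f := by
    have key : ∀ (c : ℂ) (f : R), leftMulNorm N (c • f) ≤ ‖c‖ * leftMulNorm N f :=
      fun c f => leftMulNorm_le (mul_nonneg (norm_nonneg c) (leftMulNorm_nonneg _ _)) fun x => by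
        rw [smul_mul_assoc, map_smul_eq_mul, mul_assoc]
        exact mul_le_mul_of_nonneg_left (le_leftMulNorm (hb f) x) (norm_nonneg c)
    refine le_antisymm (key c f) ?_
    rcases eq_or_ne c 0 with rfl | hc
    · rw [norm_zero, zero_mul]
      exact leftMulNorm_nonneg _ _
    · have h := key c⁻¹ (c • f)
      rw [smul_smul, inv_mul_cancel₀ hc, one_smul, norm_inv] at h
      rwa [inv_mul_eq_div, le_div_iff₀' (norm_pos_iff.mpr hc)] at h
  mul_le' f g := leftMulNorm_le (mul_nonneg (leftMulNorm_nonneg _ _) (leftMulNorm_nonneg _ _))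
    fun x => by
      rw [mul_assoc, mul_assoc]
      exact (le_leftMulNorm (hb f) _).trans
        (mul_le_mul_of_nonneg_left (le_leftMulNorm (hb g) x) (leftMulNorm_nonneg _ f))
  star_mul_self' := by
    have hmul : ∀ f g : R, leftMulNorm N (f * g) ≤ leftMulNorm N f * leftMulNorm N g :=
      fun f g => leftMulNorm_le (mul_nonneg (leftMulNorm_nonneg _ _) (leftMulNorm_nonneg _ _))
        fun x => by
          rw [mul_assoc, mul_assoc]
          exact (le_leftMulNorm (hb f) _).trans
            (mul_le_mul_of_nonneg_left (le_leftMulNorm (hb g) x) (leftMulNorm_nonneg _ f))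
    have key : ∀ f : R, leftMulNorm N f * leftMulNorm N f ≤ leftMulNorm N (star f * f) := by
      intro f
      have h : leftMulNorm N f ≤ √(leftMulNorm N (star f * f)) := by
        refine leftMulNorm_le (Real.sqrt_nonneg _) fun x => ?_
        rw [← Real.sqrt_mul_self (apply_nonneg N x), ← Real.sqrt_mul (leftMulNorm_nonneg _ _)]
        refine Real.le_sqrt_of_sq_le ((hsq f x).trans ?_)
        have := mul_le_mul_of_nonneg_left (le_leftMulNorm (hb (star f * f)) x) (apply_nonneg N x)
        linarith
      calc _ ≤ √(leftMulNorm N (star f * f)) * √(leftMulNorm N (star f * f)) :=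
            mul_le_mul h h (leftMulNorm_nonneg _ f) (Real.sqrt_nonneg _)
        _ = _ := Real.mul_self_sqrt (leftMulNorm_nonneg _ _)
    have key' : ∀ f : R, leftMulNorm N f ≤ leftMulNorm N (star f) := by
      intro f
      have h1 := (key f).trans (hmul _ _)
      rcases (leftMulNorm_nonneg N f).eq_or_lt with h | h
      · rw [← h]; exact leftMulNorm_nonneg _ _
      · exact le_of_mul_le_mul_right h1 h
    intro f
    refine le_antisymm ((hmul _ _).trans ?_) (key f)
    refine mul_le_mul_of_nonneg_right ?_ (leftMulNorm_nonneg _ f)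
    simpa using key' (star f)

end OpSeminorm

/-! ### Extension from dense subalgebras -/

/-- A bounded *-representation of a dense *-subalgebra on a pre-Hilbert space extends to a
representation on the completion. -/
theorem exists_completion_rep {R C E : Type*} [NonUnitalRing R] [StarRing R] [Module ℂ R]
    [NonUnitalCStarAlgebra C] [SeminormedAddCommGroup E] [InnerProductSpace ℂ E]
    (m : R →⋆ₙₐ[ℂ] C) (hm : DenseRange m) (f : R →ₗ[ℂ] E →ₗ[ℂ] E)
    (hmul : ∀ x y v, f (x * y) v = f x (f y v))
    (hstar : ∀ x v w, inner ℂ (f (star x) v) w = inner ℂ v (f x w))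
    (hb : ∀ x v, ‖f x v‖ ≤ ‖m x‖ * ‖v‖) :
    ∃ θ : C →⋆ₙₐ[ℂ] (Completion E →L[ℂ] Completion E), ∀ x (v : E),
      θ (m x) (v : Completion E) = ((f x v : E) : Completion E) := by
  let e : E →ₗ[ℂ] Completion E := (Completion.toComplₗᵢ : E →ₗᵢ[ℂ] Completion E).toLinearMap
  have he : DenseRange e := Completion.denseRange_coe
  have hb' : ∀ x v, ‖(e ∘ₗ f x) v‖ ≤ ‖m x‖ * ‖e v‖ := fun x v => by
    change ‖((f x v : E) : Completion E)‖ ≤ ‖m x‖ * ‖(v : Completion E)‖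
    rw [Completion.norm_coe, Completion.norm_coe]
    exact hb x v
  have key : ∀ x v, LinearMap.extendOfNorm (e ∘ₗ f x) e (e v) = e (f x v) := fun x v =>
    LinearMap.extendOfNorm_eq he ⟨_, hb' x⟩ v
  have ext : ∀ {S T : Completion E →L[ℂ] Completion E}, (∀ v, S (e v) = T (e v)) → S = T := by
    intro S T h
    ext1 v
    exact he.induction_on (p := fun v => S v = T v) v (isClosed_eq S.continuous T.continuous) h
  let F₀ : R →⋆ₙₐ[ℂ] (Completion E →L[ℂ] Completion E) :=
    { toFun := fun x => LinearMap.extendOfNorm (e ∘ₗ f x) e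
      map_smul' := fun c x => ext fun v => (key _ v).trans (by simp [key])
      map_zero' := ext fun v => (key _ v).trans (by simp)
      map_add' := fun x y => ext fun v => (key _ v).trans (by simp [key])
      map_mul' := fun x y => ext fun v => by simp [key, hmul]
      map_star' := fun x => by
        rw [ContinuousLinearMap.star_eq_adjoint, ContinuousLinearMap.eq_adjoint_iff]
        intro v w
        refine he.induction_on₂ (p := fun v w => inner ℂ (LinearMap.extendOfNorm
          (e ∘ₗ f (star x)) e v) w = inner ℂ v (LinearMap.extendOfNorm (e ∘ₗ f x) e w))
          (isClosed_eq ?_ ?_) (fun v w => ?_) v w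
        · fun_prop
        · fun_prop
        · rw [key, key]
          change inner ℂ ((f (star x) v : E) : Completion E) (w : Completion E) =
            inner ℂ (v : Completion E) ((f x w : E) : Completion E)
          rw [Completion.inner_coe, Completion.inner_coe, hstar] }
  obtain ⟨θ, hθ⟩ := exists_starAlgHom_extend m hm F₀ fun x =>
    LinearMap.opNorm_extendOfNorm_le he (norm_nonneg _) (hb' x)
  exact ⟨θ, fun x v => by rw [hθ]; exact key x v⟩

/-- A *-homomorphism on `A ⊗ R` that is bounded by the norm of `A` times the norm of a C*-algebra `E`
in which `R` is dense extends to `A ⊗ E`. -/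
theorem exists_extend_second_leg {A R E P : Type u} [NonUnitalCStarAlgebra A] [NonUnitalRing R]
    [StarRing R] [Module ℂ R] [IsScalarTower ℂ R R] [SMulCommClass ℂ R R] [StarModule ℂ R]
    [NonUnitalCStarAlgebra E] [NonUnitalCStarAlgebra P] (m : R →⋆ₙₐ[ℂ] E) (hm : DenseRange m)
    (f : A ⊗[ℂ] R →⋆ₙₐ[ℂ] P) (h : ∀ a y, ‖f (a ⊗ₜ y)‖ ≤ ‖a‖ * ‖m y‖) :
    ∃ Φ : A ⊗[ℂ] E →⋆ₙₐ[ℂ] P, (∀ a y, ‖Φ (a ⊗ₜ y)‖ ≤ ‖a‖ * ‖y‖) ∧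
      ∀ x, Φ (tensorMapHom (.id ℂ A) m x) = f x := by
  let e : R →ₗ[ℂ] E := (m : R →ₗ[ℂ] E)
  let b : A → R →ₗ[ℂ] P := fun a => (f : A ⊗[ℂ] R →ₗ[ℂ] P) ∘ₗ TensorProduct.mk ℂ A R a
  have hb : ∀ a y, ‖b a y‖ ≤ ‖a‖ * ‖e y‖ := h
  -- For each fixed `a` the map `y ↦ f (a ⊗ y)` is bounded and extends continuously to `E`. All
  -- algebraic identities, including linearity in `a`, are then checked on the dense image of `R`.
  let β : A → E →L[ℂ] P := fun a => LinearMap.extendOfNorm (b a) e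
  have key : ∀ a y, β a (m y) = f (a ⊗ₜ y) := fun a y =>
    LinearMap.extendOfNorm_eq (f := b a) (e := e) hm ⟨_, hb a⟩ y
  have hβ : ∀ a y, ‖β a y‖ ≤ ‖a‖ * ‖y‖ := fun a y =>
    LinearMap.norm_extendOfNorm_apply_le (f := b a) (e := e) hm _ (hb a) y
  clear_value β
  let F : A ⊗[ℂ] E →ₗ[ℂ] P := TensorProduct.lift (LinearMap.mk₂ ℂ (fun a y => β a y)
    (fun a a' y => by
      refine hm.induction_on (p := fun y => β (a + a') y = β a y + β a' y) y
        (isClosed_eq (by fun_prop) (by fun_prop)) fun y => ?_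
      rw [key, key, key, TensorProduct.add_tmul, map_add])
    (fun c a y => by
      refine hm.induction_on (p := fun y => β (c • a) y = c • β a y) y
        (isClosed_eq (by fun_prop) (by fun_prop)) fun y => ?_
      rw [key, key, ← TensorProduct.smul_tmul', map_smul])
    (fun a y y' => map_add _ _ _) (fun c a y => map_smul _ _ _))
  have hF : ∀ a y, F (a ⊗ₜ y) = β a y := fun _ _ => rfl
  clear_value F
  let Φ : A ⊗[ℂ] E →⋆ₙₐ[ℂ] P := tensorStarHom F
    (fun a y a' y' => by
      rw [hF, hF, hF]
      refine hm.induction_on₂ (p := fun y y' => β (a * a') (y * y') = β a y * β a' y')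
        (isClosed_eq (by fun_prop) (by fun_prop)) (fun y y' => ?_) y y'
      rw [← map_mul, key, key, key, ← map_mul, Algebra.TensorProduct.tmul_mul_tmul])
    (fun a y => by
      rw [hF, hF]
      refine hm.induction_on (p := fun y => β (star a) (star y) = star (β a y)) y
        (isClosed_eq (by fun_prop) (by fun_prop)) fun y => ?_
      rw [← map_star, key, key, ← map_star, TensorProduct.star_tmul])
  have hΦ : ∀ a y, Φ (a ⊗ₜ y) = β a y := hF
  clear_value Φ
  refine ⟨Φ, fun a y => by rw [hΦ]; exact hβ a y, fun x => ?_⟩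
  induction x with
  | zero => simp
  | add x y hx hy => rw [map_add, map_add, hx, hy, map_add]
  | tmul a y => rw [tensorMapHom_tmul, hΦ, key]; rfl

namespace FellBundle

variable {G : Type u} [Group G] (B : FellBundle G)

/-! ### Fibres in the cross-sectional algebras -/

/-- The canonical *-homomorphism `C_c(B) → C*(B)`. -/
def toFullHom : B.Sec →⋆ₙₐ[ℂ] B.FullAlg := B.fullNorm.toAlgHom

theorem denseRange_toFullHom : DenseRange B.toFullHom := B.fullNorm.denseRange_toAlg

theorem norm_toFullHom (x : B.Sec) : ‖B.toFullHom x‖ = B.fullNorm x := B.fullNorm.norm_toAlg x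

theorem toFullHom_single (g : G) (a : B.fiber g) : B.toFullHom (B.single g a) = B.toFull g a := rfl

theorem fullNorm_single_le (g : G) (a : B.fiber g) : B.fullNorm (B.single g a) ≤ ‖a‖ :=
  CStarSeminorm.sSup_le (hS := B.fibreContractive_bounded) (norm_nonneg a) fun _ hp => hp g a

theorem moduleNorm_single (g : G) (a : B.fiber g) : B.moduleNorm (B.single g a) = ‖a‖ := by
  rw [moduleNorm, B.norm_innerSec_single, Real.sqrt_mul_self (norm_nonneg a)]

theorem star_single_mul_single_self {g : G} (a b : B.fiber g) :
    star (B.single g a) * B.single g b =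
      B.single 1 (B.mulMap (inv_mul_cancel g) (B.starMap rfl a) b) := by
  rw [B.star_single rfl, B.single_mul_single (inv_mul_cancel g)]

theorem single_one_mul (a b : B.fiber 1) : B.single 1 (a * b) = B.single 1 a * B.single 1 b :=
  (B.single_mul_single (one_mul 1) a b).symm

theorem single_one_star (a : B.fiber 1) : B.single 1 (star a) = star (B.single 1 a) :=
  (B.star_single inv_one a).symm

/-- The lower bound comes from the regular representation: `a δ_1` sends the vector `a* δ_1` of norm
`‖a‖` to one of norm `‖a‖²`. -/
theorem fullNorm_single_one (a : B.fiber 1) : B.fullNorm (B.single 1 a) = ‖a‖ := by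
  refine le_antisymm (B.fullNorm_single_le 1 a) ?_
  have h1 := B.moduleNorm_mul_le (B.single 1 a) (B.single 1 (star a))
  rw [← B.single_one_mul, B.moduleNorm_single, B.moduleNorm_single,
    CStarRing.norm_self_mul_star, norm_star] at h1
  have h2 := B.redNorm_le_fullNorm (B.single 1 a)
  rcases (norm_nonneg a).eq_or_lt with h | h
  · rw [← h]; exact B.fullNorm.nonneg _
  · exact (le_of_mul_le_mul_right h1 h).trans h2

/-- The C*-identity reduces this to the unit fibre. -/
theorem fullNorm_single (g : G) (a : B.fiber g) : B.fullNorm (B.single g a) = ‖a‖ := by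
  have h1 := B.fullNorm.star_mul_self' (B.single g a)
  rw [B.star_single_mul_single_self] at h1
  have h2 := (B.fullNorm_single_one _).symm.trans h1
  rw [B.norm_starMap_mulMap_self] at h2
  exact ((mul_self_inj_of_nonneg (norm_nonneg a) (B.fullNorm.nonneg _)).mp h2).symm

theorem norm_toFull (g : G) (a : B.fiber g) : ‖B.toFull g a‖ = ‖a‖ :=
  (B.norm_toFullHom _).trans (B.fullNorm_single g a)

/-- The inclusion of the unit fibre into `C_c(B)` as a *-homomorphism. -/
def singleOneHom : B.fiber 1 →⋆ₙₐ[ℂ] B.Sec where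
  toFun := B.single 1
  map_smul' := map_smul _
  map_zero' := map_zero _
  map_add' := map_add _
  map_mul' := B.single_one_mul
  map_star' := B.single_one_star

/-- The inclusion of the unit fibre into `C*(B)` as a *-homomorphism. -/
def toFullOneHom : B.fiber 1 →⋆ₙₐ[ℂ] B.FullAlg := B.toFullHom.comp B.singleOneHom

theorem toFullOneHom_apply (a : B.fiber 1) : B.toFullOneHom a = B.toFull 1 a := rfl

theorem moduleNorm_mul_sq_le (f x : B.Sec) :
    B.moduleNorm (f * x) ^ 2 ≤ B.moduleNorm x * B.moduleNorm (star f * f * x) := by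
  rw [pow_two, moduleNorm_mul_self]
  have h1 : B.innerSec (f * x) (f * x) = B.innerSec x (star f * f * x) := by
    rw [innerSec, innerSec, star_mul]
    simp only [mul_assoc]
  rw [h1]
  exact B.norm_innerSec_le _ _

/-- For a *-homomorphism `Δ` into `C_c(B)` and a C*-seminorm `q`, the operator `Δ f` is bounded by
`q f` on all sums of vectors `y` for which `Δ f y` is bounded by a multiple of `q f`. -/
theorem moduleNorm_map_mul_le {R : Type u} [NonUnitalRing R] [StarRing R] [Module ℂ R]
    (Δ : R →⋆ₙₐ[ℂ] B.Sec) (q : CStarSeminorm R) {ι : Type*} (s : Finset ι) (y : ι → B.Sec)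
    (h : ∀ i ∈ s, ∃ C, ∀ f, B.moduleNorm (Δ f * y i) ≤ C * q f) (f : R) :
    B.moduleNorm (Δ f * ∑ i ∈ s, y i) ≤ q f * B.moduleNorm (∑ i ∈ s, y i) := by
  have hC : ∃ C, ∀ f, B.moduleNorm (Δ f * ∑ i ∈ s, y i) ≤ C * q f := by
    classical
    induction s using Finset.induction_on with
    | empty => exact ⟨0, fun f => by simp [moduleNorm, innerSec]⟩
    | insert i s hi ih =>
      obtain ⟨C, hC⟩ := h i (Finset.mem_insert_self i s)
      obtain ⟨C', hC'⟩ := ih fun j hj => h j (Finset.mem_insert_of_mem hj)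
      refine ⟨C + C', fun f => ?_⟩
      rw [Finset.sum_insert hi, mul_add, add_mul]
      exact (B.moduleNorm_add_le _ _).trans (add_le_add (hC f) (hC' f))
  obtain ⟨C, hC⟩ := hC
  rw [mul_comm]
  -- Cauchy-Schwarz gives `‖Δ f y‖² ≤ ‖y‖ ‖Δ(f* f) y‖` for the whole sum `y`, so the constant
  -- collected from the summands may be replaced by `‖y‖`.
  refine le_mul_of_sq_le_mul (K := fun f => B.moduleNorm (Δ f * ∑ i ∈ s, y i)) (q := q)
    (φ := fun f => star f * f) (B.moduleNorm_nonneg _) q.nonneg q.star_mul_self' (fun f => ?_) hC f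
  have := B.moduleNorm_mul_sq_le (Δ f) (∑ i ∈ s, y i)
  rwa [← map_star, ← map_mul] at this

/-! ### The trivial bundle `P × G` -/

variable (G) in
/-- The Fell bundle over `G` all of whose fibres are `P`. -/
def constBundle (P : Type u) [NonUnitalCStarAlgebra P] : FellBundle G where
  fiber _ := P
  mulMap _ := LinearMap.mul ℂ P
  starMap _ := (starLinearEquiv ℂ : P ≃ₗ⋆[ℂ] P).toLinearMap
  assoc _ _ _ _ a b c := mul_assoc a b c
  starMap_starMap _ _ a := star_star a
  starMap_mulMap _ _ _ _ _ a b := star_mul a b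
  norm_mulMap_le _ a b := norm_mul_le a b
  norm_starMap _ a := norm_star a
  norm_starMap_mulMap_self _ _ a := CStarRing.norm_star_mul_self (x := a)
  starMap_mulMap_self_pos _ _ a := ⟨a, rfl⟩

section Const

variable {P : Type u} [NonUnitalCStarAlgebra P]

/-- The section `a δ_g` of the trivial bundle. -/
abbrev constSingle (g : G) : P →ₗ[ℂ] (constBundle G P).Sec := (constBundle G P).single g

/-- The value at the unit of a section of the trivial bundle. -/
def constEval : (constBundle G P).Sec →ₗ[ℂ] P := (constBundle G P).eval 1

theorem constSingle_mul (g h : G) (a b : P) :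
    constSingle g a * constSingle h b = constSingle (g * h) (a * b) :=
  (constBundle G P).single_mul_single rfl a b

theorem constSingle_star (g : G) (a : P) : star (constSingle g a) = constSingle g⁻¹ (star a) :=
  (constBundle G P).star_single rfl a

theorem constEval_single_one (a : P) : constEval (constSingle (1 : G) a) = a :=
  (constBundle G P).eval_single_same 1 a

theorem constEval_single_ne {g : G} (h : g ≠ 1) (a : P) : constEval (constSingle g a) = 0 :=
  (constBundle G P).eval_single_ne h a

theorem moduleNorm_const_mul_self (y : (constBundle G P).Sec) :
    (constBundle G P).moduleNorm y * (constBundle G P).moduleNorm y = ‖constEval (star y * y)‖ :=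
  (constBundle G P).moduleNorm_mul_self y

theorem norm_constEval_le (x y : (constBundle G P).Sec) : ‖constEval (star x * y)‖ ≤
    (constBundle G P).moduleNorm x * (constBundle G P).moduleNorm y :=
  (constBundle G P).norm_innerSec_le x y

theorem constEval_star_single_mul_mul_single (t : G) (b c : P) (w : (constBundle G P).Sec) :
    constEval (star (constSingle t b) * (w * constSingle t c)) = star b * constEval w * c := by
  refine (constBundle G P).sec_induction w (by simp) (fun g (a : P) => ?_) fun x y hx hy => by
    simp only [add_mul, mul_add, map_add, hx, hy]
  change constEval (star (constSingle t b) * (constSingle g a * constSingle t c)) =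
    star b * constEval (constSingle g a) * c
  rw [constSingle_star, constSingle_mul, constSingle_mul]
  by_cases hg : g = 1
  · subst hg
    rw [one_mul, inv_mul_cancel, constEval_single_one, constEval_single_one, mul_assoc]
  · rw [constEval_single_ne hg, constEval_single_ne, mul_zero, zero_mul]
    intro h
    rw [inv_mul_eq_one] at h
    exact hg (mul_eq_right.mp h.symm)

theorem moduleNorm_constSingle_mul_le (g : G) (b : P) (y : (constBundle G P).Sec) :
    (constBundle G P).moduleNorm (constSingle g b * y) ≤ ‖b‖ * (constBundle G P).moduleNorm y :=
  (constBundle G P).moduleNorm_single_mul_le (g := g) b y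

theorem moduleNorm_mul_constSingle_sq (t : G) (c : P) (w : (constBundle G P).Sec) :
    (constBundle G P).moduleNorm (w * constSingle t c) ^ 2 =
      ‖star c * constEval (star w * w) * c‖ := by
  rw [pow_two, moduleNorm_const_mul_self, ← constEval_star_single_mul_mul_single t, star_mul]
  simp only [mul_assoc]

/-- The section of the trivial bundle given by a finitely supported function. -/
def constSec (v : G →₀ P) : (constBundle G P).Sec := ∑ h ∈ v.support, constSingle h (v h)

/-- In `⟪v, (b δ_g) v⟫` only the pairs `(gh, h)` meet at the unit. This is Exel's sum, written as a
coefficient of left convolution with respect to one vector. -/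
theorem constEval_star_constSec_mul (v : G →₀ P) (g : G) (b : P) :
    constEval (star (constSec v) * (constSingle g b * constSec v)) =
      v.sum fun h c => star (v (g * h)) * b * c := by
  rw [constSec, Finsupp.sum, star_sum, Finset.mul_sum, Finset.sum_mul, map_sum]
  simp only [Finset.mul_sum, map_sum]
  rw [Finset.sum_comm]
  refine Finset.sum_congr rfl fun h _ => ?_
  rw [Finset.sum_eq_single (g * h)]
  · rw [constSingle_star, constSingle_mul, constSingle_mul, inv_mul_cancel, constEval_single_one,
      mul_assoc]
  · intro k _ hk
    rw [constSingle_star, constSingle_mul, constSingle_mul, constEval_single_ne]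
    rw [ne_eq, inv_mul_eq_one]
    exact hk
  · intro hk
    rw [Finsupp.notMem_support_iff.mp hk, map_zero, star_zero, zero_mul, map_zero]

theorem constEval_star_constSec_self (v : G →₀ P) :
    constEval (star (constSec v) * constSec v) = v.sum fun _ c => star c * c := by
  rw [constSec, Finsupp.sum, star_sum, Finset.sum_mul, map_sum]
  simp only [Finset.mul_sum, map_sum]
  refine Finset.sum_congr rfl fun h hh => ?_
  rw [Finset.sum_eq_single h]
  · rw [constSingle_star, constSingle_mul, inv_mul_cancel, constEval_single_one]
  · intro k _ hk
    rw [constSingle_star, constSingle_mul, constEval_single_ne]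
    rw [ne_eq, inv_mul_eq_one]
    exact hk.symm
  · exact fun hk => absurd hh hk

end Const

/-! ### The approximation property -/

/-- The map `a ↦ ∑ h, ξ(gh)* a ξ(h)` on the fibre at `g`. -/
def apMap (ξ : G →₀ B.fiber 1) (g : G) : B.fiber g →ₗ[ℂ] B.fiber g :=
  ∑ h ∈ ξ.support, (B.mulMap (mul_one g)).flip (ξ h) ∘ₗ B.mulMap (one_mul g) (star (ξ (g * h)))

theorem apMap_apply (ξ : G →₀ B.fiber 1) (g : G) (a : B.fiber g) : B.apMap ξ g a =
    ξ.sum fun h b => B.mulMap (mul_one g) (B.mulMap (one_mul g) (star (ξ (g * h))) a) b := by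
  rw [apMap, LinearMap.sum_apply]
  rfl

theorem single_apMap (ξ : G →₀ B.fiber 1) (g : G) (a : B.fiber g) :
    B.single g (B.apMap ξ g a) =
      ∑ h ∈ ξ.support, star (B.single 1 (ξ (g * h))) * B.single g a * B.single 1 (ξ h) := by
  rw [apMap_apply, Finsupp.sum, map_sum]
  refine Finset.sum_congr rfl fun h _ => ?_
  rw [← B.single_one_star, B.single_mul_single (one_mul g), B.single_mul_single (mul_one g)]

theorem single_sum_star_mul_self (ξ : G →₀ B.fiber 1) :
    B.single 1 (ξ.sum fun _ b => star b * b) =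
      ∑ h ∈ ξ.support, star (B.single 1 (ξ h)) * B.single 1 (ξ h) := by
  rw [Finsupp.sum, map_sum]
  refine Finset.sum_congr rfl fun h _ => ?_
  rw [B.single_one_mul, B.single_one_star]

/-- The approximation property in terms of filters. -/
theorem hasAP_of_filter (l : Filter (G →₀ B.fiber 1)) [l.NeBot] (M : ℝ)
    (hM : ∀ᶠ ξ in l, ‖ξ.sum fun _ b => star b * b‖ ≤ M)
    (hl : ∀ g (a : B.fiber g), Filter.Tendsto (fun ξ => B.apMap ξ g a) l (nhds a)) : B.HasAP := by
  have hne : ∀ s : {s // s ∈ l}, ∃ ξ ∈ s.1, ‖ξ.sum fun _ b => star b * b‖ ≤ M := fun s =>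
    Filter.nonempty_of_mem (Filter.inter_mem s.2 hM)
  choose ξ hξ hξM using hne
  -- The filter is turned into a net by choosing a point in each of its members, the members being
  -- ordered by reverse inclusion.
  refine ⟨{s // s ∈ l}ᵒᵈ, inferInstance, ⟨fun s t => ?_⟩, ⟨⟨Set.univ, Filter.univ_mem⟩⟩,
    fun s => ξ s.ofDual, ⟨M, fun s => hξM _⟩, fun g a => ?_⟩
  · exact ⟨⟨s.1 ∩ t.1, Filter.inter_mem s.2 t.2⟩, Set.inter_subset_left, Set.inter_subset_right⟩
  · have h1 : Filter.Tendsto (fun s : {s // s ∈ l}ᵒᵈ => ξ s.ofDual) Filter.atTop l := by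
      intro s hs
      have : IsDirectedOrder {s // s ∈ l}ᵒᵈ := ⟨fun s t =>
        ⟨⟨s.1 ∩ t.1, Filter.inter_mem s.2 t.2⟩, Set.inter_subset_left, Set.inter_subset_right⟩⟩
      have : Nonempty {s // s ∈ l}ᵒᵈ := ⟨⟨Set.univ, Filter.univ_mem⟩⟩
      exact Filter.mem_atTop_sets.mpr ⟨⟨s, hs⟩, fun t ht => ht (hξ t)⟩
    simpa only [apMap_apply] using! (hl g a).comp h1

/-- The approximation property yields a filter. -/
theorem HasAP.exists_filter {B : FellBundle G} (h : B.HasAP) :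
    ∃ (l : Filter (G →₀ B.fiber 1)) (_ : l.NeBot) (M : ℝ),
      (∀ᶠ ξ in l, ‖ξ.sum fun _ b => star b * b‖ ≤ M) ∧
      ∀ g (a : B.fiber g), Filter.Tendsto (fun ξ => B.apMap ξ g a) l (nhds a) := by
  obtain ⟨I, _, _, _, ξ, ⟨M, hM⟩, hξ⟩ := h
  refine ⟨Filter.map ξ Filter.atTop, inferInstance, M,
    Filter.eventually_map.mpr (Filter.Eventually.of_forall hM), ?_⟩
  intro g a
  rw [Filter.tendsto_map'_iff]
  simpa only [apMap_apply] using! hξ g a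

/-! ### The approximation property implies amenability -/

section ConstMap

variable {P : Type u} [NonUnitalCStarAlgebra P]

open Classical in
/-- The linear map `a δ_g ↦ Φ(a δ_g) δ_g` into the trivial bundle. -/
def constMapAux (Φ : B.Sec →ₗ[ℂ] P) : B.Sec →ₗ[ℂ] (constBundle G P).Sec :=
  DirectSum.toModule ℂ G _ fun g => constSingle g ∘ₗ Φ ∘ₗ B.single g

theorem constMapAux_single (Φ : B.Sec →ₗ[ℂ] P) (g : G) (a : B.fiber g) :
    B.constMapAux Φ (B.single g a) = constSingle g (Φ (B.single g a)) := by
  classical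
  exact DirectSum.toModule_lof ℂ (φ := fun g => constSingle g ∘ₗ Φ ∘ₗ B.single g) g a

variable (Φ : B.Sec →⋆ₙₐ[ℂ] P)

/-- The coaction `a δ_g ↦ Φ(a δ_g) δ_g` into the trivial bundle. -/
def constMap : B.Sec →⋆ₙₐ[ℂ] (constBundle G P).Sec where
  toFun := B.constMapAux (Φ : B.Sec →ₗ[ℂ] P)
  map_smul' := map_smul _
  map_zero' := map_zero _
  map_add' := map_add _
  map_mul' x y := by
    refine B.sec_induction x (by simp) (fun g a => ?_) fun x x' h h' => by
      simp only [add_mul, map_add, h, h']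
    refine B.sec_induction y (by simp) (fun h b => ?_) fun y y' h h' => by
      simp only [mul_add, map_add, h, h']
    rw [B.single_mul_single rfl, constMapAux_single, constMapAux_single, constMapAux_single,
      constSingle_mul, ← B.single_mul_single rfl]
    exact congrArg _ (map_mul Φ _ _)
  map_star' x := by
    refine B.sec_induction x (by simp) (fun g a => ?_) fun x x' h h' => by
      simp only [star_add, map_add, h, h']
    rw [B.star_single rfl, constMapAux_single, constMapAux_single, constSingle_star,
      ← B.star_single rfl]
    exact congrArg _ (map_star Φ _)

theorem constMap_single (g : G) (a : B.fiber g) :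
    B.constMap Φ (B.single g a) = constSingle g (Φ (B.single g a)) :=
  B.constMapAux_single (Φ : B.Sec →ₗ[ℂ] P) g a

theorem constEval_constMap (x : B.Sec) :
    constEval (B.constMap Φ x) = Φ (B.single 1 (B.eval 1 x)) := by
  refine B.sec_induction x (by simp) (fun g a => ?_) fun x x' h h' => by
    simp only [map_add, h, h']
  rw [constMap_single]
  by_cases hg : g = 1
  · subst hg
    rw [constEval_single_one, B.eval_single_same]
  · rw [constEval_single_ne hg, B.eval_single_ne hg, map_zero, map_zero]

/-- The finitely supported function `Φ ∘ ξ`. -/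
def mapFinsupp (ξ : G →₀ B.fiber 1) : G →₀ P :=
  ξ.mapRange (fun b => Φ (B.single 1 b)) (by simp)

/-- The same vector `ζ = Φ ∘ ξ` serves for all `g`, so the fibrewise maps `apMap ξ g` fit together
to one compression `⟪ζ, · ζ⟫` of the coaction. This is what makes norm estimates on all of `C_c(B)`
possible. -/
theorem map_single_apMap (ξ : G →₀ B.fiber 1) (g : G) (a : B.fiber g) :
    Φ (B.single g (B.apMap ξ g a)) = constEval (star (constSec (B.mapFinsupp Φ ξ)) *
      (B.constMap Φ (B.single g a) * constSec (B.mapFinsupp Φ ξ))) := by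
  rw [constMap_single, constEval_star_constSec_mul, single_apMap, map_sum, mapFinsupp,
    Finsupp.sum_mapRange_index (by simp)]
  refine Finset.sum_congr rfl fun h _ => ?_
  rw [map_mul, map_mul, map_star]
  rfl

theorem moduleNorm_constSec_mapFinsupp (ξ : G →₀ B.fiber 1) :
    (constBundle G P).moduleNorm (constSec (B.mapFinsupp Φ ξ)) *
      (constBundle G P).moduleNorm (constSec (B.mapFinsupp Φ ξ)) =
      ‖Φ (B.single 1 (ξ.sum fun _ b => star b * b))‖ := by
  rw [moduleNorm_const_mul_self, constEval_star_constSec_self, single_sum_star_mul_self, map_sum,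
    mapFinsupp, Finsupp.sum_mapRange_index (by simp)]
  congr 1
  refine Finset.sum_congr rfl fun h _ => ?_
  rw [map_mul, map_star]

end ConstMap

/-- The maps `apMap ξ g` are uniformly bounded. -/
theorem norm_apMap_le (ξ : G →₀ B.fiber 1) (g : G) (a : B.fiber g) :
    ‖B.apMap ξ g a‖ ≤ ‖ξ.sum fun _ b => star b * b‖ * ‖a‖ := by
  have h := B.map_single_apMap B.toFullHom ξ g a
  have h2 := B.moduleNorm_constSec_mapFinsupp B.toFullHom ξ
  rw [toFullHom_single, norm_toFull] at h2
  rw [← B.norm_toFull g, ← toFullHom_single, h, ← h2, constMap_single]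
  -- Cauchy-Schwarz for `⟪ζ, (a δ_g) ζ⟫`, where `‖ζ‖² = ‖∑ ξ* ξ‖`; convolution by `a δ_g` costs at
  -- most `‖a‖`.
  refine (norm_constEval_le _ _).trans ?_
  have h3 := moduleNorm_constSingle_mul_le g (B.toFull g a) (constSec (B.mapFinsupp B.toFullHom ξ))
  rw [norm_toFull] at h3
  refine (mul_le_mul_of_nonneg_left h3 (moduleNorm_nonneg _ _)).trans_eq ?_
  ring

/-- For `Φ` the canonical map into `C*(B)`, the element `Φ f` is the limit of the compressions `⟪ζ,
f ζ⟫`, each of norm at most `‖ζ‖²` times the reduced norm of `f`. This gives a comparison with the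
constant `M`, which `CStarSeminorm.le_of_le_mul` removes. -/
theorem HasAP.fullNorm_eq_redNorm {B : FellBundle G} (hB : B.HasAP) (f : B.Sec) :
    B.fullNorm f = B.redNorm f := by
  refine le_antisymm ?_ (B.redNorm_le_fullNorm f)
  obtain ⟨l, _, M, hM, hl⟩ := hB.exists_filter
  refine CStarSeminorm.le_of_le_mul (C := M) (fun f => ?_) f
  have hbound : ∀ ξ : G →₀ B.fiber 1, ‖constEval (star (constSec (B.mapFinsupp B.toFullHom ξ)) *
      (B.constMap B.toFullHom f * constSec (B.mapFinsupp B.toFullHom ξ)))‖ ≤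
      ‖ξ.sum fun _ b => star b * b‖ * B.redNorm f := by
    intro ξ
    refine (norm_constEval_le _ _).trans ?_
    -- The absorption step: on the vector `ζ` the coaction of `f` is bounded by the reduced norm. It
    -- is enough to bound it, with any constant, on each of the finitely many `ζ(h) δ_h`.
    have h1 := (constBundle G B.FullAlg).moduleNorm_map_mul_le (B.constMap B.toFullHom) B.redNorm
      (B.mapFinsupp B.toFullHom ξ).support
      (fun h => constSingle h (B.mapFinsupp B.toFullHom ξ h)) (fun h _ => ?_) f
    · have h2 := B.moduleNorm_constSec_mapFinsupp B.toFullHom ξ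
      rw [toFullHom_single, norm_toFull] at h2
      rw [← h2]
      refine (mul_le_mul_of_nonneg_left h1 (moduleNorm_nonneg _ _)).trans_eq ?_
      rw [constSec]
      ring
    · refine ⟨‖ξ h‖, fun f => ?_⟩
      rw [mapFinsupp, Finsupp.mapRange_apply]
      refine abs_le_of_sq_le_sq' ?_ (mul_nonneg (norm_nonneg _) (B.redNorm.nonneg f)) |>.2
      rw [moduleNorm_mul_constSingle_sq, ← map_star (B.constMap _), ← map_mul (B.constMap _),
        constEval_constMap,
        ← map_star, ← map_mul, ← map_mul, ← single_one_star, ← single_one_mul, ← single_one_mul,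
        toFullHom_single, norm_toFull]
      -- The vector `f · ζ(h) δ_h` has the same norm as the convolution `f * ξ(h) δ_1` in `ℓ²(B)`,
      -- where the reduced norm applies by definition.
      have h3 : star (ξ h) * B.eval 1 (star f * f) * ξ h =
          B.innerSec (f * B.single 1 (ξ h)) (f * B.single 1 (ξ h)) := by
        rw [innerSec, star_mul, ← B.eval_unit_mul, ← B.eval_mul_unit, single_one_star]
        simp only [mul_assoc]
      rw [h3, ← moduleNorm_mul_self, ← pow_two]
      refine pow_le_pow_left₀ (moduleNorm_nonneg _ _) ?_ 2
      have h4 := B.moduleNorm_mul_le f (B.single 1 (ξ h))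
      rw [moduleNorm_single] at h4
      rw [mul_comm]
      exact h4
  have hlim : Filter.Tendsto (fun ξ => constEval (star (constSec (B.mapFinsupp B.toFullHom ξ)) *
      (B.constMap B.toFullHom f * constSec (B.mapFinsupp B.toFullHom ξ)))) l
      (nhds (B.toFullHom f)) := by
    refine B.sec_induction f ?_ (fun g a => ?_) fun x y hx hy => ?_
    · simp
    · simp only [← map_single_apMap]
      -- Fibres embed isometrically in `C*(B)`, so convergence in the fibre norm suffices.
      have hc : Continuous fun a => B.toFullHom (B.single g a) :=
        AddMonoidHomClass.isometry_of_norm (B.toFull g) (B.norm_toFull g) |>.continuous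
      exact (hc.tendsto a).comp (hl g a)
    · simp only [map_add, add_mul, mul_add]
      exact hx.add hy
  rw [← norm_toFullHom]
  refine le_of_tendsto hlim.norm ?_
  filter_upwards [hM] with ξ hξ
  exact (hbound ξ).trans (mul_le_mul_of_nonneg_right hξ (B.redNorm.nonneg f))

/-- If a Fell bundle has the approximation property, its left regular representation is an
isomorphism. -/
theorem HasAP.bijective_regularRep {B : FellBundle G} (hB : B.HasAP) :
    Function.Bijective B.regularRep := by
  have hiso : Isometry B.regularRep := by
    refine AddMonoidHomClass.isometry_of_norm B.regularRep fun x => ?_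
    have hc : Continuous B.regularRep :=
      (LinearMap.extendOfNorm B.redNorm.toAlg B.fullNorm.toAlg).continuous
    refine B.fullNorm.alg_induction x (isClosed_eq hc.norm continuous_norm) fun f => ?_
    rw [regularRep, CStarSeminorm.mapLE_toAlg, CStarSeminorm.norm_toAlg, CStarSeminorm.norm_toAlg,
      hB.fullNorm_eq_redNorm]
  refine ⟨hiso.injective, ?_⟩
  rw [← Set.range_eq_univ, ← hiso.isClosedEmbedding.isClosed_range.closure_eq]
  refine (B.redNorm.denseRange_toAlg.mono ?_).closure_eq
  rintro _ ⟨f, rfl⟩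
  exact ⟨B.fullNorm.toAlg f, CStarSeminorm.mapLE_toAlg _ _ _ f⟩

end FellBundle

/-! ### Approximate frames of `ℓ²(B)` -/

section Order

attribute [local instance] CStarAlgebra.spectralOrder CStarAlgebra.spectralOrderedRing

theorem cfcₙ_defect {A : Type*} [NonUnitalCStarAlgebra A] {d : A} (hd : IsSelfAdjoint d) {r : ℝ → ℝ}
    (hr : Continuous r) (hr0 : r 0 = 0) :
    d - cfcₙ r d * d - d * cfcₙ r d + cfcₙ r d * d * cfcₙ r d =
      cfcₙ (fun t => t - r t * t - t * r t + r t * t * r t) d := by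
  have hr' : ContinuousOn r (quasispectrum ℝ d) := hr.continuousOn
  have hid : ContinuousOn (fun t : ℝ => t) (quasispectrum ℝ d) := continuousOn_id
  have h1 : ContinuousOn (fun t : ℝ => r t * t) (quasispectrum ℝ d) := hr'.mul hid
  have h2 : ContinuousOn (fun t : ℝ => t * r t) (quasispectrum ℝ d) := hid.mul hr'
  have h3 : ContinuousOn (fun t : ℝ => r t * t * r t) (quasispectrum ℝ d) := h1.mul hr'
  have h4 : ContinuousOn (fun t : ℝ => t - r t * t) (quasispectrum ℝ d) := hid.sub h1
  have h5 : ContinuousOn (fun t : ℝ => t - r t * t - t * r t) (quasispectrum ℝ d) := h4.sub h2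
  rw [cfcₙ_add (fun t => t - r t * t - t * r t) (fun t => r t * t * r t) d h5 (by simp) h3
      (by simp),
    cfcₙ_sub (fun t => t - r t * t) (fun t => t * r t) d h4 (by simp) h2 (by simp),
    cfcₙ_sub (fun t => t) (fun t => r t * t) d hid rfl h1 (by simp),
    cfcₙ_mul (fun t => r t * t) r d h1 (by simp) hr' hr0,
    cfcₙ_mul r (fun t => t) d hr' hr0 hid rfl, cfcₙ_mul (fun t => t) r d hid rfl hr' hr0,
    cfcₙ_id' ℝ d hd]

/-- For positive `d` there is a self-adjoint `s` such that `s d s` is almost a unit for `d`. -/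
theorem exists_approx_unit_of_nonneg {A : Type*} [NonUnitalCStarAlgebra A] {d : A} (hd : 0 ≤ d)
    {δ : ℝ} (hδ : 0 < δ) : ∃ s : A, star s = s ∧
      ‖d - s * d * s * d - d * (s * d * s) + s * d * s * d * (s * d * s)‖ ≤ δ := by
  have hpos : ∀ t : ℝ, 0 < t ^ 2 + δ ^ 2 := fun t => by positivity
  -- With `s = f(d)` and `f(t)² = t / (t² + δ²)` one gets `s d s = r(d)` for `r(t) = t² / (t² +
  -- δ²)`. The expression to be estimated is `(1 - r(d)) d (1 - r(d))`, and `t (1 - r(t))² ≤ δ` for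
  -- `t ≥ 0`.
  obtain ⟨f, hf, hf0, hft⟩ : ∃ f : ℝ → ℝ, Continuous f ∧ f 0 = 0 ∧
      ∀ t, 0 ≤ t → f t * f t = t / (t ^ 2 + δ ^ 2) :=
    ⟨fun t => √(t / (t ^ 2 + δ ^ 2)),
      Real.continuous_sqrt.comp (continuous_id.div (by fun_prop) fun t => (hpos t).ne'),
      by simp, fun t ht => Real.mul_self_sqrt (div_nonneg ht (hpos t).le)⟩
  obtain ⟨r, hr, hr0, hrt⟩ : ∃ r : ℝ → ℝ, Continuous r ∧ r 0 = 0 ∧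
      ∀ t, r t = t ^ 2 / (t ^ 2 + δ ^ 2) :=
    ⟨fun t => t ^ 2 / (t ^ 2 + δ ^ 2),
      (by fun_prop : Continuous fun t : ℝ => t ^ 2).div (by fun_prop) fun t => (hpos t).ne',
      by simp, fun t => rfl⟩
  have hdsa : IsSelfAdjoint d := .of_nonneg hd
  have hspec : ∀ t ∈ quasispectrum ℝ d, 0 ≤ t := fun t ht => quasispectrum_nonneg_of_nonneg d hd t ht
  have hf' : ContinuousOn f (quasispectrum ℝ d) := hf.continuousOn
  have hid : ContinuousOn (fun t : ℝ => t) (quasispectrum ℝ d) := continuousOn_id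
  have he : cfcₙ f d * d * cfcₙ f d = cfcₙ r d := by
    have h1 : cfcₙ r d = cfcₙ (fun t => f t * t * f t) d := cfcₙ_congr fun t ht => by
      rw [mul_right_comm, hft t (hspec t ht), hrt]
      ring
    rw [h1, cfcₙ_mul (fun t => f t * t) f d (hf'.mul hid) (by simp) hf' hf0,
      cfcₙ_mul f (fun t => t) d hf' hf0 hid rfl, cfcₙ_id' ℝ d hdsa]
  refine ⟨cfcₙ f d, (cfcₙ_predicate f d).star_eq, ?_⟩
  rw [he, cfcₙ_defect hdsa hr hr0]
  refine norm_cfcₙ_le fun t ht => ?_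
  have ht0 := hspec t ht
  have h3 : t - r t * t - t * r t + r t * t * r t = t * (δ ^ 2 / (t ^ 2 + δ ^ 2)) ^ 2 := by
    have := (hpos t).ne'
    rw [hrt]
    field_simp
    ring
  rw [h3, Real.norm_of_nonneg (by positivity)]
  have h4 : δ ^ 2 / (t ^ 2 + δ ^ 2) ≤ 1 := by
    rw [div_le_one (hpos t)]; nlinarith
  have h5 : 0 ≤ δ ^ 2 / (t ^ 2 + δ ^ 2) := by positivity
  have h6 : t * (δ ^ 2 / (t ^ 2 + δ ^ 2)) ≤ δ := by
    rw [mul_div_assoc', div_le_iff₀ (hpos t)]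
    nlinarith [sq_nonneg (t - δ), mul_pos hδ hδ, mul_nonneg ht0 hδ.le]
  calc _ = (t * (δ ^ 2 / (t ^ 2 + δ ^ 2))) * (δ ^ 2 / (t ^ 2 + δ ^ 2)) := by ring
    _ ≤ (t * (δ ^ 2 / (t ^ 2 + δ ^ 2))) * 1 := by gcongr
    _ ≤ δ := by rw [mul_one]; exact h6

theorem mul_star_self_le_sum {C ι : Type*} [NonUnitalCStarAlgebra C] {s : Finset ι} (f : ι → C)
    {i : ι} (hi : i ∈ s) : f i * star (f i) ≤ ∑ i ∈ s, f i * star (f i) :=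
  Finset.single_le_sum (f := fun i => f i * star (f i)) (fun _ _ => mul_star_self_nonneg _) hi

/-- Conjugating `y y* ≤ d` by `1 - e` gives `(1 - e) y y* (1 - e) ≤ (1 - e) d (1 - e)`. The products
are expanded because no unit is available. -/
theorem norm_sub_mul_sq_le {C : Type*} [NonUnitalCStarAlgebra C] {y e d : C} (he : star e = e)
    (h : y * star y ≤ d) : ‖y - e * y‖ ^ 2 ≤ ‖d - e * d - d * e + e * d * e‖ := by
  have key : ∀ q : C, 0 ≤ q → 0 ≤ q - e * q - q * e + e * q * e := by
    intro q hq
    obtain ⟨w, rfl⟩ := CStarAlgebra.nonneg_iff_eq_star_mul_self.mp hq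
    have : star w * w - e * (star w * w) - star w * w * e + e * (star w * w) * e =
        star (w - w * e) * (w - w * e) := by
      rw [star_sub, star_mul, he]
      noncomm_ring
    rw [this]
    exact star_mul_self_nonneg _
  rw [pow_two, ← CStarRing.norm_self_mul_star]
  refine CStarAlgebra.norm_le_norm_of_nonneg_of_le (mul_star_self_nonneg _) ?_
  rw [← sub_nonneg]
  convert key (d - y * star y) (sub_nonneg.mpr h) using 1
  rw [star_sub, star_mul, he]
  noncomm_ring

namespace FellBundle

variable {G : Type u} [Group G] (B : FellBundle G)

theorem toFullHom_single_innerSec_same {g : G} (a b : B.fiber g) :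
    B.toFull 1 (B.innerSec (B.single g a) (B.single g b)) = star (B.toFull g a) * B.toFull g b := by
  rw [innerSec_single_same]
  simp only [← toFullHom_single]
  rw [← star_single_mul_single_self, map_mul, map_star]

open Classical in
/-- The element `∑ c c*`, for `c` in the fibre at `g` and in the finite set `F`. -/
def frameSum (F : Finset (Σ g, B.fiber g)) (g : G) : B.fiber 1 :=
  ∑ i ∈ F with i.1 = g, B.mulMap (mul_inv_cancel i.1) i.2 (B.starMap rfl i.2)

theorem toFull_frameSum (F : Finset (Σ g, B.fiber g)) (g : G) [DecidablePred fun i : (Σ g, B.fiber g) => i.1 = g] : B.toFull 1 (B.frameSum F g) =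
    ∑ i ∈ F with i.1 = g, B.toFull i.1 i.2 * star (B.toFull i.1 i.2) := by
  rw [frameSum, map_sum]
  refine Finset.sum_congr (by congr) fun i _ => ?_
  simp only [← toFullHom_single]
  rw [← map_star, ← map_mul, B.star_single rfl, B.single_mul_single (mul_inv_cancel i.1)]

theorem frameSum_nonneg (F : Finset (Σ g, B.fiber g)) (g : G) : 0 ≤ B.frameSum F g := by
  refine Finset.sum_nonneg fun i _ => ?_
  have h := B.innerSec_single_nonneg (B.starMap rfl i.2 : B.fiber i.1⁻¹)
  rw [innerSec, B.star_single (inv_inv i.1), B.starMap_starMap,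
    B.single_mul_single (mul_inv_cancel i.1), B.eval_single_same] at h
  exact h

/-- The multiplier that turns a finite set into an approximate frame. -/
def frameMult (F : Finset (Σ g, B.fiber g)) (n : ℕ) (g : G) : B.fiber 1 :=
  (exists_approx_unit_of_nonneg (B.frameSum_nonneg F g) (δ := 1 / ((n : ℝ) + 1))
    (by positivity)).choose

theorem frameMult_spec (F : Finset (Σ g, B.fiber g)) (n : ℕ) (g : G) :
    star (B.frameMult F n g) = B.frameMult F n g ∧
      ‖B.frameSum F g - B.frameMult F n g * B.frameSum F g * B.frameMult F n g * B.frameSum F g -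
        B.frameSum F g * (B.frameMult F n g * B.frameSum F g * B.frameMult F n g) +
        B.frameMult F n g * B.frameSum F g * B.frameMult F n g * B.frameSum F g *
          (B.frameMult F n g * B.frameSum F g * B.frameMult F n g)‖ ≤ 1 / ((n : ℝ) + 1) :=
  (exists_approx_unit_of_nonneg (B.frameSum_nonneg F g) (δ := 1 / ((n : ℝ) + 1))
    (by positivity)).choose_spec

/-- The elements of an approximate frame. -/
def frameVec (F : Finset (Σ g, B.fiber g)) (n : ℕ) (i : Σ g, B.fiber g) : B.Sec :=
  B.single i.1 (B.mulMap (one_mul i.1) (B.frameMult F n i.1) i.2)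

theorem toFull_innerSec_frameVec (F : Finset (Σ g, B.fiber g)) (n : ℕ) {g : G} (c a : B.fiber g) :
    B.toFull 1 (B.innerSec (B.frameVec F n ⟨g, c⟩) (B.single g a)) =
      star (B.toFull g c) * B.toFull 1 (B.frameMult F n g) * B.toFull g a := by
  have h : star (B.toFull 1 (B.frameMult F n g)) = B.toFull 1 (B.frameMult F n g) := by
    nth_rewrite 2 [← (B.frameMult_spec F n g).1]
    exact (map_star B.toFullOneHom _).symm
  rw [frameVec, toFullHom_single_innerSec_same]
  simp only [← toFullHom_single]
  rw [← single_unit_mul, map_mul, toFullHom_single, toFullHom_single, toFullHom_single, star_mul, h]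

theorem innerSec_single_ne {g h : G} (hgh : g ≠ h) (a : B.fiber g) (b : B.fiber h) :
    B.innerSec (B.single g a) (B.single h b) = 0 := B.eval_single_star_mul_single_ne hgh a b

/-- The sum equals `a* (s d s) b` with `d = ∑ c c*` over the members `c` of `F` in the fibre at `g`.
As `b` is one of them, `b b* ≤ d`, and `s d s` is almost a unit for `d`, hence almost a left unit
for `b`. -/
theorem frame_estimate (F : Finset (Σ g, B.fiber g)) (n : ℕ) {g : G} (a b : B.fiber g)
    (hb : ⟨g, b⟩ ∈ F) :
    ‖(∑ i ∈ F, star (B.innerSec (B.frameVec F n i) (B.single g a)) *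
        B.innerSec (B.frameVec F n i) (B.single g b)) -
      B.innerSec (B.single g a) (B.single g b)‖ ≤ ‖a‖ * √(1 / ((n : ℝ) + 1)) := by
  classical
  obtain ⟨hs, hn⟩ := B.frameMult_spec F n g
  have h1 : ∑ i ∈ F, star (B.innerSec (B.frameVec F n i) (B.single g a)) *
        B.innerSec (B.frameVec F n i) (B.single g b) =
      ∑ i ∈ F with i.1 = g, star (B.innerSec (B.frameVec F n i) (B.single g a)) *
        B.innerSec (B.frameVec F n i) (B.single g b) := by
    refine (Finset.sum_filter_of_ne fun i _ h => ?_).symm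
    by_contra hi
    rw [frameVec, innerSec_single_ne B hi _ b, mul_zero] at h
    exact h rfl
  set s := B.frameMult F n g with hsdef
  set d := B.frameSum F g with hddef
  have hS : star (B.toFull 1 s) = B.toFull 1 s := by
    nth_rewrite 2 [← hs]
    exact (map_star B.toFullOneHom _).symm
  set S := B.toFull 1 s with hSdef
  have h2 : B.toFull 1 (∑ i ∈ F with i.1 = g,
      star (B.innerSec (B.frameVec F n i) (B.single g a)) *
        B.innerSec (B.frameVec F n i) (B.single g b)) =
      star (B.toFull g a) * (S * B.toFull 1 d * S * B.toFull g b) := by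
    rw [hddef, B.toFull_frameSum F g, map_sum, Finset.mul_sum, Finset.sum_mul, Finset.sum_mul,
      Finset.mul_sum]
    refine Finset.sum_congr rfl fun i hi => ?_
    obtain ⟨h, c⟩ := i
    obtain rfl : h = g := (Finset.mem_filter.mp hi).2
    refine (map_mul B.toFullOneHom _ _).trans ?_
    rw [map_star B.toFullOneHom, toFullOneHom_apply, toFullOneHom_apply,
      B.toFull_innerSec_frameVec, B.toFull_innerSec_frameVec, star_mul, star_mul, star_star]
    rw [← hsdef, ← hSdef, hS]
    simp only [mul_assoc]
  have hD : B.toFull g b * star (B.toFull g b) ≤ B.toFull 1 d := by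
    rw [hddef, B.toFull_frameSum F g]
    exact mul_star_self_le_sum (fun i : (Σ g, B.fiber g) => B.toFull i.1 i.2) (i := ⟨g, b⟩)
      (Finset.mem_filter.mpr ⟨hb, rfl⟩)
  have hE : star (S * B.toFull 1 d * S) = S * B.toFull 1 d * S := by
    have : star (B.toFull 1 d) = B.toFull 1 d := by
      rw [hddef, B.toFull_frameSum F g, star_sum]
      simp only [star_mul, star_star]
    rw [star_mul, star_mul, hS, this, mul_assoc]
  have h3 := norm_sub_mul_sq_le hE hD
  have h4 : B.toFull 1 d - S * B.toFull 1 d * S * B.toFull 1 d -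
        B.toFull 1 d * (S * B.toFull 1 d * S) +
        S * B.toFull 1 d * S * B.toFull 1 d * (S * B.toFull 1 d * S) =
      B.toFullOneHom (d - s * d * s * d - d * (s * d * s) + s * d * s * d * (s * d * s)) := by
    simp only [map_add, map_sub, map_mul]
    rfl
  rw [h4, toFullOneHom_apply, norm_toFull] at h3
  rw [h1, ← B.norm_toFull, map_sub, h2, toFullHom_single_innerSec_same, ← mul_sub]
  refine (norm_mul_le _ _).trans ?_
  rw [norm_star, norm_toFull, norm_sub_rev]
  exact mul_le_mul_of_nonneg_left (Real.le_sqrt_of_sq_le (h3.trans hn)) (norm_nonneg a)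

/-- Approximate frames: the inner product of `ℓ²(B)` is a limit of finite sums
`∑ ⟪u, x⟫* ⟪u, y⟫`. -/
theorem tendsto_frame (x y : B.Sec) :
    Filter.Tendsto (fun j : Finset (Σ g, B.fiber g) × ℕ =>
        ∑ i ∈ j.1, star (B.innerSec (B.frameVec j.1 j.2 i) x) *
          B.innerSec (B.frameVec j.1 j.2 i) y)
      Filter.atTop (nhds (B.innerSec x y)) := by
  classical
  refine B.sec_induction x (by simp [innerSec]) (fun g a => ?_) fun x x' h h' => ?_
  · refine B.sec_induction y (by simp [innerSec]) (fun k b => ?_) fun y y' h h' => ?_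
    · by_cases hg : g = k
      · subst hg
        rw [tendsto_iff_norm_sub_tendsto_zero]
        have h0 : Filter.Tendsto (fun j : Finset (Σ g, B.fiber g) × ℕ =>
            ‖a‖ * √(1 / ((j.2 : ℝ) + 1))) Filter.atTop (nhds 0) := by
          have h1 := (Real.continuous_sqrt.tendsto _).comp
            (tendsto_one_div_add_atTop_nhds_zero_nat (𝕜 := ℝ))
          have h2 := (h1.const_mul ‖a‖).comp
            (Filter.tendsto_snd (f := (Filter.atTop : Filter (Finset (Σ g, B.fiber g))))
              (g := (Filter.atTop : Filter ℕ)))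
          rw [Filter.prod_atTop_atTop_eq, Real.sqrt_zero, mul_zero] at h2
          exact h2
        refine squeeze_zero' (Filter.Eventually.of_forall fun _ => norm_nonneg _) ?_ h0
        -- The finite set only has to contain `b`; the error is then governed by `n` alone.
        filter_upwards [Filter.eventually_ge_atTop (({⟨g, b⟩}, 0) : Finset (Σ g, B.fiber g) × ℕ)]
          with j hj
        exact B.frame_estimate j.1 j.2 a b (hj.1 (Finset.mem_singleton_self _))
      · rw [B.innerSec_single_ne hg]
        refine Filter.Tendsto.congr (fun j => ?_) tendsto_const_nhds
        refine (Finset.sum_eq_zero fun i _ => ?_).symm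
        rw [frameVec]
        by_cases hi : i.1 = k
        · rw [B.innerSec_single_ne (fun h => hg (h.symm.trans hi)), star_zero, zero_mul]
        · rw [B.innerSec_single_ne hi _ b, mul_zero]
    · have := h.add h'
      simp only [innerSec, mul_add, map_add] at this ⊢
      simpa only [← Finset.sum_add_distrib] using this
  · have := h.add h'
    simp only [innerSec, star_add, mul_add, add_mul, map_add] at this ⊢
    simpa only [← Finset.sum_add_distrib] using this

end FellBundle

end Order

/-! ### The module `ℓ²(B) ⊗ D` and the maximal norm -/

section Order

attribute [local instance] CStarAlgebra.spectralOrder CStarAlgebra.spectralOrderedRing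

/-- A *-algebra acting by adjointable operators on which a positive map is bounded acts with norm
at most `q`. -/
theorem posNorm_act_le {R S P : Type*} [NonUnitalRing S] [StarRing S] [Module ℂ S]
    [IsScalarTower ℂ S S] [SMulCommClass ℂ S S] [StarModule ℂ S] [NonUnitalCStarAlgebra P]
    {T : S →ₗ[ℂ] P} (hT : ∀ x, 0 ≤ T (star x * x)) [Mul R] [Star R] {q : R → ℝ}
    (hq : ∀ r, 0 ≤ q r) (hqs : ∀ r, q (star r * r) = q r * q r) (L : R → S →ₗ[ℂ] S)
    (hmul : ∀ r s z, L (r * s) z = L r (L s z)) (hss : ∀ r : R, star (star r) = r)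
    (hadj : ∀ r z w, star (L r z) * w = star z * L (star r) w) {z : S}
    (hb : ∃ C, ∀ r, posNorm T (L r z) ≤ C * q r) (r : R) :
    posNorm T (L r z) ≤ posNorm T z * q r := by
  obtain ⟨C, hC⟩ := hb
  refine le_mul_of_sq_le_mul (φ := fun r => star r * r) (posNorm_nonneg T z) hq hqs
    (K := fun r => posNorm T (L r z)) (fun r => ?_) hC r
  refine posNorm_sq_le hT ?_ ?_
  · rw [hadj, hmul]
  · rw [hmul, hadj, hss, hadj]

end Order

namespace FellBundle

variable {G : Type u} [Group G] (B : FellBundle G) (D : Type u) [NonUnitalCStarAlgebra D]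

/-- The conditional expectation `E ⊗ id` from `C_c(B) ⊗ D` onto `B_e ⊗ D`. -/
def condExp : B.Sec ⊗[ℂ] D →ₗ[ℂ] B.fiber 1 ⊗[ℂ] D := TensorProduct.map (B.eval 1) .id

variable {D}

theorem condExp_tmul (x : B.Sec) (d : D) : B.condExp D (x ⊗ₜ d) = B.eval 1 x ⊗ₜ d := rfl

/-- The inclusion of `B_e ⊗ D` into `C_c(B) ⊗ D`. -/
def inclOne (D : Type u) [NonUnitalCStarAlgebra D] : B.fiber 1 ⊗[ℂ] D →⋆ₙₐ[ℂ] B.Sec ⊗[ℂ] D :=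
  tensorMapHom B.singleOneHom (.id ℂ D)

theorem inclOne_tmul (a : B.fiber 1) (d : D) : B.inclOne D (a ⊗ₜ d) = B.single 1 a ⊗ₜ d := rfl

theorem condExp_inclOne (c : B.fiber 1 ⊗[ℂ] D) : B.condExp D (B.inclOne D c) = c := by
  induction c with
  | zero => simp
  | add x y hx hy => rw [map_add, map_add, hx, hy]
  | tmul a d => rw [inclOne_tmul, condExp_tmul, B.eval_single_same]

theorem condExp_inclOne_mul (c : B.fiber 1 ⊗[ℂ] D) (x : B.Sec ⊗[ℂ] D) :
    B.condExp D (B.inclOne D c * x) = c * B.condExp D x := by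
  induction c with
  | zero => simp
  | add c c' h h' => simp only [map_add, add_mul, h, h']
  | tmul a d =>
    induction x with
    | zero => simp
    | add x x' h h' => simp only [map_add, mul_add, h, h']
    | tmul x e =>
      rw [inclOne_tmul, Algebra.TensorProduct.tmul_mul_tmul, condExp_tmul, condExp_tmul,
        Algebra.TensorProduct.tmul_mul_tmul, B.eval_unit_mul]

theorem condExp_mul_inclOne (c : B.fiber 1 ⊗[ℂ] D) (x : B.Sec ⊗[ℂ] D) :
    B.condExp D (x * B.inclOne D c) = B.condExp D x * c := by
  induction c with
  | zero => simp
  | add c c' h h' => simp only [map_add, mul_add, h, h']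
  | tmul a d =>
    induction x with
    | zero => simp
    | add x x' h h' => simp only [map_add, add_mul, h, h']
    | tmul x e =>
      rw [inclOne_tmul, Algebra.TensorProduct.tmul_mul_tmul, condExp_tmul, condExp_tmul,
        Algebra.TensorProduct.tmul_mul_tmul, B.eval_mul_unit]

/-- The map `⟪u, ·⟫ ⊗ id`. -/
def innerMap (D : Type u) [NonUnitalCStarAlgebra D] (u : B.Sec) :
    B.Sec ⊗[ℂ] D →ₗ[ℂ] B.fiber 1 ⊗[ℂ] D :=
  TensorProduct.map (B.eval 1 ∘ₗ LinearMap.mulLeft ℂ (star u)) .id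

theorem innerMap_tmul (u x : B.Sec) (d : D) :
    B.innerMap D u (x ⊗ₜ d) = B.innerSec u x ⊗ₜ d := rfl

variable {P : Type u} [NonUnitalCStarAlgebra P] (Θ : B.fiber 1 ⊗[ℂ] D →⋆ₙₐ[ℂ] P)

/-- Both sides are sesquilinear in `(z, w)`, and on elementary tensors this is `tendsto_frame`,
multiplied by `d* e` in the second leg. For `z = w` the left-hand side is a sum of elements `c* c`,
whence the positivity of `Θ ∘ (E ⊗ id)` on `z* z`. -/
theorem tendsto_frame_tensor (hΘ : ∀ a d, ‖Θ (a ⊗ₜ d)‖ ≤ ‖a‖ * ‖d‖) (z w : B.Sec ⊗[ℂ] D) :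
    Filter.Tendsto (fun j : Finset (Σ g, B.fiber g) × ℕ =>
        ∑ i ∈ j.1, star (Θ (B.innerMap D (B.frameVec j.1 j.2 i) z)) *
          Θ (B.innerMap D (B.frameVec j.1 j.2 i) w))
      Filter.atTop (nhds (Θ (B.condExp D (star z * w)))) := by
  induction z with
  | zero => simpa using tendsto_const_nhds
  | add z z' h h' =>
    have := h.add h'
    simpa only [← Finset.sum_add_distrib, ← add_mul, ← star_add, ← map_add] using this
  | tmul x d =>
    induction w with
    | zero => simpa using tendsto_const_nhds
    | add z z' h h' =>
      have := h.add h'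
      simpa only [← Finset.sum_add_distrib, ← mul_add, ← map_add] using this
    | tmul y e =>
      let F : B.fiber 1 →ₗ[ℂ] P := (Θ : B.fiber 1 ⊗[ℂ] D →ₗ[ℂ] P) ∘ₗ
        (TensorProduct.mk ℂ (B.fiber 1) D).flip (star d * e)
      have hF : ∀ a, F a = Θ (a ⊗ₜ (star d * e)) := fun _ => rfl
      have hc : Continuous F := AddMonoidHomClass.continuous_of_bound F (‖star d * e‖) fun a => by
        rw [hF, mul_comm]; exact hΘ _ _
      rw [TensorProduct.star_tmul, Algebra.TensorProduct.tmul_mul_tmul, condExp_tmul]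
      refine ((hc.tendsto _).comp (B.tendsto_frame x y)).congr fun j => ?_
      rw [Function.comp_apply, map_sum]
      refine Finset.sum_congr rfl fun i _ => ?_
      rw [hF, innerMap_tmul, innerMap_tmul, ← map_star, ← map_mul, TensorProduct.star_tmul,
        Algebra.TensorProduct.tmul_mul_tmul]

/-- The map `Θ ∘ (E ⊗ id)`. -/
def condMap : B.Sec ⊗[ℂ] D →ₗ[ℂ] P := (Θ : B.fiber 1 ⊗[ℂ] D →ₗ[ℂ] P) ∘ₗ B.condExp D

theorem condMap_apply (x : B.Sec ⊗[ℂ] D) : B.condMap Θ x = Θ (B.condExp D x) := rfl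

section Order

attribute [local instance] CStarAlgebra.spectralOrder CStarAlgebra.spectralOrderedRing

theorem condMap_nonneg (hΘ : ∀ a d, ‖Θ (a ⊗ₜ d)‖ ≤ ‖a‖ * ‖d‖) (z : B.Sec ⊗[ℂ] D) :
    0 ≤ B.condMap Θ (star z * z) := by
  classical
  exact ge_of_tendsto' (B.tendsto_frame_tensor Θ hΘ z z) fun _ =>
    Finset.sum_nonneg fun _ _ => star_mul_self_nonneg _

theorem posNorm_condMap_tmul_le (hΘ : ∀ a d, ‖Θ (a ⊗ₜ d)‖ ≤ ‖a‖ * ‖d‖) (x : B.Sec) (d : D) :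
    posNorm (B.condMap Θ) (x ⊗ₜ d) ≤ B.moduleNorm x * ‖d‖ := by
  refine Real.sqrt_le_iff.mpr ⟨mul_nonneg (B.moduleNorm_nonneg x) (norm_nonneg d), ?_⟩
  rw [TensorProduct.star_tmul, Algebra.TensorProduct.tmul_mul_tmul, condMap_apply, condExp_tmul]
  refine (hΘ _ _).trans_eq ?_
  rw [CStarRing.norm_star_mul_self, mul_pow, pow_two, pow_two, moduleNorm_mul_self]
  rfl

/-- The operators `f ⊗ 1` are adjointable for the form `Θ((E ⊗ id)(z* w))`. Bounds on elementary
tensors, where `f` acts on `ℓ²(B)`, add up to a crude bound on any `z`, and `posNorm_act_le` makes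
it sharp. The two legs are treated separately because neither `f ⊗ 1` nor `1 ⊗ d` need lie in
`C_c(B) ⊗ D`. -/
theorem posNorm_condMap_left_le (hΘ : ∀ a d, ‖Θ (a ⊗ₜ d)‖ ≤ ‖a‖ * ‖d‖) (f : B.Sec)
    (z : B.Sec ⊗[ℂ] D) :
    posNorm (B.condMap Θ) (TensorProduct.map (LinearMap.mulLeft ℂ f) .id z) ≤
      posNorm (B.condMap Θ) z * B.fullNorm f := by
  have hT := B.condMap_nonneg Θ hΘ
  refine posNorm_act_le hT (q := B.fullNorm) (B.fullNorm.nonneg) B.fullNorm.star_mul_self'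
    (fun f => TensorProduct.map (LinearMap.mulLeft ℂ f) .id) (fun f g z => ?_) star_star
    (fun f z w => ?_) ?_ f
  · rw [← LinearMap.comp_apply, ← TensorProduct.map_comp, LinearMap.mulLeft_mul]
    rfl
  · induction z with
    | zero => simp
    | add z z' h h' => simp only [map_add, star_add, add_mul, h, h']
    | tmul x d =>
      induction w with
      | zero => simp
      | add z z' h h' => simp only [map_add, mul_add, h, h']
      | tmul y e => simp [mul_assoc]
  · induction z with
    | zero => exact ⟨0, fun f => by simp [posNorm]⟩
    | add z z' h h' =>
      obtain ⟨C, hC⟩ := h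
      obtain ⟨C', hC'⟩ := h'
      refine ⟨C + C', fun f => ?_⟩
      rw [map_add, add_mul]
      exact (posNorm_add_le hT _ _).trans (add_le_add (hC f) (hC' f))
    | tmul x d =>
      refine ⟨B.moduleNorm x * ‖d‖, fun f => ?_⟩
      refine (B.posNorm_condMap_tmul_le Θ hΘ (f * x) d).trans ?_
      calc _ ≤ (B.fullNorm f * B.moduleNorm x) * ‖d‖ := by
            gcongr
            exact (B.moduleNorm_mul_le f x).trans (mul_le_mul_of_nonneg_right
              (B.redNorm_le_fullNorm f) (B.moduleNorm_nonneg x))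
        _ = _ := by ring

theorem posNorm_condMap_right_le (hΘ : ∀ a d, ‖Θ (a ⊗ₜ d)‖ ≤ ‖a‖ * ‖d‖) (d : D)
    (z : B.Sec ⊗[ℂ] D) :
    posNorm (B.condMap Θ) (TensorProduct.map .id (LinearMap.mulLeft ℂ d) z) ≤
      posNorm (B.condMap Θ) z * ‖d‖ := by
  have hT := B.condMap_nonneg Θ hΘ
  refine posNorm_act_le hT (q := fun d => ‖d‖) norm_nonneg
    (fun d => CStarRing.norm_star_mul_self)
    (fun d => TensorProduct.map .id (LinearMap.mulLeft ℂ d)) (fun f g z => ?_) star_star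
    (fun f z w => ?_) ?_ d
  · rw [← LinearMap.comp_apply, ← TensorProduct.map_comp, LinearMap.mulLeft_mul]
    rfl
  · induction z with
    | zero => simp
    | add z z' h h' => simp only [map_add, star_add, add_mul, h, h']
    | tmul x d =>
      induction w with
      | zero => simp
      | add z z' h h' => simp only [map_add, mul_add, h, h']
      | tmul y e => simp [mul_assoc]
  · induction z with
    | zero => exact ⟨0, fun f => by simp [posNorm]⟩
    | add z z' h h' =>
      obtain ⟨C, hC⟩ := h
      obtain ⟨C', hC'⟩ := h'
      refine ⟨C + C', fun f => ?_⟩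
      rw [map_add, add_mul]
      exact (posNorm_add_le hT _ _).trans (add_le_add (hC f) (hC' f))
    | tmul x e =>
      refine ⟨B.moduleNorm x * ‖e‖, fun d => ?_⟩
      refine (B.posNorm_condMap_tmul_le Θ hΘ x (d * e)).trans ?_
      calc _ ≤ B.moduleNorm x * (‖d‖ * ‖e‖) :=
            mul_le_mul_of_nonneg_left (norm_mul_le _ _) (B.moduleNorm_nonneg x)
        _ = _ := by ring

theorem posNorm_condMap_tmul_mul_le (hΘ : ∀ a d, ‖Θ (a ⊗ₜ d)‖ ≤ ‖a‖ * ‖d‖) (f : B.Sec) (d : D)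
    (z : B.Sec ⊗[ℂ] D) :
    posNorm (B.condMap Θ) (f ⊗ₜ d * z) ≤ B.fullNorm f * ‖d‖ * posNorm (B.condMap Θ) z := by
  have h : f ⊗ₜ d * z = TensorProduct.map (LinearMap.mulLeft ℂ f) .id
      (TensorProduct.map .id (LinearMap.mulLeft ℂ d) z) := by
    induction z with
    | zero => simp
    | add z z' h h' => rw [mul_add, map_add, map_add, h, h']
    | tmul x e => simp
  rw [h]
  refine (B.posNorm_condMap_left_le Θ hΘ f _).trans ?_
  refine (mul_le_mul_of_nonneg_right (B.posNorm_condMap_right_le Θ hΘ d z)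
    (B.fullNorm.nonneg f)).trans_eq (by ring)

/-- The seminorm `‖Θ((E ⊗ id)(z* z))‖^{1/2}` on `C_c(B) ⊗ D`. -/
def condSeminorm (hΘ : ∀ a d, ‖Θ (a ⊗ₜ d)‖ ≤ ‖a‖ * ‖d‖) : Seminorm ℂ (B.Sec ⊗[ℂ] D) :=
  Seminorm.of (posNorm (B.condMap Θ)) (posNorm_add_le (B.condMap_nonneg Θ hΘ))
    (posNorm_smul (B.condMap Θ))

theorem condSeminorm_bounded (hΘ : ∀ a d, ‖Θ (a ⊗ₜ d)‖ ≤ ‖a‖ * ‖d‖) (f : B.Sec ⊗[ℂ] D) :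
    ∃ M : ℝ, 0 ≤ M ∧ ∀ x, B.condSeminorm Θ hΘ (f * x) ≤ M * B.condSeminorm Θ hΘ x := by
  induction f with
  | zero => exact ⟨0, le_rfl, fun x => by rw [zero_mul, map_zero, zero_mul]⟩
  | add f g h h' =>
    obtain ⟨C, hC0, hC⟩ := h
    obtain ⟨C', hC0', hC'⟩ := h'
    refine ⟨C + C', add_nonneg hC0 hC0', fun x => ?_⟩
    rw [add_mul, add_mul]
    exact (map_add_le_add _ _ _).trans (add_le_add (hC x) (hC' x))
  | tmul f d =>
    exact ⟨B.fullNorm f * ‖d‖, mul_nonneg (B.fullNorm.nonneg f) (norm_nonneg d),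
      B.posNorm_condMap_tmul_mul_le Θ hΘ f d⟩

/-- The operator norm of `C_c(B) ⊗ D` acting by left multiplication, with respect to
`condSeminorm`. -/
def condCStarSeminorm (hΘ : ∀ a d, ‖Θ (a ⊗ₜ d)‖ ≤ ‖a‖ * ‖d‖) : CStarSeminorm (B.Sec ⊗[ℂ] D) :=
  CStarSeminorm.leftMul (B.condSeminorm Θ hΘ)
    (fun f x => posNorm_sq_le (B.condMap_nonneg Θ hΘ) (by simp only [star_mul, mul_assoc])
      (by simp only [star_mul, star_star, mul_assoc]))
    (B.condSeminorm_bounded Θ hΘ)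

theorem condCStarSeminorm_tmul_le (hΘ : ∀ a d, ‖Θ (a ⊗ₜ d)‖ ≤ ‖a‖ * ‖d‖) (f : B.Sec) (d : D) :
    B.condCStarSeminorm Θ hΘ (f ⊗ₜ d) ≤ B.fullNorm f * ‖d‖ :=
  leftMulNorm_le (mul_nonneg (B.fullNorm.nonneg f) (norm_nonneg d))
    (B.posNorm_condMap_tmul_mul_le Θ hΘ f d)

theorem posNorm_condMap_mul_le (hΘ : ∀ a d, ‖Θ (a ⊗ₜ d)‖ ≤ ‖a‖ * ‖d‖) (f z : B.Sec ⊗[ℂ] D) :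
    posNorm (B.condMap Θ) (f * z) ≤ B.condCStarSeminorm Θ hΘ f * posNorm (B.condMap Θ) z :=
  le_leftMulNorm (B.condSeminorm_bounded Θ hΘ f) z

end Order

/-- A C*-seminorm on `C_c(B) ⊗ D` that is bounded on elementary tensors is dominated by the maximal
norm of `C*(B) ⊗ D`. -/
theorem le_max_of_tmul_le (q : CStarSeminorm (B.Sec ⊗[ℂ] D))
    (hq : ∀ f d, q (f ⊗ₜ d) ≤ B.fullNorm f * ‖d‖) (x : B.Sec ⊗[ℂ] D) :
    q x ≤ tensorNorm B.FullAlg D .max (tensorMapHom B.toFullHom (.id ℂ D) x) := by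
  -- The seminorm is given only on `C_c(B) ⊗ D`. The flip puts `C_c(B)` in the second leg, where the
  -- canonical map into the completion for `q` extends to `C*(B)`; the norm pulled back is then a
  -- subcross C*-seminorm.
  obtain ⟨Φ, hΦ, hΦx⟩ := exists_extend_second_leg (A := D) B.toFullHom B.denseRange_toFullHom
    (q.toAlgHom.comp (tensorCommHom D B.Sec)) (fun d y => by
      rw [NonUnitalStarAlgHom.comp_apply, q.norm_toAlgHom, tensorCommHom_tmul, norm_toFullHom,
        mul_comm]
      exact hq y d)
  have h1 := le_maxTensorNorm (p := (CStarSeminorm.ofNorm q.Alg).comap Φ) hΦ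
    (tensorMapHom (.id ℂ D) B.toFullHom (tensorCommHom B.Sec D x))
  rw [CStarSeminorm.comap_apply, hΦx, CStarSeminorm.ofNorm_apply, NonUnitalStarAlgHom.comp_apply,
    q.norm_toAlgHom, tensorCommHom_comm] at h1
  refine h1.trans_eq ?_
  rw [← tensorNorm_comm .max]
  congr 1
  clear h1
  induction x with
  | zero => simp
  | add x y hx hy => simp only [map_add, hx, hy]
  | tmul f d => rfl

/-- Take for `Θ` the canonical map into `B_e ⊗_max D`. The operator norm of left multiplication is a
C*-seminorm on `C_c(B) ⊗ D` bounded on elementary tensors, hence lies below the maximal norm. The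
statement is `‖x z‖² ≤ ‖x‖² ‖z‖²` written through inner products. -/
theorem maxTensorNorm_condExp_mul_le (x z : B.Sec ⊗[ℂ] D) :
    tensorNorm (B.fiber 1) D .max (B.condExp D (star (x * z) * (x * z))) ≤
      tensorNorm B.FullAlg D .max (tensorMapHom B.toFullHom (.id ℂ D) x) ^ 2 *
        tensorNorm (B.fiber 1) D .max (B.condExp D (star z * z)) := by
  have hΘ : ∀ a d, ‖(tensorNorm (B.fiber 1) D .max).toAlgHom (a ⊗ₜ d)‖ ≤ ‖a‖ * ‖d‖ := fun a d => by
    rw [CStarSeminorm.norm_toAlgHom]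
    exact tensorNorm_isSubcross .max a d
  have h1 := B.posNorm_condMap_mul_le _ hΘ x z
  have h2 := B.le_max_of_tmul_le _ (B.condCStarSeminorm_tmul_le _ hΘ) x
  have h3 := mul_self_le_mul_self (posNorm_nonneg _ _) (h1.trans (mul_le_mul_of_nonneg_right h2
    (posNorm_nonneg _ _)))
  rw [posNorm_mul_self, mul_mul_mul_comm, posNorm_mul_self, ← pow_two, condMap_apply,
    condMap_apply, CStarSeminorm.norm_toAlgHom, CStarSeminorm.norm_toAlgHom] at h3
  exact h3

end FellBundle

namespace FellBundle

variable {G : Type u} [Group G] (B : FellBundle G)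

/-! ### Induced representations -/

section Ind

variable {H : Type u} [NormedAddCommGroup H] [InnerProductSpace ℂ H] [CompleteSpace H]
  (π : B.fiber 1 →⋆ₙₐ[ℂ] (H →L[ℂ] H))

/-- The map `x ⊗ h ↦ π(⟪u, x⟫) h`. -/
def indMap : B.Sec →ₗ⋆[ℂ] B.Sec ⊗[ℂ] H →ₗ[ℂ] H where
  toFun u := TensorProduct.lift (LinearMap.mk₂ ℂ (fun x h => π (B.innerSec u x) h)
    (fun x x' h => by simp [innerSec, mul_add])
    (fun c x h => by simp [innerSec, mul_smul_comm])
    (fun x h h' => by simp) (fun c x h => by simp))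
  map_add' u u' := by
    ext x h
    simp [innerSec, add_mul]
  map_smul' c u := by
    ext x h
    simp [innerSec, smul_mul_assoc]

theorem indMap_tmul (u x : B.Sec) (h : H) : B.indMap π u (x ⊗ₜ h) = π (B.innerSec u x) h := rfl

/-- The form `⟪x ⊗ h, y ⊗ k⟫ = ⟪h, π(⟪x, y⟫) k⟫`. -/
def indForm : B.Sec ⊗[ℂ] H →ₗ⋆[ℂ] B.Sec ⊗[ℂ] H →ₗ[ℂ] ℂ :=
  TensorProduct.lift (LinearMap.mk₂'ₛₗ (starRingEnd ℂ) (starRingEnd ℂ)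
    (fun x h => (innerₛₗ ℂ h) ∘ₗ B.indMap π x)
    (fun x x' h => by ext; simp [inner_add_right]) (fun c x h => by ext; simp [inner_smul_right])
    (fun x h h' => by ext; simp) (fun c x h => by ext; simp))

theorem indForm_tmul (x y : B.Sec) (h k : H) :
    B.indForm π (x ⊗ₜ h) (y ⊗ₜ k) = inner ℂ h (π (B.innerSec x y) k) := rfl

/-- As with `tendsto_frame_tensor`, writing the form as a limit of sums of Hilbert space inner
products yields at once its symmetry and its positivity. -/
theorem tendsto_indForm (v w : B.Sec ⊗[ℂ] H) :
    Filter.Tendsto (fun j : Finset (Σ g, B.fiber g) × ℕ =>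
        ∑ i ∈ j.1, inner ℂ (B.indMap π (B.frameVec j.1 j.2 i) v)
          (B.indMap π (B.frameVec j.1 j.2 i) w))
      Filter.atTop (nhds (B.indForm π v w)) := by
  induction v with
  | zero => simpa using tendsto_const_nhds
  | add v v' h h' =>
    have := h.add h'
    simpa only [← Finset.sum_add_distrib, ← inner_add_left, ← map_add, ← LinearMap.add_apply]
      using this
  | tmul x h =>
    induction w with
    | zero => simpa using tendsto_const_nhds
    | add w w' h h' =>
      have := h.add h'
      simpa only [← Finset.sum_add_distrib, ← inner_add_right, ← map_add] using this
    | tmul y k =>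
      have hc : Continuous fun a => inner ℂ h (π a k) := by
        have : Continuous π := AddMonoidHomClass.continuous_of_bound π 1 fun a => by
          rw [one_mul]; exact NonUnitalStarAlgHom.norm_apply_le π a
        fun_prop
      rw [indForm_tmul]
      refine ((hc.tendsto _).comp (B.tendsto_frame x y)).congr fun j => ?_
      rw [Function.comp_apply, map_sum, sum_apply, inner_sum]
      refine Finset.sum_congr rfl fun i _ => ?_
      rw [indMap_tmul, indMap_tmul, map_mul, map_star, ContinuousLinearMap.star_eq_adjoint,
        mul_apply_eq_comp, ContinuousLinearMap.adjoint_inner_right]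

/-- The space `C_c(B) ⊗ H`, on which the representation induced by `π` acts. -/
@[nolint unusedArguments]
def IndSpace (_π : B.fiber 1 →⋆ₙₐ[ℂ] (H →L[ℂ] H)) : Type u := B.Sec ⊗[ℂ] H

/-- The pre-inner product on `C_c(B) ⊗ H`. -/
@[reducible]
def indCore : PreInnerProductSpace.Core ℂ (B.Sec ⊗[ℂ] H) where
  inner v w := B.indForm π v w
  conj_inner_symm v w := by
    classical
    have h := (Complex.continuous_conj.tendsto _).comp (B.tendsto_indForm π w v)
    refine tendsto_nhds_unique (h.congr fun j => ?_) (B.tendsto_indForm π v w)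
    simp [map_sum]
  re_inner_nonneg v := by
    classical
    have h := (Complex.continuous_re.tendsto _).comp (B.tendsto_indForm π v v)
    refine ge_of_tendsto' h fun j => ?_
    rw [Function.comp_apply, Complex.re_sum]
    exact Finset.sum_nonneg fun i _ => inner_self_nonneg (𝕜 := ℂ)
  add_left v w z := by simp
  smul_left v w c := by simp

instance : SeminormedAddCommGroup (B.IndSpace π) :=
  @InnerProductSpace.Core.toSeminormedAddCommGroup ℂ (B.Sec ⊗[ℂ] H) _ _ _ (B.indCore π)

instance : InnerProductSpace ℂ (B.IndSpace π) :=
  @InnerProductSpace.ofCore ℂ (B.Sec ⊗[ℂ] H) _ _ _ (B.indCore π)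

/-- The identification of `C_c(B) ⊗ H` with `IndSpace`. -/
def indEquiv : B.Sec ⊗[ℂ] H ≃ₗ[ℂ] B.IndSpace π where
  toFun v := v
  invFun v := v
  map_add' _ _ := rfl
  map_smul' _ _ := rfl
  left_inv _ := rfl
  right_inv _ := rfl

/-- The vector `x ⊗ h`. -/
def indVec (x : B.Sec) (h : H) : B.IndSpace π := B.indEquiv π (x ⊗ₜ[ℂ] h)

theorem inner_indVec (x y : B.Sec) (h k : H) :
    inner ℂ (B.indVec π x h) (B.indVec π y k) = inner ℂ h (π (B.innerSec x y) k) := rfl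

@[elab_as_elim]
theorem indSpace_induction {Q : B.IndSpace π → Prop} (v : B.IndSpace π) (h0 : Q 0)
    (h1 : ∀ x h, Q (B.indVec π x h)) (h2 : ∀ v w, Q v → Q w → Q (v + w)) : Q v :=
  TensorProduct.induction_on (motive := fun v => Q (B.indEquiv π v)) v h0 h1 h2

theorem norm_indVec_le (x : B.Sec) (h : H) : ‖B.indVec π x h‖ ≤ B.moduleNorm x * ‖h‖ := by
  refine abs_le_of_sq_le_sq' ?_ (mul_nonneg (B.moduleNorm_nonneg x) (norm_nonneg h)) |>.2
  calc ‖B.indVec π x h‖ ^ 2 = ‖inner ℂ (B.indVec π x h) (B.indVec π x h)‖ := by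
        rw [inner_self_eq_norm_sq_to_K]; simp
    _ = ‖inner ℂ h (π (B.innerSec x x) h)‖ := by rw [inner_indVec]
    _ ≤ ‖h‖ * (‖B.innerSec x x‖ * ‖h‖) := by
        refine (norm_inner_le_norm _ _).trans ?_
        gcongr
        refine (ContinuousLinearMap.le_opNorm _ _).trans ?_
        gcongr
        exact NonUnitalStarAlgHom.norm_apply_le π _
    _ = _ := by rw [← moduleNorm_mul_self]; ring

/-- The induced representation on `C_c(B) ⊗ H`. -/
def indRep : B.Sec →ₗ[ℂ] B.IndSpace π →ₗ[ℂ] B.IndSpace π where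
  toFun f := (B.indEquiv π).toLinearMap ∘ₗ TensorProduct.map (LinearMap.mulLeft ℂ f) .id ∘ₗ
    (B.indEquiv π).symm.toLinearMap
  map_add' f g := by
    rw [← LinearMap.comp_add, ← LinearMap.add_comp, ← TensorProduct.map_add_left]
    congr 3
    ext x
    simp [add_mul]
  map_smul' c f := by
    rw [RingHom.id_apply, ← LinearMap.comp_smul, ← LinearMap.smul_comp,
      ← TensorProduct.map_smul_left]
    congr 3
    ext x
    simp [smul_mul_assoc]

theorem indRep_indVec (f x : B.Sec) (h : H) :
    B.indRep π f (B.indVec π x h) = B.indVec π (f * x) h := rfl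

theorem indRep_mul (f g : B.Sec) (v : B.IndSpace π) :
    B.indRep π (f * g) v = B.indRep π f (B.indRep π g v) := by
  refine B.indSpace_induction π v (by simp) (fun x h => ?_) fun v w hv hw => by
    simp only [map_add, hv, hw]
  simp only [indRep_indVec, mul_assoc]

theorem indRep_star (f : B.Sec) (v w : B.IndSpace π) :
    inner ℂ (B.indRep π (star f) v) w = inner ℂ v (B.indRep π f w) := by
  refine B.indSpace_induction π v (by simp) (fun x h => ?_) fun v w hv hw => by
    simp only [map_add, inner_add_left, hv, hw]
  refine B.indSpace_induction π w (by simp) (fun y k => ?_) fun v w hv hw => by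
    simp only [map_add, inner_add_right, hv, hw]
  rw [indRep_indVec, indRep_indVec, inner_indVec, inner_indVec, innerSec, innerSec, star_mul,
    star_star, mul_assoc]

/-- On an elementary vector the bound holds with a constant depending on the vector, since the
reduced norm is at most the full one. The inequality `‖f v‖² ≤ ‖v‖ ‖f* f v‖` then makes the constant
`‖v‖`. -/
theorem norm_indRep_le (f : B.Sec) (v : B.IndSpace π) :
    ‖B.indRep π f v‖ ≤ B.fullNorm f * ‖v‖ := by
  have hb : ∃ C, ∀ f, ‖B.indRep π f v‖ ≤ C * B.fullNorm f := by
    refine B.indSpace_induction π v ⟨0, fun f => by simp⟩ (fun x h => ?_) ?_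
    · refine ⟨B.moduleNorm x * ‖h‖, fun f => ?_⟩
      rw [indRep_indVec]
      refine (B.norm_indVec_le π _ _).trans ?_
      calc _ ≤ (B.fullNorm f * B.moduleNorm x) * ‖h‖ := by
            gcongr
            exact (B.moduleNorm_mul_le f x).trans (mul_le_mul_of_nonneg_right
              (B.redNorm_le_fullNorm f) (B.moduleNorm_nonneg x))
        _ = _ := by ring
    · rintro v w ⟨C, hC⟩ ⟨C', hC'⟩
      refine ⟨C + C', fun f => ?_⟩
      rw [map_add, add_mul]
      exact (norm_add_le _ _).trans (add_le_add (hC f) (hC' f))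
  obtain ⟨C, hC⟩ := hb
  rw [mul_comm]
  refine le_mul_of_sq_le_mul (φ := fun f => star f * f) (norm_nonneg v) B.fullNorm.nonneg
    B.fullNorm.star_mul_self' (K := fun f => ‖B.indRep π f v‖) (fun f => ?_) hC f
  calc ‖B.indRep π f v‖ ^ 2 = ‖inner ℂ (B.indRep π f v) (B.indRep π f v)‖ := by
        rw [inner_self_eq_norm_sq_to_K]; simp
    _ = ‖inner ℂ v (B.indRep π (star f * f) v)‖ := by
        rw [indRep_mul, ← B.indRep_star π (star f), star_star]
    _ ≤ _ := norm_inner_le_norm _ _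

/-- The representation of `C*(B)` induced by the representation `π` of the unit fibre. -/
theorem exists_induced_rep : ∃ θ : B.FullAlg →⋆ₙₐ[ℂ]
    (Completion (B.IndSpace π) →L[ℂ] Completion (B.IndSpace π)), ∀ f (v : B.IndSpace π),
      θ (B.toFullHom f) (v : Completion (B.IndSpace π)) =
        ((B.indRep π f v : B.IndSpace π) : Completion (B.IndSpace π)) :=
  exists_completion_rep (E := B.IndSpace π) B.toFullHom B.denseRange_toFullHom (B.indRep π)
    (B.indRep_mul π) (B.indRep_star π) fun f v => by
      rw [norm_toFullHom]; exact B.norm_indRep_le π f v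

end Ind

end FellBundle

theorem norm_sq_eq_norm_inner {E : Type*} [SeminormedAddCommGroup E] [InnerProductSpace ℂ E] (v : E) :
    ‖v‖ ^ 2 = ‖inner ℂ v v‖ := by
  rw [inner_self_eq_norm_sq_to_K]
  simp

/-! ### The minimal norm and the unit fibre of a tensor product -/

namespace FellBundle

variable {G : Type u} [Group G] (B : FellBundle G) {D : Type u} [NonUnitalCStarAlgebra D]

section MinCond

variable {H K : Type u} [NormedAddCommGroup H] [InnerProductSpace ℂ H] [CompleteSpace H]
  [NormedAddCommGroup K] [InnerProductSpace ℂ K] [CompleteSpace K]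
  (π : B.fiber 1 →⋆ₙₐ[ℂ] (H →L[ℂ] H)) (ρ : D →⋆ₙₐ[ℂ] (K →L[ℂ] K))

/-- The map `h ↦ x ⊗ h` into the space of the induced representation. -/
def indIncl : B.Sec →ₗ[ℂ] H →ₗ[ℂ] Completion (B.IndSpace π) :=
  (TensorProduct.mk ℂ B.Sec H).compr₂
    ((Completion.toComplₗᵢ : B.IndSpace π →ₗᵢ[ℂ] _).toLinearMap ∘ₗ (B.indEquiv π).toLinearMap)

theorem indIncl_apply (x : B.Sec) (h : H) :
    B.indIncl π x h = ((B.indVec π x h : B.IndSpace π) : Completion (B.IndSpace π)) := rfl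

/-- The maps `h ⊗ k ↦ (x ⊗ h) ⊗ ρ(d) k`, for `x ⊗ d` in `C_c(B) ⊗ D`. -/
def indTensor : B.Sec ⊗[ℂ] D →ₗ[ℂ] H ⊗[ℂ] K →ₗ[ℂ] Completion (B.IndSpace π) ⊗[ℂ] K :=
  TensorProduct.lift (LinearMap.mk₂ ℂ
    (fun x d => TensorProduct.map (B.indIncl π x) (ρ d : K →ₗ[ℂ] K))
    (fun x x' d => by rw [map_add, TensorProduct.map_add_left])
    (fun c x d => by rw [map_smul, TensorProduct.map_smul_left])
    (fun x d d' => by rw [map_add, ContinuousLinearMap.toLinearMap_add, TensorProduct.map_add_right])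
    (fun c x d => by
      rw [map_smul, ContinuousLinearMap.toLinearMap_smul, TensorProduct.map_smul_right]))

theorem indTensor_tmul (x : B.Sec) (d : D) (h : H) (k : K) :
    B.indTensor π ρ (x ⊗ₜ d) (h ⊗ₜ k) = B.indIncl π x h ⊗ₜ ρ d k := rfl

/-- Writing `V_z` for the operator from `H ⊗ K` into the induced space tensored with `K`, this is
`V_z* V_w = (π ⊗ ρ)((E ⊗ id)(z* w))`. -/
theorem inner_indTensor (z w : B.Sec ⊗[ℂ] D) (v v' : H ⊗[ℂ] K) :
    inner ℂ (B.indTensor π ρ z v) (B.indTensor π ρ w v') =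
      inner ℂ v (spatialRep π ρ (B.condExp D (star z * w)) v') := by
  induction z with
  | zero => simp
  | add z z' h h' =>
    simp only [map_add, LinearMap.add_apply, inner_add_left, h, h', star_add, add_mul, add_apply,
      inner_add_right]
  | tmul x d =>
    induction w with
    | zero => simp
    | add w w' h h' =>
      simp only [map_add, LinearMap.add_apply, inner_add_right, h, h', mul_add, add_apply]
    | tmul y e =>
      induction v with
      | zero => simp
      | add v w h h' => simp only [map_add, inner_add_left, h, h']
      | tmul h k =>
        induction v' with
        | zero => simp
        | add v w h h' => simp only [map_add, inner_add_right, h, h']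
        | tmul h' k' =>
          rw [TensorProduct.star_tmul, Algebra.TensorProduct.tmul_mul_tmul, condExp_tmul,
            spatialRep_tmul, TensorProduct.mapL_tmul, indTensor_tmul, indTensor_tmul,
            TensorProduct.inner_tmul, TensorProduct.inner_tmul, indIncl_apply, indIncl_apply,
            Completion.inner_coe, inner_indVec, map_mul ρ, map_star ρ,
            ContinuousLinearMap.star_eq_adjoint, mul_apply_eq_comp,
            ContinuousLinearMap.adjoint_inner_right]
          rfl

/-- If `θ` is induced by `π`, then `V_{xz} = (θ ⊗ ρ)(x) V_z`. Hence `‖V_{xz}‖²` is at most the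
square of the minimal norm of `x` times `‖V_z‖²`, and `V_z* V_z` is `(π ⊗ ρ)((E ⊗ id)(z* z))`. -/
theorem minTensorNorm_condExp_mul_le (x z : B.Sec ⊗[ℂ] D) :
    tensorNorm (B.fiber 1) D .min (B.condExp D (star (x * z) * (x * z))) ≤
      tensorNorm B.FullAlg D .min (tensorMapHom B.toFullHom (.id ℂ D) x) ^ 2 *
        tensorNorm (B.fiber 1) D .min (B.condExp D (star z * z)) := by
  set M := tensorNorm B.FullAlg D .min (tensorMapHom B.toFullHom (.id ℂ D) x) with hM
  have hM0 : 0 ≤ M := CStarSeminorm.nonneg _ _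
  set N := tensorNorm (B.fiber 1) D .min (B.condExp D (star z * z)) with hN
  have hN0 : 0 ≤ N := CStarSeminorm.nonneg _ _
  refine minTensorNorm_le (by positivity) fun H K _ _ _ _ _ _ π ρ => ?_
  obtain ⟨θ, hθ⟩ := B.exists_induced_rep π
  have hV : ∀ v, B.indTensor π ρ (x * z) v =
      spatialRep θ ρ (tensorMapHom B.toFullHom (.id ℂ D) x) (B.indTensor π ρ z v) := by
    intro v
    clear_value M N
    clear hM hN
    induction x with
    | zero => simp
    | add x x' h h' => simp only [map_add, LinearMap.add_apply, add_mul, add_apply, h, h']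
    | tmul x d =>
      induction z with
      | zero => simp
      | add z z' h h' => simp only [map_add, LinearMap.add_apply, mul_add, h, h']
      | tmul y e =>
        induction v with
        | zero => simp
        | add v v' h h' => simp only [map_add, h, h']
        | tmul h k =>
          rw [Algebra.TensorProduct.tmul_mul_tmul, indTensor_tmul, indTensor_tmul,
            tensorMapHom_tmul, spatialRep_tmul, TensorProduct.mapL_tmul, indIncl_apply,
            indIncl_apply, hθ, indRep_indVec, map_mul ρ]
          rfl
  have h1 : ∀ v, ‖B.indTensor π ρ z v‖ ^ 2 ≤ N * ‖v‖ ^ 2 := by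
    intro v
    calc ‖B.indTensor π ρ z v‖ ^ 2 = ‖inner ℂ (B.indTensor π ρ z v) (B.indTensor π ρ z v)‖ :=
          norm_sq_eq_norm_inner (E := Completion (B.IndSpace π) ⊗[ℂ] K) _
      _ = ‖inner ℂ v (spatialRep π ρ (B.condExp D (star z * z)) v)‖ := by rw [inner_indTensor]
      _ ≤ ‖v‖ * (N * ‖v‖) := by
          refine (norm_inner_le_norm (𝕜 := ℂ) (E := H ⊗[ℂ] K) _ _).trans ?_
          gcongr
          refine (ContinuousLinearMap.le_opNorm _ _).trans ?_
          gcongr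
          exact spatial_le_minTensorNorm _ _ _
      _ = _ := by ring
  have h2 : ∀ v, ‖B.indTensor π ρ (x * z) v‖ ≤ M * √N * ‖v‖ := by
    intro v
    rw [hV, mul_assoc]
    refine (ContinuousLinearMap.le_opNorm _ _).trans ?_
    gcongr
    · exact spatial_le_minTensorNorm _ _ _
    · refine abs_le_of_sq_le_sq' ?_ (by positivity) |>.2
      rw [mul_pow, Real.sq_sqrt hN0]
      exact h1 v
  refine ContinuousLinearMap.opNorm_le_bound _ (by positivity) fun v => ?_
  set T := spatialRep π ρ (B.condExp D (star (x * z) * (x * z))) with hT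
  -- `T` is `V_{xz}* V_{xz}`, so `‖T v‖² = ⟪V_{xz} T v, V_{xz} v⟫`; one factor `‖T v‖` is cancelled
  -- at the end.
  have h3 : ‖T v‖ * ‖T v‖ ≤ (M ^ 2 * N * ‖v‖) * ‖T v‖ := by
    calc ‖T v‖ * ‖T v‖ = ‖inner ℂ (T v) (T v)‖ := by
          rw [← pow_two]
          exact norm_sq_eq_norm_inner (E := H ⊗[ℂ] K) _
      _ = ‖inner ℂ (B.indTensor π ρ (x * z) (T v)) (B.indTensor π ρ (x * z) v)‖ := by
          rw [inner_indTensor]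
      _ ≤ (M * √N * ‖T v‖) * (M * √N * ‖v‖) := by
          refine (norm_inner_le_norm (𝕜 := ℂ) (E := Completion (B.IndSpace π) ⊗[ℂ] K) _ _).trans ?_
          gcongr
          · exact h2 _
          · exact h2 _
      _ = M ^ 2 * √N ^ 2 * ‖v‖ * ‖T v‖ := by ring
      _ = _ := by rw [Real.sq_sqrt hN0]
  rcases (norm_nonneg (T v)).eq_or_lt with h | h
  · rw [← h]; positivity
  · exact le_of_mul_le_mul_right h3 h

end MinCond

/-- The operator norm of `x` on the Hilbert module `ℓ²(B) ⊗ D` is at most its norm in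
`C*(B) ⊗_μ D`. -/
theorem tensorNorm_condExp_mul_le (μ : TensorKind) (x z : B.Sec ⊗[ℂ] D) :
    tensorNorm (B.fiber 1) D μ (B.condExp D (star (x * z) * (x * z))) ≤
      tensorNorm B.FullAlg D μ (tensorMapHom B.toFullHom (.id ℂ D) x) ^ 2 *
        tensorNorm (B.fiber 1) D μ (B.condExp D (star z * z)) := by
  cases μ with
  | max => exact B.maxTensorNorm_condExp_mul_le x z
  | min => exact B.minTensorNorm_condExp_mul_le x z

/-- The inclusion of the unit fibre into `C*(B)` is isometric on `B_e ⊗_μ D`. -/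
theorem tensorNorm_toFull_left (μ : TensorKind) (x : B.fiber 1 ⊗[ℂ] D) :
    tensorNorm B.FullAlg D μ (tensorMapHom B.toFullOneHom (.id ℂ D) x) =
      tensorNorm (B.fiber 1) D μ x := by
  refine le_antisymm (tensorNorm_map_le μ _ _ x) ?_
  set p := tensorNorm (B.fiber 1) D μ
  set q := tensorNorm B.FullAlg D μ
  -- Tested at `z = x*` in the unit fibre, the estimate reads `p(x)⁴ ≤ q(x)² p(x)²`.
  have h := B.tensorNorm_condExp_mul_le μ (B.inclOne D x) (B.inclOne D (star x))
  have e1 : tensorMapHom B.toFullHom (.id ℂ D) (B.inclOne D x) =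
      tensorMapHom B.toFullOneHom (.id ℂ D) x := by
    clear h
    induction x with
    | zero => simp
    | add x y hx hy => simp only [map_add, hx, hy]
    | tmul a d => rfl
  rw [e1, ← map_mul, ← map_star, ← map_mul, ← map_star, ← map_mul, condExp_inclOne,
    condExp_inclOne, p.star_mul_self', p.star_mul_self', p.mul_star_self, p.star_eq] at h
  have h0 := p.nonneg x
  have h0' := q.nonneg (tensorMapHom B.toFullOneHom (.id ℂ D) x)
  rcases h0.eq_or_lt with h1 | h1
  · rw [← h1]; exact h0'
  · have h2 : p x * p x ≤ q (tensorMapHom B.toFullOneHom (.id ℂ D) x) ^ 2 :=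
      le_of_mul_le_mul_right h (mul_pos h1 h1)
    exact le_of_sq_le_sq (by nlinarith) h0'

/-- The inclusions of the unit fibres into the cross-sectional algebras are isometric on
`A_e ⊗_μ B_e`. -/
theorem tensorNorm_toFull (μ : TensorKind) (𝒜 ℬ : FellBundle G)
    (x : 𝒜.fiber 1 ⊗[ℂ] ℬ.fiber 1) :
    tensorNorm 𝒜.FullAlg ℬ.FullAlg μ (tensorMapHom 𝒜.toFullOneHom ℬ.toFullOneHom x) =
      tensorNorm (𝒜.fiber 1) (ℬ.fiber 1) μ x := by
  -- The two legs are enlarged one after the other, the second one by means of the flip.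
  have h1 := 𝒜.tensorNorm_toFull_left μ (tensorMapHom (.id ℂ _) ℬ.toFullOneHom x)
  have h2 := ℬ.tensorNorm_toFull_left μ (tensorCommHom _ _ x)
  rw [tensorNorm_comm] at h2
  have e1 : tensorMapHom 𝒜.toFullOneHom (.id ℂ ℬ.FullAlg)
      (tensorMapHom (.id ℂ _) ℬ.toFullOneHom x) =
      tensorMapHom 𝒜.toFullOneHom ℬ.toFullOneHom x := by
    clear h1 h2
    induction x with
    | zero => simp
    | add x y hx hy => simp only [map_add, hx, hy]
    | tmul a d => rfl
  have e2 : tensorMapHom ℬ.toFullOneHom (.id ℂ (𝒜.fiber 1)) (tensorCommHom _ _ x) =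
      tensorCommHom _ _ (tensorMapHom (.id ℂ (𝒜.fiber 1)) ℬ.toFullOneHom x) := by
    clear h1 h2 e1
    induction x with
    | zero => simp
    | add x y hx hy => simp only [map_add, hx, hy]
    | tmul a d => rfl
  rw [e2, tensorNorm_comm] at h2
  rw [e1] at h1
  rw [h1, h2]

theorem norm_tensorMk_one (μ : TensorKind) (𝒜 ℬ : FellBundle G) (x : 𝒜.fiber 1 ⊗[ℂ] ℬ.fiber 1) :
    ‖tensorMk μ 𝒜 ℬ 1 x‖ = tensorNorm (𝒜.fiber 1) (ℬ.fiber 1) μ x := by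
  rw [← tensorNorm_toFull, ← CStarSeminorm.norm_toAlg]
  rfl

end FellBundle

/-! ### Approximate units and comparison on dense subalgebras -/

section ApproximateUnit

attribute [local instance] CStarAlgebra.spectralOrder CStarAlgebra.spectralOrderedRing

/-- Every C*-algebra has a contractive approximate unit. -/
theorem exists_approximateUnit (D : Type*) [NonUnitalCStarAlgebra D] :
    ∃ l : Filter D, l.NeBot ∧ (∀ᶠ e in l, ‖e‖ ≤ 1) ∧
      (∀ d : D, Filter.Tendsto (fun e => e * d) l (nhds d)) ∧
      ∀ d : D, Filter.Tendsto (fun e => star e * d * e) l (nhds d) := by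
  have hu := CStarAlgebra.increasingApproximateUnit D
  have h1 : ∀ d : D, Filter.Tendsto (fun e => e * d) (CStarAlgebra.approximateUnit D) (nhds d) :=
    hu.tendsto_mul_right
  have h2 : ∀ d : D, Filter.Tendsto (fun e => d * e) (CStarAlgebra.approximateUnit D) (nhds d) :=
    hu.tendsto_mul_left
  refine ⟨CStarAlgebra.approximateUnit D, inferInstance, hu.eventually_norm, h1, fun d => ?_⟩
  have h3 : Filter.Tendsto (fun e => ‖d * e - d‖ + ‖e * d - d‖) (CStarAlgebra.approximateUnit D)
      (nhds 0) := by
    have := (tendsto_iff_norm_sub_tendsto_zero.mp (h2 d)).add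
      (tendsto_iff_norm_sub_tendsto_zero.mp (h1 d))
    rwa [add_zero] at this
  rw [tendsto_iff_norm_sub_tendsto_zero]
  refine squeeze_zero' (Filter.Eventually.of_forall fun c => norm_nonneg _) ?_ h3
  filter_upwards [hu.eventually_norm, hu.eventually_star_eq] with e he he'
  rw [he']
  have : e * d * e - d = e * (d * e - d) + (e * d - d) := by noncomm_ring
  rw [this]
  refine (norm_add_le _ _).trans (add_le_add_left ?_ _)
  refine (norm_mul_le _ _).trans ?_
  nlinarith [norm_nonneg (d * e - d)]

end ApproximateUnit

/-- Subcross C*-seminorms on `A ⊗ D` are compared on a dense subspace of `A`. -/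
theorem le_of_le_on_dense {R A D : Type u} [NonUnitalRing R] [StarRing R] [Module ℂ R]
    [IsScalarTower ℂ R R] [SMulCommClass ℂ R R] [StarModule ℂ R]
    [NonUnitalCStarAlgebra A] [NonUnitalCStarAlgebra D] (m : R →⋆ₙₐ[ℂ] A) (hm : DenseRange m)
    {p q : CStarSeminorm (A ⊗[ℂ] D)} (hp : p.IsSubcross) (hq : q.IsSubcross)
    (h : ∀ x : R ⊗[ℂ] D, p (tensorMapHom m (.id ℂ D) x) ≤ q (tensorMapHom m (.id ℂ D) x))
    (X : A ⊗[ℂ] D) : p X ≤ q X := by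
  -- One and the same `x` approximates `X` for all subcross seminorms at once, so both sides of the
  -- inequality pass to the limit together.
  have key : ∀ ε : ℝ, 0 < ε → ∃ x : R ⊗[ℂ] D, ∀ r : CStarSeminorm (A ⊗[ℂ] D), r.IsSubcross →
      r (X - tensorMapHom m (.id ℂ D) x) ≤ ε := by
    induction X with
    | zero => exact fun ε hε => ⟨0, fun r _ => by rw [map_zero, sub_zero, r.map_zero_eq]; exact hε.le⟩
    | add X Y hX hY =>
      intro ε hε
      obtain ⟨x, hx⟩ := hX (ε / 2) (half_pos hε)
      obtain ⟨y, hy⟩ := hY (ε / 2) (half_pos hε)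
      refine ⟨x + y, fun r hr => ?_⟩
      rw [map_add, add_sub_add_comm]
      linarith [r.add_le (X - tensorMapHom m (.id ℂ D) x) (Y - tensorMapHom m (.id ℂ D) y),
        hx r hr, hy r hr]
    | tmul a d =>
      intro ε hε
      obtain ⟨f, hf⟩ := hm.exists_dist_lt a (ε := ε / (‖d‖ + 1)) (by positivity)
      refine ⟨f ⊗ₜ d, fun r hr => ?_⟩
      rw [tensorMapHom_tmul, NonUnitalStarAlgHom.coe_id, id, ← TensorProduct.sub_tmul]
      refine (hr _ _).trans ?_
      rw [dist_eq_norm, lt_div_iff₀ (by positivity)] at hf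
      nlinarith [norm_nonneg (a - m f)]
  refine le_of_forall_pos_le_add fun ε hε => ?_
  obtain ⟨x, hx⟩ := key (ε / 2) (half_pos hε)
  have h1 := p.add_le (X - tensorMapHom m (.id ℂ D) x) (tensorMapHom m (.id ℂ D) x)
  have h2 := q.add_le X (-(X - tensorMapHom m (.id ℂ D) x))
  have h3 : q (-(X - tensorMapHom m (.id ℂ D) x)) = q (X - tensorMapHom m (.id ℂ D) x) := q.neg' _
  rw [sub_add_cancel] at h1
  rw [h3, ← sub_eq_add_neg, sub_sub_cancel] at h2
  linarith [hx p hp, hx q hq, h x]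

namespace FellBundle

variable {G : Type u} [Group G] (B : FellBundle G) {D P : Type u} [NonUnitalCStarAlgebra D]
  [NonUnitalCStarAlgebra P] (Θ : B.Sec ⊗[ℂ] D →⋆ₙₐ[ℂ] P)

/-! ### Nuclearity -/

theorem constMapAux_add (Φ Ψ : B.Sec →ₗ[ℂ] P) (x : B.Sec) :
    B.constMapAux (Φ + Ψ) x = B.constMapAux Φ x + B.constMapAux Ψ x := by
  refine B.sec_induction x (by simp) (fun g a => ?_) fun x x' h h' => by
    rw [map_add, h, h', map_add, map_add]; abel
  simp only [constMapAux_single, LinearMap.add_apply, map_add]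

theorem constMapAux_smul (c : ℂ) (Φ : B.Sec →ₗ[ℂ] P) (x : B.Sec) :
    B.constMapAux (c • Φ) x = c • B.constMapAux Φ x := by
  refine B.sec_induction x (by simp) (fun g a => ?_) fun x x' h h' => by
    rw [map_add, h, h', map_add, smul_add]
  simp only [constMapAux_single, LinearMap.smul_apply, map_smul]

/-- The linear map underlying `constMapTensor`. -/
def constMapTensorAux : B.Sec ⊗[ℂ] D →ₗ[ℂ] (constBundle G P).Sec :=
  TensorProduct.lift (LinearMap.mk₂ ℂ
    (fun x d => B.constMapAux ((Θ : B.Sec ⊗[ℂ] D →ₗ[ℂ] P) ∘ₗ (TensorProduct.mk ℂ B.Sec D).flip d) x)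
    (fun x x' d => map_add _ _ _) (fun c x d => map_smul _ _ _)
    (fun x d d' => by rw [map_add, LinearMap.comp_add, constMapAux_add])
    (fun c x d => by rw [map_smul, LinearMap.comp_smul, constMapAux_smul]))

theorem constMapTensorAux_single (g : G) (a : B.fiber g) (d : D) :
    B.constMapTensorAux Θ (B.single g a ⊗ₜ d) = constSingle g (Θ (B.single g a ⊗ₜ d)) :=
  B.constMapAux_single _ g a

/-- The coaction `a δ_g ⊗ d ↦ Θ(a δ_g ⊗ d) δ_g` into the trivial bundle. -/
def constMapTensor : B.Sec ⊗[ℂ] D →⋆ₙₐ[ℂ] (constBundle G P).Sec :=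
  tensorStarHom (B.constMapTensorAux Θ)
    (fun x d y e => by
      refine B.sec_induction x (by simp) (fun g a => ?_) fun x x' h h' => by
        simp only [add_mul, TensorProduct.add_tmul, map_add, h, h']
      refine B.sec_induction y (by simp) (fun h b => ?_) fun x x' h h' => by
        simp only [mul_add, TensorProduct.add_tmul, map_add, h, h']
      rw [B.single_mul_single rfl, constMapTensorAux_single, constMapTensorAux_single,
        constMapTensorAux_single, constSingle_mul, ← map_mul Θ, Algebra.TensorProduct.tmul_mul_tmul,
        B.single_mul_single rfl])
    (fun x d => by
      refine B.sec_induction x (by simp) (fun g a => ?_) fun x x' h h' => by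
        simp only [star_add, TensorProduct.add_tmul, map_add, h, h']
      rw [B.star_single rfl, constMapTensorAux_single, constMapTensorAux_single, constSingle_star,
        ← map_star Θ, TensorProduct.star_tmul, B.star_single rfl])

theorem constMapTensor_single (g : G) (a : B.fiber g) (d : D) :
    B.constMapTensor Θ (B.single g a ⊗ₜ d) = constSingle g (Θ (B.single g a ⊗ₜ d)) :=
  B.constMapTensorAux_single Θ g a d

theorem constEval_constMapTensor (x : B.Sec ⊗[ℂ] D) :
    constEval (B.constMapTensor Θ x) = Θ (B.inclOne D (B.condExp D x)) := by
  induction x with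
  | zero => simp
  | add x y hx hy => simp only [map_add, hx, hy]
  | tmul x d =>
    refine B.sec_induction x (by simp) (fun g a => ?_) fun x x' h h' => by
      simp only [TensorProduct.add_tmul, map_add, h, h']
    rw [constMapTensor_single, condExp_tmul, inclOne_tmul]
    by_cases hg : g = 1
    · subst hg
      rw [constEval_single_one, B.eval_single_same]
    · rw [constEval_single_ne hg, B.eval_single_ne hg, map_zero, TensorProduct.zero_tmul, map_zero]

/-- The finitely supported function `Θ(ξ ⊗ e)`. -/
def tensorFinsupp (ξ : G →₀ B.fiber 1) (e : D) : G →₀ P :=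
  ξ.mapRange (fun b => Θ (B.single 1 b ⊗ₜ e)) (by simp)

/-- The analogue of `map_single_apMap` with a second leg. The vector needs an entry in `D`; as `D`
may have no unit, `e` will run through an approximate unit, with `e* d e → d`. -/
theorem map_single_apMap_tensor (ξ : G →₀ B.fiber 1) (g : G) (a : B.fiber g) (d e : D) :
    Θ (B.single g (B.apMap ξ g a) ⊗ₜ (star e * d * e)) =
      constEval (star (constSec (B.tensorFinsupp Θ ξ e)) *
      (B.constMapTensor Θ (B.single g a ⊗ₜ d) * constSec (B.tensorFinsupp Θ ξ e))) := by
  rw [constMapTensor_single, constEval_star_constSec_mul, single_apMap, TensorProduct.sum_tmul,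
    map_sum, tensorFinsupp, Finsupp.sum_mapRange_index (by simp)]
  refine Finset.sum_congr rfl fun h _ => ?_
  beta_reduce
  rw [Finsupp.mapRange_apply, ← map_star Θ, TensorProduct.star_tmul, ← map_mul Θ, ← map_mul Θ,
    Algebra.TensorProduct.tmul_mul_tmul, Algebra.TensorProduct.tmul_mul_tmul]

theorem moduleNorm_constSec_tensorFinsupp (ξ : G →₀ B.fiber 1) (e : D) :
    (constBundle G P).moduleNorm (constSec (B.tensorFinsupp Θ ξ e)) *
      (constBundle G P).moduleNorm (constSec (B.tensorFinsupp Θ ξ e)) =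
      ‖Θ (B.single 1 (ξ.sum fun _ b => star b * b) ⊗ₜ (star e * e))‖ := by
  rw [moduleNorm_const_mul_self, constEval_star_constSec_self, single_sum_star_mul_self,
    TensorProduct.sum_tmul, map_sum, tensorFinsupp, Finsupp.sum_mapRange_index (by simp)]
  congr 1
  refine Finset.sum_congr rfl fun h _ => ?_
  beta_reduce
  rw [← map_star Θ, TensorProduct.star_tmul, ← map_mul Θ, Algebra.TensorProduct.tmul_mul_tmul]

/-- The estimate behind the nuclearity of `C*(B)`. -/
theorem norm_constEval_tensorFinsupp_le (q : CStarSeminorm (B.Sec ⊗[ℂ] D))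
    (hΘ : ∀ g (a : B.fiber g) d, ‖Θ (B.single g a ⊗ₜ d)‖ ≤ ‖a‖ * ‖d‖)
    (hq : ∀ c : B.fiber 1 ⊗[ℂ] D, ∃ C, 0 ≤ C ∧ ∀ x,
      ‖Θ (B.inclOne D (B.condExp D (star (x * B.inclOne D c) * (x * B.inclOne D c))))‖ ≤
        (C * q x) ^ 2) (ξ : G →₀ B.fiber 1) (e : D) (x : B.Sec ⊗[ℂ] D) :
    ‖constEval (star (constSec (B.tensorFinsupp Θ ξ e)) *
      (B.constMapTensor Θ x * constSec (B.tensorFinsupp Θ ξ e)))‖ ≤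
      ‖ξ.sum fun _ b => star b * b‖ * (‖e‖ * ‖e‖) * q x := by
  refine (norm_constEval_le _ _).trans ?_
  have h1 := (constBundle G P).moduleNorm_map_mul_le (B.constMapTensor Θ) q
    (B.tensorFinsupp Θ ξ e).support
    (fun h => constSingle h (B.tensorFinsupp Θ ξ e h)) (fun h _ => ?_) x
  · have h2 := B.moduleNorm_constSec_tensorFinsupp Θ ξ e
    have h3 := hΘ 1 (ξ.sum fun _ b => star b * b) (star e * e)
    rw [CStarRing.norm_star_mul_self] at h3
    refine le_trans ?_ (mul_le_mul_of_nonneg_right (h2.le.trans h3) (q.nonneg x))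
    refine (mul_le_mul_of_nonneg_left h1 (moduleNorm_nonneg _ _)).trans_eq ?_
    rw [constSec]
    ring
  -- On a vector supported at `h`, the squared norm is that of `x (ξ(h) ⊗ e)` in `ℓ²(B) ⊗ D`, seen
  -- through `Θ`. The hypothesis bounds it with a constant depending on `ξ(h) ⊗ e`, which is enough.
  · obtain ⟨C, hC0, hC⟩ := hq (ξ h ⊗ₜ e)
    refine ⟨C, fun x => ?_⟩
    refine abs_le_of_sq_le_sq' ?_ (mul_nonneg hC0 (q.nonneg x)) |>.2
    rw [moduleNorm_mul_constSingle_sq, ← map_star (B.constMapTensor Θ),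
      ← map_mul (B.constMapTensor Θ), constEval_constMapTensor, tensorFinsupp,
      Finsupp.mapRange_apply, ← inclOne_tmul, ← map_star Θ, ← map_mul Θ, ← map_mul Θ,
      ← map_star (B.inclOne D), ← map_mul (B.inclOne D), ← map_mul (B.inclOne D)]
    refine le_trans (le_of_eq ?_) (hC x)
    congr 3
    rw [← condExp_inclOne_mul, ← condExp_mul_inclOne, star_mul, map_star (B.inclOne D)]
    simp only [mul_assoc]

/-- The cross-sectional algebra of a Fell bundle with the approximation property and nuclear unit
fibre is nuclear. -/
theorem HasAP.isNuclear {B : FellBundle G} (hB : B.HasAP) (hA : IsNuclear (B.fiber 1)) :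
    IsNuclear B.FullAlg := by
  intro D _ X
  refine le_antisymm ?_ (min_le_max_tensorNorm X)
  refine le_of_le_on_dense B.toFullHom B.denseRange_toFullHom (tensorNorm_isSubcross .max)
    (tensorNorm_isSubcross .min) (fun x => ?_) X
  clear X
  set j := tensorMapHom B.toFullHom (NonUnitalStarAlgHom.id ℂ D) with hj
  set p := tensorNorm B.FullAlg D .max with hp
  set q := (tensorNorm B.FullAlg D .min).comap j with hq
  let Θ : B.Sec ⊗[ℂ] D →⋆ₙₐ[ℂ] p.Alg := p.toAlgHom.comp j
  have hΘn : ∀ x, ‖Θ x‖ = p (j x) := fun x => p.norm_toAlgHom _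
  clear_value Θ
  have hΘ : ∀ g (a : B.fiber g) d, ‖Θ (B.single g a ⊗ₜ d)‖ ≤ ‖a‖ * ‖d‖ := fun g a d => by
    rw [hΘn, ← B.norm_toFull g a]
    exact tensorNorm_isSubcross .max _ _
  have hbd : ∀ c : B.fiber 1 ⊗[ℂ] D, ∃ C, 0 ≤ C ∧ ∀ x,
      ‖Θ (B.inclOne D (B.condExp D (star (x * B.inclOne D c) * (x * B.inclOne D c))))‖ ≤
        (C * q x) ^ 2 := by
    intro c
    refine ⟨tensorNorm (B.fiber 1) D .min c, CStarSeminorm.nonneg _ _, fun x => ?_⟩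
    have e1 : ∀ y, j (B.inclOne D y) = tensorMapHom B.toFullOneHom (.id ℂ D) y := fun y => by
      induction y with
      | zero => simp
      | add x y hx hy => simp only [map_add, hx, hy]
      | tmul a d => rfl
    rw [hΘn, e1]
    refine (tensorNorm_map_le .max _ _ _).trans ?_
    -- Here nuclearity of the unit fibre enters: the inner product lies in `B_e ⊗ D`, where the
    -- maximal norm is exchanged for the minimal one.
    rw [hA D]
    refine (B.tensorNorm_condExp_mul_le .min x (B.inclOne D c)).trans_eq ?_
    rw [← map_star (B.inclOne D), ← map_mul (B.inclOne D), condExp_inclOne,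
      (tensorNorm (B.fiber 1) D .min).star_mul_self', mul_pow, ← pow_two, mul_comm]
    rfl
  obtain ⟨l, _, M, hM, hl⟩ := hB.exists_filter
  obtain ⟨l', _, hl'n, -, hl'⟩ := exists_approximateUnit D
  -- It suffices to compare the maximal and the minimal seminorm up to a constant.
  suffices h : ∀ x, p.comap j x ≤ M * q x from CStarSeminorm.le_of_le_mul h x
  clear x
  intro x
  -- The compressions converge to `Θ x`: on `a δ_g ⊗ d` they are `Θ(apMap ξ g a ⊗ e* d e)`, which is
  -- jointly continuous in its two entries.
  have hlim : Filter.Tendsto (fun i : (G →₀ B.fiber 1) × D =>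
      constEval (star (constSec (B.tensorFinsupp Θ i.1 i.2)) *
      (B.constMapTensor Θ x * constSec (B.tensorFinsupp Θ i.1 i.2)))) (l ×ˢ l') (nhds (Θ x)) := by
    induction x with
    | zero => simp
    | add x y hx hy =>
      simp only [map_add, add_mul, mul_add]
      exact hx.add hy
    | tmul x d =>
      refine B.sec_induction x ?_ (fun g a => ?_) fun x y hx hy => ?_
      · simp
      · simp only [← map_single_apMap_tensor]
        let β : B.fiber g →ₗ[ℂ] D →ₗ[ℂ] p.Alg :=
          ((TensorProduct.mk ℂ B.Sec D).compr₂ (Θ : B.Sec ⊗[ℂ] D →ₗ[ℂ] p.Alg)) ∘ₗ B.single g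
        have hβ : ∀ a d, β a d = Θ (B.single g a ⊗ₜ d) := fun _ _ => rfl
        have hc : Continuous fun i : B.fiber g × D => β i.1 i.2 :=
          (β.mkContinuous₂ 1 fun a d => by rw [one_mul, hβ]; exact hΘ g a d).continuous₂
        have h1 : Filter.Tendsto (fun i : (G →₀ B.fiber 1) × D =>
            (B.apMap i.1 g a, star i.2 * d * i.2)) (l ×ˢ l') (nhds (a, d)) :=
          ((hl g a).comp Filter.tendsto_fst).prodMk_nhds ((hl' d).comp Filter.tendsto_snd)
        exact (hc.tendsto (a, d)).comp h1
      · simp only [TensorProduct.add_tmul, map_add, add_mul, mul_add]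
        exact hx.add hy
  rw [CStarSeminorm.comap_apply, ← hΘn]
  refine le_of_tendsto hlim.norm ?_
  filter_upwards [hM.prod_mk hl'n] with i hi
  refine (B.norm_constEval_tensorFinsupp_le Θ q hΘ hbd i.1 i.2 x).trans ?_
  refine mul_le_mul_of_nonneg_right ?_ (q.nonneg x)
  have h0 := norm_nonneg (i.1.sum fun _ b => star b * b)
  have h1 : ‖i.2‖ * ‖i.2‖ ≤ 1 := by nlinarith [norm_nonneg i.2, hi.2]
  nlinarith [hi.1]

end FellBundle

/-! ### Nuclearity of tensor products -/

section Nuclear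

variable {A B C D E : Type u} [NonUnitalCStarAlgebra A] [NonUnitalCStarAlgebra B]
  [NonUnitalCStarAlgebra C] [NonUnitalCStarAlgebra D]

/-- The smallest function `r` on `R` with `p (a ⊗ y) ≤ r(y) ‖a‖`. -/
def secondLegNorm {R : Type u} [NonUnitalRing R] [StarRing R] [Module ℂ R] [IsScalarTower ℂ R R]
    [SMulCommClass ℂ R R] [StarModule ℂ R] (p : CStarSeminorm (A ⊗[ℂ] R)) (y : R) : ℝ :=
  sInf {M : ℝ | 0 ≤ M ∧ ∀ a, p (a ⊗ₜ y) ≤ M * ‖a‖}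

section SecondLeg

variable {R : Type u} [NonUnitalRing R] [StarRing R] [Module ℂ R] [IsScalarTower ℂ R R]
  [SMulCommClass ℂ R R] [StarModule ℂ R] (p : CStarSeminorm (A ⊗[ℂ] R))

theorem secondLegNorm_nonneg (y : R) : 0 ≤ secondLegNorm p y := Real.sInf_nonneg fun _ h => h.1

theorem secondLegNorm_le {y : R} {M : ℝ} (h0 : 0 ≤ M) (h : ∀ a, p (a ⊗ₜ y) ≤ M * ‖a‖) :
    secondLegNorm p y ≤ M := csInf_le ⟨0, fun _ h => h.1⟩ ⟨h0, h⟩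

variable {p} (hb : ∀ y : R, ∃ M, 0 ≤ M ∧ ∀ a, p (a ⊗ₜ y) ≤ M * ‖a‖)
include hb

theorem le_secondLegNorm (a : A) (y : R) : p (a ⊗ₜ y) ≤ secondLegNorm p y * ‖a‖ := by
  obtain ⟨M, hM⟩ := hb y
  rcases (norm_nonneg a).eq_or_lt with h | h
  · rw [← h, mul_zero]
    have := hM.2 a
    rwa [← h, mul_zero] at this
  · rw [← div_le_iff₀ h]
    exact le_csInf ⟨M, hM⟩ fun N hN => (div_le_iff₀ h).mpr (hN.2 a)

theorem secondLegNorm_add_le (x y : R) :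
    secondLegNorm p (x + y) ≤ secondLegNorm p x + secondLegNorm p y :=
  secondLegNorm_le p (add_nonneg (secondLegNorm_nonneg p x) (secondLegNorm_nonneg p y)) fun a => by
    rw [TensorProduct.tmul_add, add_mul]
    exact (p.add_le _ _).trans (add_le_add (le_secondLegNorm hb a x) (le_secondLegNorm hb a y))

theorem secondLegNorm_smul_le (c : ℂ) (y : R) :
    secondLegNorm p (c • y) ≤ ‖c‖ * secondLegNorm p y :=
  secondLegNorm_le p (mul_nonneg (norm_nonneg c) (secondLegNorm_nonneg p y)) fun a => by
    rw [TensorProduct.tmul_smul, p.smul_eq, mul_assoc]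
    exact mul_le_mul_of_nonneg_left (le_secondLegNorm hb a y) (norm_nonneg c)

/-- An approximate unit of `A` splits the product: `a ⊗ xy = (e ⊗ x)(a ⊗ y) - (e a - a) ⊗ xy`, and
the last term becomes small. -/
theorem secondLegNorm_mul_le (x y : R) :
    secondLegNorm p (x * y) ≤ secondLegNorm p x * secondLegNorm p y := by
  refine secondLegNorm_le p (mul_nonneg (secondLegNorm_nonneg p x) (secondLegNorm_nonneg p y))
    fun a => ?_
  obtain ⟨l, _, hl1, hl, -⟩ := exists_approximateUnit A
  have h1 : Filter.Tendsto (fun e => secondLegNorm p x * secondLegNorm p y * ‖a‖ +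
      secondLegNorm p (x * y) * ‖e * a - a‖) l
      (nhds (secondLegNorm p x * secondLegNorm p y * ‖a‖)) := by
    have := (((tendsto_iff_norm_sub_tendsto_zero.mp (hl a)).const_mul
      (secondLegNorm p (x * y))).const_add (secondLegNorm p x * secondLegNorm p y * ‖a‖))
    rwa [mul_zero, add_zero] at this
  refine ge_of_tendsto h1 ?_
  filter_upwards [hl1] with e he
  have h2 : a ⊗ₜ[ℂ] (x * y) = e ⊗ₜ x * a ⊗ₜ y + -((e * a - a) ⊗ₜ (x * y)) := by
    rw [Algebra.TensorProduct.tmul_mul_tmul, TensorProduct.sub_tmul]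
    abel
  rw [h2]
  refine (p.add_le _ _).trans (add_le_add ?_ ?_)
  · refine (p.mul_le' _ _).trans ?_
    have h3 := le_secondLegNorm hb e x
    have h4 := le_secondLegNorm hb a y
    have h5 := secondLegNorm_nonneg p x
    have h6 := mul_le_mul h3 h4 (p.nonneg _) (mul_nonneg h5 (norm_nonneg e))
    refine h6.trans ?_
    have h7 : 0 ≤ secondLegNorm p x * secondLegNorm p y * ‖a‖ :=
      mul_nonneg (mul_nonneg h5 (secondLegNorm_nonneg p y)) (norm_nonneg a)
    nlinarith [mul_le_mul_of_nonneg_right he h7]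
  · refine (p.neg' _).trans_le ?_
    exact le_secondLegNorm hb _ _

theorem secondLegNorm_mul_self_le (y : R) :
    secondLegNorm p y * secondLegNorm p y ≤ secondLegNorm p (star y * y) := by
  have h : secondLegNorm p y ≤ √(secondLegNorm p (star y * y)) := by
    refine secondLegNorm_le p (Real.sqrt_nonneg _) fun a => ?_
    refine abs_le_of_sq_le_sq' ?_ (by positivity) |>.2
    rw [mul_pow, Real.sq_sqrt (secondLegNorm_nonneg p _), pow_two, ← p.star_mul_self',
      TensorProduct.star_tmul, Algebra.TensorProduct.tmul_mul_tmul, pow_two,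
      ← CStarRing.norm_star_mul_self]
    exact le_secondLegNorm hb _ _
  calc _ ≤ √(secondLegNorm p (star y * y)) * √(secondLegNorm p (star y * y)) :=
        mul_le_mul h h (secondLegNorm_nonneg p y) (Real.sqrt_nonneg _)
    _ = _ := Real.mul_self_sqrt (secondLegNorm_nonneg p _)

theorem secondLegNorm_le_star (y : R) : secondLegNorm p y ≤ secondLegNorm p (star y) :=
  secondLegNorm_le p (secondLegNorm_nonneg p _) fun a => by
    rw [← p.star_eq, TensorProduct.star_tmul, ← norm_star a]
    exact le_secondLegNorm hb _ _

/-- `secondLegNorm` as a C*-seminorm. -/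
def CStarSeminorm.secondLeg : CStarSeminorm R where
  toFun := secondLegNorm p
  map_zero' := le_antisymm (secondLegNorm_le p le_rfl fun a => by
    rw [TensorProduct.tmul_zero, p.map_zero_eq, zero_mul]) (secondLegNorm_nonneg p _)
  add_le' := secondLegNorm_add_le hb
  neg' y := by
    have : ∀ a, p (a ⊗ₜ (-y)) = p (a ⊗ₜ y) := fun a => by
      rw [TensorProduct.tmul_neg]; exact p.neg' _
    simp only [secondLegNorm, this]
  smul' c y := by
    refine le_antisymm (secondLegNorm_smul_le hb c y) ?_
    rcases eq_or_ne c 0 with rfl | hc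
    · rw [norm_zero, zero_mul]
      exact secondLegNorm_nonneg p _
    · have h := secondLegNorm_smul_le hb c⁻¹ (c • y)
      rw [smul_smul, inv_mul_cancel₀ hc, one_smul, norm_inv] at h
      rwa [inv_mul_eq_div, le_div_iff₀' (norm_pos_iff.mpr hc)] at h
  mul_le' := secondLegNorm_mul_le hb
  star_mul_self' y := by
    refine le_antisymm ((secondLegNorm_mul_le hb _ _).trans ?_) (secondLegNorm_mul_self_le hb y)
    refine mul_le_mul_of_nonneg_right ?_ (secondLegNorm_nonneg p y)
    simpa using secondLegNorm_le_star hb (star y)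

end SecondLeg

/-- A C*-seminorm on `A ⊗ (B ⊗ D)` that is bounded on elementary tensors is dominated by the maximal
norm on the second leg. -/
theorem le_norm_mul_max {p : CStarSeminorm (A ⊗[ℂ] (B ⊗[ℂ] D))}
    (hp : ∀ a b d, p (a ⊗ₜ (b ⊗ₜ d)) ≤ ‖a‖ * (‖b‖ * ‖d‖)) (a : A) (y : B ⊗[ℂ] D) :
    p (a ⊗ₜ y) ≤ ‖a‖ * tensorNorm B D .max y := by
  have hb : ∀ y : B ⊗[ℂ] D, ∃ M, 0 ≤ M ∧ ∀ a, p (a ⊗ₜ y) ≤ M * ‖a‖ := by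
    intro y
    induction y with
    | zero => exact ⟨0, le_rfl, fun a => by rw [TensorProduct.tmul_zero, p.map_zero_eq, zero_mul]⟩
    | tmul b d => exact ⟨‖b‖ * ‖d‖, by positivity, fun a => by rw [mul_comm]; exact hp a b d⟩
    | add x y hx hy =>
      obtain ⟨M, hM0, hM⟩ := hx
      obtain ⟨N, hN0, hN⟩ := hy
      refine ⟨M + N, add_nonneg hM0 hN0, fun a => ?_⟩
      rw [TensorProduct.tmul_add, add_mul]
      exact (p.add_le _ _).trans (add_le_add (hM a) (hN a))
  rw [mul_comm]
  refine (le_secondLegNorm hb a y).trans (mul_le_mul_of_nonneg_right ?_ (norm_nonneg a))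
  -- As a function of the second leg alone, the best constant is a subcross C*-seminorm on `B ⊗ D`.
  refine le_maxTensorNorm (p := CStarSeminorm.secondLeg hb) (fun b d => ?_) y
  exact secondLegNorm_le p (by positivity) fun a => by rw [mul_comm]; exact hp a b d

section MinAssoc

variable {H : Type u} [NormedAddCommGroup H] [InnerProductSpace ℂ H] [CompleteSpace H]
  (π : A →⋆ₙₐ[ℂ] (H →L[ℂ] H)) (h : H)

/-- The slice map `a ⊗ y ↦ ⟪h, π(a) h⟫ y`. -/
def sliceMap (R : Type u) [AddCommGroup R] [Module ℂ R] : A ⊗[ℂ] R →ₗ[ℂ] R :=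
  TensorProduct.lift (LinearMap.mk₂ ℂ (fun a y => (inner ℂ h (π a h) : ℂ) • y)
    (fun a a' y => by rw [map_add, add_apply, inner_add_right, add_smul])
    (fun c a y => by rw [map_smul, smul_apply, inner_smul_right, mul_smul])
    (fun a y y' => smul_add _ _ _) (fun c a y => smul_comm _ _ _))

theorem sliceMap_tmul (R : Type u) [AddCommGroup R] [Module ℂ R] (a : A) (y : R) :
    sliceMap π h R (a ⊗ₜ y) = (inner ℂ h (π a h) : ℂ) • y := rfl

variable (m : A ⊗[ℂ] B →⋆ₙₐ[ℂ] C) (hm : DenseRange m)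
  (hmin : ∀ x, tensorNorm A B .min x ≤ ‖m x‖)

/-- The map `A ⊗ (B ⊗ D) → C ⊗ D` obtained from `A ⊗ B → C`. -/
def assocMap (D : Type u) [NonUnitalCStarAlgebra D] : A ⊗[ℂ] (B ⊗[ℂ] D) →⋆ₙₐ[ℂ] C ⊗[ℂ] D :=
  (tensorMapHom m (.id ℂ D)).comp (tensorAssocHom A B D)

theorem assocMap_tmul (a : A) (b : B) (d : D) :
    assocMap m D (a ⊗ₜ (b ⊗ₜ d)) = m (a ⊗ₜ b) ⊗ₜ d := rfl

section Slice

variable {K L T : Type u} [NormedAddCommGroup K] [InnerProductSpace ℂ K]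
  [NormedAddCommGroup L] [InnerProductSpace ℂ L]
  [NormedAddCommGroup T] [InnerProductSpace ℂ T]

theorem inner_map_id_map_id {J : K →ₗ[ℂ] T} {c : ℂ}
    (hJ : ∀ k k', inner ℂ (J k) (J k') = c * inner ℂ k k') (v w : K ⊗[ℂ] L) :
    inner ℂ (TensorProduct.map J .id v) (TensorProduct.map J .id w) = c * inner ℂ v w := by
  induction v with
  | zero => simp
  | add v v' h h' => simp only [map_add, inner_add_left, h, h', mul_add]
  | tmul k l =>
    induction w with
    | zero => simp
    | add v v' h h' => simp only [map_add, inner_add_right, h, h', mul_add]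
    | tmul k' l' =>
      rw [TensorProduct.map_tmul, TensorProduct.map_tmul, TensorProduct.inner_tmul,
        TensorProduct.inner_tmul, hJ, LinearMap.id_apply, LinearMap.id_apply, mul_assoc]

theorem norm_map_id {J : K →ₗ[ℂ] T} (hJ : ∀ k k', inner ℂ (J k) (J k') = (inner ℂ h h : ℂ) *
    inner ℂ k k') (v : K ⊗[ℂ] L) : ‖TensorProduct.map J .id v‖ = ‖h‖ * ‖v‖ := by
  refine (sq_eq_sq₀ (norm_nonneg _) (by positivity)).mp ?_
  rw [norm_sq_eq_norm_inner (E := T ⊗[ℂ] L), mul_pow, norm_sq_eq_norm_inner h,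
    norm_sq_eq_norm_inner (E := K ⊗[ℂ] L) v, ← norm_mul]
  exact congrArg _ (inner_map_id_map_id hJ v v)

/-- Here `J` behaves like `k ↦ h ⊗ k`. Slicing the first leg by the functional of `h` is compression
by `J ⊗ 1`, and therefore is compatible with spatial representations. -/
theorem inner_spatialRep_sliceMap [CompleteSpace K] [CompleteSpace L] [CompleteSpace T]
    (ρ : B →⋆ₙₐ[ℂ] (K →L[ℂ] K)) (τ : D →⋆ₙₐ[ℂ] (L →L[ℂ] L))
    (θ : C →⋆ₙₐ[ℂ] (T →L[ℂ] T))
    {J : K →ₗ[ℂ] T} (hJ : ∀ a b k k', inner ℂ (J k) (θ (m (a ⊗ₜ b)) (J k')) =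
      (inner ℂ h (π a h) : ℂ) * inner ℂ k (ρ b k')) (z : A ⊗[ℂ] (B ⊗[ℂ] D)) (v w : K ⊗[ℂ] L) :
    inner ℂ v (spatialRep ρ τ (sliceMap π h _ z) w) =
      inner ℂ (TensorProduct.map J .id v)
        (spatialRep θ τ (assocMap m D z) (TensorProduct.map J .id w)) := by
  induction z with
  | zero => simp
  | add z z' h h' => simp only [map_add, add_apply, inner_add_right, h, h']
  | tmul a y =>
    induction y with
    | zero => simp
    | add z z' h h' =>
      simp only [map_add, TensorProduct.tmul_add, add_apply, inner_add_right, h, h']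
    | tmul b d =>
      induction v with
      | zero => simp
      | add v v' h h' => simp only [map_add, inner_add_left, h, h']
      | tmul k l =>
        induction w with
        | zero => simp
        | add v v' h h' => simp only [map_add, inner_add_right, h, h']
        | tmul k' l' =>
          rw [sliceMap_tmul, assocMap_tmul, map_smul, spatialRep_tmul, spatialRep_tmul,
            smul_apply, TensorProduct.mapL_tmul, inner_smul_right, TensorProduct.map_tmul,
            TensorProduct.map_tmul, TensorProduct.mapL_tmul, TensorProduct.inner_tmul,
            TensorProduct.inner_tmul, hJ, mul_assoc]
          rfl

end Slice

-- Since `m` is bounded below by the minimal norm, `π ⊗ ρ` extends from `A ⊗ B` to a representation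
-- of `C` on the completion of `H ⊗ K`; `J` is `k ↦ h ⊗ k`.
include hm hmin in
theorem exists_slice_rep {K : Type u} [NormedAddCommGroup K] [InnerProductSpace ℂ K]
    [CompleteSpace K] (ρ : B →⋆ₙₐ[ℂ] (K →L[ℂ] K)) :
    ∃ (T : Type u) (_ : NormedAddCommGroup T) (_ : InnerProductSpace ℂ T) (_ : CompleteSpace T)
      (θ : C →⋆ₙₐ[ℂ] (T →L[ℂ] T)) (J : K →ₗ[ℂ] T),
      (∀ k k', inner ℂ (J k) (J k') = (inner ℂ h h : ℂ) * inner ℂ k k') ∧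
      ∀ a b k k', inner ℂ (J k) (θ (m (a ⊗ₜ b)) (J k')) =
        (inner ℂ h (π a h) : ℂ) * inner ℂ k (ρ b k') := by
  obtain ⟨θ, hθ⟩ := exists_completion_rep (E := H ⊗[ℂ] K) m hm
    (ContinuousLinearMap.coeLM ℂ ∘ₗ spatialRep π ρ)
    (fun x y v => by
      change spatialRep π ρ (x * y) v = _
      rw [spatialRep_mul]
      rfl)
    (spatialRep_star π ρ)
    (fun x v => (ContinuousLinearMap.le_opNorm _ _).trans (mul_le_mul_of_nonneg_right
      ((spatial_le_minTensorNorm π ρ x).trans (hmin x)) (norm_nonneg v)))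
  refine ⟨Completion (H ⊗[ℂ] K), inferInstance, inferInstance, inferInstance, θ,
    (Completion.toComplₗᵢ : H ⊗[ℂ] K →ₗᵢ[ℂ] _).toLinearMap ∘ₗ TensorProduct.mk ℂ H K h,
    fun k k' => ?_, fun a b k k' => ?_⟩
  · exact (Completion.inner_coe (h ⊗ₜ[ℂ] k) (h ⊗ₜ[ℂ] k')).trans
      (TensorProduct.inner_tmul ..)
  · have h1 := hθ (a ⊗ₜ b) (h ⊗ₜ k')
    change inner ℂ ((h ⊗ₜ[ℂ] k : H ⊗[ℂ] K) : Completion (H ⊗[ℂ] K))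
      (θ (m (a ⊗ₜ b)) ((h ⊗ₜ[ℂ] k' : H ⊗[ℂ] K) : Completion (H ⊗[ℂ] K))) = _
    rw [h1]
    refine (Completion.inner_coe (h ⊗ₜ[ℂ] k) (spatialRep π ρ (a ⊗ₜ b) (h ⊗ₜ k'))).trans ?_
    rw [spatialRep_tmul, TensorProduct.mapL_tmul]
    exact TensorProduct.inner_tmul ..

include hm hmin in
/-- Slice maps are bounded for the minimal norm. -/
theorem minTensorNorm_sliceMap_le (z : A ⊗[ℂ] (B ⊗[ℂ] D)) :
    tensorNorm B D .min (sliceMap π h _ z) ≤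
      ‖h‖ ^ 2 * tensorNorm C D .min (assocMap m D z) := by
  refine minTensorNorm_le (mul_nonneg (by positivity) (CStarSeminorm.nonneg _ _))
    fun K L _ _ _ _ _ _ ρ τ => ?_
  obtain ⟨T, _, _, _, θ, J₀, hJ₀, hθ⟩ := exists_slice_rep π h m hm hmin ρ
  have hJn := norm_map_id (L := L) h hJ₀
  have key := inner_spatialRep_sliceMap π h m ρ τ θ hθ z
  set J := TensorProduct.map J₀ (LinearMap.id (R := ℂ) (M := L)) with hJ
  clear_value J
  refine ContinuousLinearMap.opNorm_le_bound _ (mul_nonneg (by positivity)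
    (CStarSeminorm.nonneg _ _)) fun w => ?_
  set S := spatialRep ρ τ (sliceMap π h _ z) w with hS
  set q := tensorNorm C D .min (assocMap m D z) with hq
  have hq0 : 0 ≤ q := CStarSeminorm.nonneg _ _
  have h3 : ‖S‖ * ‖S‖ ≤ (‖h‖ ^ 2 * q * ‖w‖) * ‖S‖ := by
    calc ‖S‖ * ‖S‖ = ‖inner ℂ S S‖ := by
          rw [← pow_two]
          exact norm_sq_eq_norm_inner (E := K ⊗[ℂ] L) _
      _ = ‖inner ℂ (J S) (spatialRep θ τ (assocMap m D z) (J w))‖ := by rw [← key]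
      _ ≤ ‖J S‖ * (q * ‖J w‖) := by
          refine (norm_inner_le_norm (𝕜 := ℂ) (E := T ⊗[ℂ] L) _ _).trans ?_
          gcongr
          refine (ContinuousLinearMap.le_opNorm _ _).trans ?_
          gcongr
          exact spatial_le_minTensorNorm _ _ _
      _ = _ := by rw [hJn, hJn]; ring
  rcases (norm_nonneg S).eq_or_lt with h | h
  · rw [← h]; positivity
  · exact le_of_mul_le_mul_right h3 h

include hm hmin in
/-- Associativity of the minimal norm. -/
theorem minTensorNorm_assoc_le [NonUnitalCStarAlgebra E] (e : B ⊗[ℂ] D →⋆ₙₐ[ℂ] E)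
    (he : ∀ y, ‖e y‖ ≤ tensorNorm B D .min y) (z : A ⊗[ℂ] (B ⊗[ℂ] D)) :
    tensorNorm A E .min (tensorMapHom (.id ℂ A) e z) ≤ tensorNorm C D .min (assocMap m D z) := by
  refine minTensorNorm_le (CStarSeminorm.nonneg _ _) fun H K _ _ _ _ _ _ π σ => ?_
  set j := tensorMapHom (NonUnitalStarAlgHom.id ℂ A) e with hj
  set q := CStarSeminorm.comap (R := A ⊗[ℂ] (B ⊗[ℂ] D)) (S := C ⊗[ℂ] D)
    (tensorNorm C D .min) (assocMap m D) with hq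
  refine ContinuousLinearMap.opNorm_le_bound _ (CStarSeminorm.nonneg _ _) fun v => ?_
  change _ ≤ q z * ‖v‖
  -- The representation `σ` of `E` need not be spatial on `B ⊗ D`, so `π ⊗ σ` is not compared with a
  -- representation of `C ⊗ D` directly. Its diagonal coefficients at elementary vectors only
  -- involve slices, and these are bounded for the minimal norm of `C ⊗ D`.
  have hel : ∀ (h : H) (k : K) z, inner ℂ (h ⊗ₜ[ℂ] k) (spatialRep π σ (j z) (h ⊗ₜ k)) =
      inner ℂ k (σ (e (sliceMap π h _ z)) k) := by
    intro h k z
    induction z with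
    | zero => simp
    | add z z' h h' => simp only [map_add, add_apply, inner_add_right, h, h']
    | tmul a y =>
      rw [hj, tensorMapHom_tmul, spatialRep_tmul, TensorProduct.mapL_tmul,
        TensorProduct.inner_tmul, sliceMap_tmul, map_smul e, map_smul σ, smul_apply,
        inner_smul_right]
      rfl
  have hsq : ∀ v z, ‖spatialRep π σ (j z) v‖ ^ 2 =
      ‖inner ℂ v (spatialRep π σ (j (star z * z)) v)‖ := by
    intro v z
    rw [map_mul j, map_star j, spatialRep_mul, mul_apply_eq_comp]
    refine (norm_sq_eq_norm_inner (E := H ⊗[ℂ] K) _).trans ?_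
    have := spatialRep_star π σ (star (j z)) v (spatialRep π σ (j z) v)
    rw [star_star] at this
    exact congrArg _ this
  have hb : ∃ M, ∀ z, ‖spatialRep π σ (j z) v‖ ≤ M * q z := by
    induction v with
    | zero => exact ⟨0, fun z => by simp⟩
    | add v w hv hw =>
      obtain ⟨M, hM⟩ := hv
      obtain ⟨N, hN⟩ := hw
      refine ⟨M + N, fun z => ?_⟩
      rw [map_add, add_mul]
      exact (norm_add_le _ _).trans (add_le_add (hM z) (hN z))
    | tmul h k =>
      -- The diagonal coefficient at `z* z` controls `‖(π ⊗ σ)(z)(h ⊗ k)‖²`. Sums of elementary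
      -- vectors get a crude constant, which is sharpened to `‖v‖` afterwards.
      refine ⟨‖h‖ * ‖k‖, fun z => ?_⟩
      refine abs_le_of_sq_le_sq' ?_ (mul_nonneg (by positivity) (q.nonneg z)) |>.2
      rw [hsq, hel]
      calc _ ≤ ‖k‖ * ((‖h‖ ^ 2 * q (star z * z)) * ‖k‖) := by
            refine (norm_inner_le_norm _ _).trans ?_
            gcongr
            refine (ContinuousLinearMap.le_opNorm _ _).trans ?_
            gcongr
            refine (NonUnitalStarAlgHom.norm_apply_le σ _).trans ((he _).trans ?_)
            exact minTensorNorm_sliceMap_le π h m hm hmin _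
        _ = _ := by rw [q.star_mul_self']; ring
  obtain ⟨M, hM⟩ := hb
  rw [mul_comm]
  refine le_mul_of_sq_le_mul (φ := fun z => star z * z) (norm_nonneg v) q.nonneg
    q.star_mul_self' (K := fun z => ‖spatialRep π σ (j z) v‖) (fun z => ?_) hM z
  rw [hsq]
  exact norm_inner_le_norm (𝕜 := ℂ) (E := H ⊗[ℂ] K) _ _

end MinAssoc

/-- A C*-algebra with a dense *-subalgebra that is the image of `A ⊗ B` under a map bounded below by
the minimal norm is nuclear, if `A` and `B` are nuclear. -/
theorem IsNuclear.of_tensor (hA : IsNuclear A) (hB : IsNuclear B) (m : A ⊗[ℂ] B →⋆ₙₐ[ℂ] C)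
    (hm : DenseRange m) (hmin : ∀ x, tensorNorm A B .min x ≤ ‖m x‖)
    (hsub : ∀ a b, ‖m (a ⊗ₜ b)‖ ≤ ‖a‖ * ‖b‖) : IsNuclear C := by
  intro D _ X
  refine le_antisymm ?_ (min_le_max_tensorNorm X)
  refine le_of_le_on_dense m hm (tensorNorm_isSubcross .max) (tensorNorm_isSubcross .min)
    (fun x => ?_) X
  clear X
  set p := CStarSeminorm.comap (R := A ⊗[ℂ] (B ⊗[ℂ] D)) (S := C ⊗[ℂ] D)
    (tensorNorm C D .max) (assocMap m D) with hp
  have hpb : ∀ a b d, p (a ⊗ₜ (b ⊗ₜ d)) ≤ ‖a‖ * (‖b‖ * ‖d‖) := fun a b d => by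
    rw [hp, CStarSeminorm.comap_apply, assocMap_tmul, ← mul_assoc]
    exact (tensorNorm_isSubcross .max _ _).trans
      (mul_le_mul_of_nonneg_right (hsub a b) (norm_nonneg d))
  -- The chain is: the maximal norm of `C ⊗ D`, pulled back to `A ⊗ (B ⊗ D)`, lies below that of `A
  -- ⊗_max (B ⊗_max D)`; nuclearity of `B` and then of `A` turns both tensor products into minimal
  -- ones; associativity of the minimal norm leads back to `C ⊗_min D`.
  have hpm : ∀ z, p z ≤ tensorNorm C D .min (assocMap m D z) := by
    intro z
    obtain ⟨Φ, hΦ, hΦz⟩ := exists_extend_second_leg (A := A) (P := p.Alg) (tensorNorm B D .min).toAlgHom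
      (tensorNorm B D .min).denseRange_toAlg p.toAlgHom (fun a y => by
        rw [p.norm_toAlgHom, CStarSeminorm.norm_toAlgHom, ← hB D]
        exact le_norm_mul_max hpb a y)
    have h1 := le_maxTensorNorm (p := (CStarSeminorm.ofNorm p.Alg).comap Φ) hΦ
      (tensorMapHom (.id ℂ A) (tensorNorm B D .min).toAlgHom z)
    rw [CStarSeminorm.comap_apply, hΦz, CStarSeminorm.ofNorm_apply, p.norm_toAlgHom, hA] at h1
    exact h1.trans (minTensorNorm_assoc_le m hm hmin _
      (fun y => (CStarSeminorm.norm_toAlgHom _ _).le) z)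
  obtain ⟨z, hz⟩ : ∃ z, tensorAssocHom A B D z = x :=
    (TensorProduct.assoc ℂ A B D).symm.surjective x
  have := hpm z
  rw [← hz]
  exact this

end Nuclear

/-! ### The approximation property of tensor products -/

/-- Uniformly bounded linear maps that converge to the identity on a dense set converge to it
everywhere. -/
theorem tendsto_of_dense {ι V : Type*} [NormedAddCommGroup V] [NormedSpace ℂ V] {l : Filter ι}
    {T : ι → V →ₗ[ℂ] V} {M : ℝ} (hM : ∀ᶠ i in l, ∀ v, ‖T i v‖ ≤ M * ‖v‖) {s : Set V}
    (hs : Dense s) (h : ∀ v ∈ s, Filter.Tendsto (fun i => T i v) l (nhds v)) (v : V) :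
    Filter.Tendsto (fun i => T i v) l (nhds v) := by
  rw [Metric.tendsto_nhds]
  intro ε hε
  obtain ⟨w, hw, hvw⟩ := Metric.dense_iff.mp hs v (ε / (2 * (|M| + 2))) (by positivity)
  rw [Metric.mem_ball, lt_div_iff₀ (by positivity), dist_comm, dist_eq_norm] at hw
  filter_upwards [hM, Metric.tendsto_nhds.mp (h w hvw) (ε / (2 * (|M| + 2))) (by positivity)]
    with i h1 h2
  rw [lt_div_iff₀ (by positivity), dist_eq_norm] at h2
  have h3 : T i v - v = T i (v - w) + (T i w - w) - (v - w) := by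
    rw [map_sub]
    abel
  rw [dist_eq_norm, h3]
  refine (norm_sub_le _ _).trans_lt ?_
  have h4 := norm_add_le (T i (v - w)) (T i w - w)
  have h5 := (h1 (v - w)).trans (mul_le_mul_of_nonneg_right (le_abs_self M) (norm_nonneg _))
  nlinarith [abs_nonneg M, norm_nonneg (v - w), norm_nonneg (T i w - w)]

namespace FellBundle

variable {G : Type u} [Group G]

/-- An approximate unit of `B_e` acts as one on every fibre: `‖b e - b‖²` is controlled by `‖c e -
c‖` for `c = b* b` in the unit fibre, and the left-hand factor is handled by applying this to `b*`.
-/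
theorem exists_approximateUnit (B : FellBundle G) :
    ∃ (l : Filter (B.fiber 1)) (_ : l.NeBot), (∀ᶠ e in l, ‖e‖ ≤ 1) ∧
      ∀ g (b : B.fiber g), Filter.Tendsto
        (fun e => B.mulMap (mul_one g) (B.mulMap (one_mul g) (star e) b) e) l (nhds b) := by
  obtain ⟨l, hne, hl1, hl, -⟩ := _root_.exists_approximateUnit (B.fiber 1)
  -- The given filter has `e d → d`; passing to adjoints yields the right-hand version `d e → d`
  -- used below.
  have hl1' : ∀ᶠ e in l.map star, ‖e‖ ≤ 1 := by
    rw [Filter.eventually_map]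
    filter_upwards [hl1] with e he
    rwa [norm_star]
  have hl' : ∀ d : B.fiber 1, Filter.Tendsto (fun e => d * e) (l.map star) (nhds d) := fun d => by
    rw [Filter.tendsto_map'_iff]
    have := (hl (star d)).star
    simpa [Function.comp_def] using this
  have hr : ∀ {g h : G} (e' : g⁻¹ = h) (hg : h * g = 1) (b : B.fiber g), Filter.Tendsto
      (fun e => ‖B.toFull g b * B.toFull 1 e - B.toFull g b‖) (l.map star) (nhds 0) := by
    intro g h e' hg b
    set c := B.mulMap hg (B.starMap e' b) b with hc
    have hX : star (B.toFull g b) * B.toFull g b = B.toFull 1 c := by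
      rw [B.toFull_star e', B.toFull_mul hg]
    have h1 : Filter.Tendsto (fun e => √(2 * ‖c * e - c‖)) (l.map star) (nhds 0) := by
      have h2 := ((tendsto_iff_norm_sub_tendsto_zero.mp (hl' c)).const_mul 2).sqrt
      rwa [mul_zero, Real.sqrt_zero] at h2
    refine squeeze_zero' (Filter.Eventually.of_forall fun _ => norm_nonneg _) ?_ h1
    filter_upwards [hl1'] with e he
    refine Real.le_sqrt_of_sq_le ?_
    set X := B.toFull g b
    set E := B.toFull 1 e with hE
    have hE1 : ‖E‖ ≤ 1 := by rwa [hE, B.norm_toFull]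
    have hcE : ‖B.toFull 1 c * E - B.toFull 1 c‖ = ‖c * e - c‖ := by
      rw [hE, B.toFull_mul (one_mul 1), ← map_sub, B.norm_toFull]
      rfl
    rw [pow_two, ← CStarRing.norm_star_mul_self, ← hcE]
    have h3 : star (X * E - X) * (X * E - X) = star E * (B.toFull 1 c * E - B.toFull 1 c) -
        (B.toFull 1 c * E - B.toFull 1 c) := by
      rw [← hX, star_sub, star_mul]
      noncomm_ring
    rw [h3]
    refine (norm_sub_le _ _).trans ?_
    have h4 := norm_mul_le (star E) (B.toFull 1 c * E - B.toFull 1 c)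
    rw [norm_star] at h4
    nlinarith [norm_nonneg (B.toFull 1 c * E - B.toFull 1 c)]
  refine ⟨l.map star, inferInstance, hl1', fun g b => ?_⟩
  rw [tendsto_iff_norm_sub_tendsto_zero]
  have h1 := hr rfl (inv_mul_cancel g) b
  have h2 := hr (inv_inv g) (mul_inv_cancel g) (B.starMap rfl b)
  have h3 := h1.add h2
  rw [add_zero] at h3
  refine squeeze_zero' (Filter.Eventually.of_forall fun _ => norm_nonneg _) ?_ h3
  filter_upwards [hl1'] with e he
  rw [← B.norm_toFull g, map_sub, ← B.toFull_mul, ← B.toFull_mul, ← B.toFull_star rfl b,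
    show B.toFull 1 (star e) = star (B.toFull 1 e) from (B.toFull_star inv_one e).symm]
  set X := B.toFull g b
  set E := B.toFull 1 e with hE
  have hE1 : ‖E‖ ≤ 1 := by rwa [hE, B.norm_toFull]
  have h4 : star E * X * E - X = star E * (X * E - X) + star (star X * E - star X) := by
    rw [star_sub, star_mul, star_star]
    noncomm_ring
  rw [h4]
  refine (norm_add_le _ _).trans ?_
  rw [norm_star]
  have h5 := norm_mul_le (star E) (X * E - X)
  rw [norm_star] at h5
  nlinarith [norm_nonneg (X * E - X)]

/-- The approximation property passes to a Fell bundle in which the tensor product with some Fell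
bundle is dense. -/
theorem HasAP.of_tensor {𝒜 ℬ 𝒞 : FellBundle G} (hA : 𝒜.HasAP)
    (m : ∀ g, 𝒜.fiber g ⊗[ℂ] ℬ.fiber g →ₗ[ℂ] 𝒞.fiber g)
    (hmul : ∀ {g h k : G} (e : g * h = k) (a : 𝒜.fiber g) (b : ℬ.fiber g) (a' : 𝒜.fiber h)
      (b' : ℬ.fiber h), 𝒞.mulMap e (m g (a ⊗ₜ b)) (m h (a' ⊗ₜ b')) =
        m k (𝒜.mulMap e a a' ⊗ₜ ℬ.mulMap e b b'))
    (hstar : ∀ {g h : G} (e : g⁻¹ = h) (a : 𝒜.fiber g) (b : ℬ.fiber g),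
      𝒞.starMap e (m g (a ⊗ₜ b)) = m h (𝒜.starMap e a ⊗ₜ ℬ.starMap e b))
    (hm : ∀ g a b, ‖m g (a ⊗ₜ b)‖ ≤ ‖a‖ * ‖b‖) (hd : ∀ g, DenseRange (m g)) : 𝒞.HasAP := by
  obtain ⟨l, hne, M, hM, hl⟩ := hA.exists_filter
  obtain ⟨l', hne', hl1, hl'⟩ := ℬ.exists_approximateUnit
  -- The new functions are `ξ(g) ⊗ e`. On elementary tensors Exel's sum then factors as `(∑ ξ(gh)* a
  -- ξ(h)) ⊗ e* b e`.
  let ζ : (G →₀ 𝒜.fiber 1) × ℬ.fiber 1 → (G →₀ 𝒞.fiber 1) := fun p =>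
    p.1.mapRange (fun a => m 1 (a ⊗ₜ p.2)) (by rw [TensorProduct.zero_tmul, map_zero])
  have hζ : ∀ p g, ζ p g = m 1 (p.1 g ⊗ₜ p.2) := fun p g => Finsupp.mapRange_apply ..
  have hmul1 : ∀ a b a' b', m 1 (a ⊗ₜ b) * m 1 (a' ⊗ₜ b') = m 1 ((a * a') ⊗ₜ (b * b')) :=
    fun a b a' b' => hmul (one_mul 1) a b a' b'
  have hstar1 : ∀ a b, star (m 1 (a ⊗ₜ b)) = m 1 (star a ⊗ₜ star b) :=
    fun a b => hstar inv_one a b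
  have hsum : ∀ p, (ζ p).sum (fun _ c => star c * c) =
      m 1 ((p.1.sum fun _ a => star a * a) ⊗ₜ (star p.2 * p.2)) := by
    intro p
    rw [Finsupp.sum_mapRange_index (fun _ => by rw [mul_zero]), Finsupp.sum, Finsupp.sum,
      TensorProduct.sum_tmul, map_sum]
    refine Finset.sum_congr rfl fun h _ => ?_
    rw [hstar1, hmul1]
  have hap : ∀ p g a b, 𝒞.apMap (ζ p) g (m g (a ⊗ₜ b)) = m g (𝒜.apMap p.1 g a ⊗ₜ
      ℬ.mulMap (mul_one g) (ℬ.mulMap (one_mul g) (star p.2) b) p.2) := by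
    intro p g a b
    rw [apMap_apply, apMap_apply, Finsupp.sum_mapRange_index (fun _ => by rw [map_zero]),
      Finsupp.sum, Finsupp.sum, TensorProduct.sum_tmul, map_sum]
    refine Finset.sum_congr rfl fun h _ => ?_
    rw [hζ, hstar1, hmul, hmul]
  have hbound : ∀ᶠ p in l ×ˢ l', ‖(ζ p).sum fun _ c => star c * c‖ ≤ M := by
    filter_upwards [hM.prod_mk hl1] with p hp
    rw [hsum]
    refine (hm _ _ _).trans ?_
    rw [CStarRing.norm_star_mul_self]
    have h1 := norm_nonneg p.2
    have h2 := norm_nonneg (p.1.sum fun _ a => star a * a)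
    calc _ ≤ ‖p.1.sum fun _ a => star a * a‖ * 1 :=
          mul_le_mul_of_nonneg_left (mul_le_one₀ hp.2 h1 hp.2) h2
      _ ≤ M := by rw [mul_one]; exact hp.1
  refine 𝒞.hasAP_of_filter (Filter.map ζ (l ×ˢ l')) M (Filter.eventually_map.mpr hbound)
    fun g => ?_
  refine fun c => Filter.tendsto_map'_iff.mpr ?_
  -- Convergence on the algebraic tensor product extends to the whole fibre because `norm_apMap_le`
  -- bounds the maps uniformly.
  refine tendsto_of_dense (T := fun p => 𝒞.apMap (ζ p) g) (M := M) ?_ (hd g) ?_ c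
  · filter_upwards [hbound] with p hp v
    exact (𝒞.norm_apMap_le _ _ _).trans (mul_le_mul_of_nonneg_right hp (norm_nonneg v))
  · rintro _ ⟨x, rfl⟩
    induction x with
    | zero => simp
    | add x y hx hy => simpa only [map_add] using hx.add hy
    | tmul a b =>
      simp only [hap]
      let β : 𝒜.fiber g →L[ℂ] ℬ.fiber g →L[ℂ] 𝒞.fiber g :=
        LinearMap.mkContinuous₂ ((TensorProduct.mk ℂ _ _).compr₂ (m g)) 1
          (fun a b => by rw [one_mul]; exact hm g a b)
      exact (β.continuous₂.tendsto (a, b)).comp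
        (((hl g a).comp Filter.tendsto_fst).prodMk_nhds ((hl' g b).comp Filter.tendsto_snd))

end FellBundle

/-! ### Tensor products of Fell bundles -/

theorem min_le_tensorNorm {A B : Type u} [NonUnitalCStarAlgebra A] [NonUnitalCStarAlgebra B]
    (μ : TensorKind) (x : A ⊗[ℂ] B) : tensorNorm A B .min x ≤ tensorNorm A B μ x := by
  cases μ
  · exact min_le_max_tensorNorm x
  · exact le_rfl

namespace FellBundle

variable {G : Type u} [Group G] (μ : TensorKind) (𝒜 ℬ : FellBundle G)

theorem denseRange_tensorMk (g : G) : DenseRange (tensorMk μ 𝒜 ℬ g) := by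
  refine Subtype.dense_iff (s := (tensorFiber μ 𝒜 ℬ g : Set (CStarTensor 𝒜.FullAlg ℬ.FullAlg μ))).mpr fun x hx => ?_
  refine closure_mono ?_ hx
  rintro _ ⟨y, rfl⟩
  exact ⟨_, ⟨y, rfl⟩, rfl⟩

theorem norm_tensorMk_tmul_le (g : G) (a : 𝒜.fiber g) (b : ℬ.fiber g) :
    ‖tensorMk μ 𝒜 ℬ g (a ⊗ₜ b)‖ ≤ ‖a‖ * ‖b‖ := by
  rw [← 𝒜.norm_toFull g a, ← ℬ.norm_toFull g b]
  change ‖(tensorNorm _ _ μ).toAlg (𝒜.toFull g a ⊗ₜ ℬ.toFull g b)‖ ≤ _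
  rw [CStarSeminorm.norm_toAlg]
  exact tensorNorm_isSubcross μ _ _

/-- The canonical map of the tensor product of the unit fibres as a *-homomorphism. -/
def tensorMkOne : 𝒜.fiber 1 ⊗[ℂ] ℬ.fiber 1 →⋆ₙₐ[ℂ] (tensor μ 𝒜 ℬ).fiber 1 :=
  tensorStarHom (tensorMk μ 𝒜 ℬ 1)
    (fun a b a' b' => (tensorMk_mul μ 𝒜 ℬ (one_mul 1) a b a' b').symm)
    (fun a b => (tensorMk_star μ 𝒜 ℬ inv_one a b).symm)

variable {𝒜}

theorem HasAP.tensor (hA : 𝒜.HasAP) : (tensor μ 𝒜 ℬ).HasAP :=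
  hA.of_tensor (tensorMk μ 𝒜 ℬ) (tensorMk_mul μ 𝒜 ℬ) (tensorMk_star μ 𝒜 ℬ)
    (norm_tensorMk_tmul_le μ 𝒜 ℬ) (denseRange_tensorMk μ 𝒜 ℬ)

variable {ℬ}

theorem isNuclear_tensor_fiber_one (hA : IsNuclear (𝒜.fiber 1)) (hB : IsNuclear (ℬ.fiber 1)) :
    IsNuclear ((FellBundle.tensor μ 𝒜 ℬ).fiber 1) := by
  refine IsNuclear.of_tensor hA hB (tensorMkOne μ 𝒜 ℬ) (denseRange_tensorMk μ 𝒜 ℬ 1)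
    (fun x => ?_) (norm_tensorMk_tmul_le μ 𝒜 ℬ 1)
  change _ ≤ ‖tensorMk μ 𝒜 ℬ 1 x‖
  rw [norm_tensorMk_one]
  exact min_le_tensorNorm μ x

end FellBundle

/-! ### Diagonal partial actions -/

namespace PartialAction

variable {G A B : Type u} [Group G] [NonUnitalCStarAlgebra A] [NonUnitalCStarAlgebra B]

section Bundle

variable (α : PartialAction G A)

/-- The map `a δ_g ↦ a`. -/
def val (g : G) : α.bundle.fiber g →ₗ[ℂ] A where
  toFun a := (show α.dom g from a).1
  map_add' _ _ := rfl
  map_smul' _ _ := rfl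

theorem val_mem (g : G) (a : α.bundle.fiber g) : α.val g a ∈ α.dom g :=
  (show α.dom g from a).2

theorem val_injective (g : G) : Function.Injective (α.val g) := Subtype.val_injective

theorem exists_val_eq {g : G} {a : A} (ha : a ∈ α.dom g) : ∃ b, α.val g b = a := ⟨⟨a, ha⟩, rfl⟩

theorem norm_val (g : G) (a : α.bundle.fiber g) : ‖α.val g a‖ = ‖a‖ := rfl

theorem val_mulMap {g h k : G} (e : g * h = k) (a : α.bundle.fiber g) (b : α.bundle.fiber h) :
    α.val k (α.bundle.mulMap e a b) = α.app g (α.app g⁻¹ (α.val g a) * α.val h b) := rfl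

theorem val_starMap {g h : G} (e : g⁻¹ = h) (a : α.bundle.fiber g) :
    α.val h (α.bundle.starMap e a) = α.app g⁻¹ (star (α.val g a)) := rfl

/-- The map `a δ_{g⁻¹} ↦ α_g(a)`. -/
def actVal (g : G) : α.bundle.fiber g⁻¹ →ₗ[ℂ] A where
  toFun a := α.app g (α.val g⁻¹ a)
  map_add' a b := by rw [map_add, α.app_add (α.val_mem _ a) (α.val_mem _ b)]
  map_smul' c a := by rw [map_smul, α.app_smul c (α.val_mem _ a), RingHom.id_apply]

theorem actVal_apply (g : G) (a : α.bundle.fiber g⁻¹) : α.actVal g a = α.app g (α.val g⁻¹ a) := rfl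

theorem val_mulMap_starMap {g : G} (a b : α.bundle.fiber g) :
    α.val 1 (α.bundle.mulMap (mul_inv_cancel g) a (α.bundle.starMap rfl b)) =
      α.val g a * star (α.val g b) := by
  have ha := α.val_mem g a
  have hb := α.val_mem g b
  rw [val_mulMap, val_starMap, ← α.app_mul (by rwa [inv_inv]) (by rw [inv_inv]; exact star_mem hb),
    α.app_app_inv (mul_mem ha (star_mem hb))]

/-- While `X Y*` for `X = a δ_{g⁻¹}` and `Y = b δ_{g⁻¹}` is computed without the action
(`val_mulMap_starMap`), the product `X* Y` in the other order involves `α_g`. Comparing the two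
orders makes the action visible to the norm. -/
theorem val_starMap_mulMap {g : G} (a b : α.bundle.fiber g⁻¹) :
    α.val 1 (α.bundle.mulMap (mul_inv_cancel g) (α.bundle.starMap (inv_inv g) a) b) =
      star (α.actVal g a) * α.actVal g b := by
  have ha := α.val_mem g⁻¹ a
  have hb := α.val_mem g⁻¹ b
  rw [val_mulMap, val_starMap, inv_inv, actVal_apply, actVal_apply, ← α.app_star ha,
    α.app_app (inv_mul_cancel g) (star_mem ha) (by rw [inv_one]; exact α.mem_dom_one _), α.app_one,
    α.app_mul (star_mem ha) hb]

/-- The unit fibre of the semidirect product bundle is `A`. -/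
def valOneHom : α.bundle.fiber 1 →⋆ₙₐ[ℂ] A where
  toFun := α.val 1
  map_smul' := map_smul _
  map_zero' := map_zero _
  map_add' := map_add _
  map_mul' a b := by
    rw [FellBundle.unit_mul_def, val_mulMap, inv_one, α.app_one, α.app_one]
  map_star' a := by
    rw [FellBundle.unit_star_def, val_starMap, inv_one, α.app_one]

/-- The element `a δ_1`. -/
def oneVal (a : A) : α.bundle.fiber 1 := (⟨a, α.mem_dom_one a⟩ : α.dom 1)

/-- The unit fibre of the semidirect product bundle is `A`. -/
def oneValHom : A →⋆ₙₐ[ℂ] α.bundle.fiber 1 where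
  toFun := α.oneVal
  map_smul' _ _ := rfl
  map_zero' := rfl
  map_add' _ _ := rfl
  map_mul' a b := α.val_injective 1 (map_mul α.valOneHom (α.oneVal a) (α.oneVal b)).symm
  map_star' a := α.val_injective 1 (map_star α.valOneHom (α.oneVal a)).symm

end Bundle

section Norm

variable (α : PartialAction G A) (β : PartialAction G B) (μ : TensorKind)

theorem tensorNorm_val_one (y : α.bundle.fiber 1 ⊗[ℂ] β.bundle.fiber 1) :
    tensorNorm A B μ (TensorProduct.map (α.val 1) (β.val 1) y) =
      tensorNorm (α.bundle.fiber 1) (β.bundle.fiber 1) μ y := by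
  refine le_antisymm (tensorNorm_map_le μ α.valOneHom β.valOneHom y) ?_
  have h := tensorNorm_map_le μ α.oneValHom β.oneValHom (tensorMapHom α.valOneHom β.valOneHom y)
  have h2 : tensorMapHom α.oneValHom β.oneValHom (tensorMapHom α.valOneHom β.valOneHom y) = y := by
    clear h
    induction y with
    | zero => simp
    | add x y hx hy =>
      rw [map_add (tensorMapHom α.valOneHom β.valOneHom),
        map_add (tensorMapHom α.oneValHom β.oneValHom), hx, hy]
    | tmul a b => rfl
  rwa [h2] at h

theorem exists_tensorIncl_mul_star {g : G} (x y : α.bundle.fiber g ⊗[ℂ] β.bundle.fiber g) :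
    ∃ z, FellBundle.tensorIncl μ α.bundle β.bundle g x *
        star (FellBundle.tensorIncl μ α.bundle β.bundle g y) =
          FellBundle.tensorIncl μ α.bundle β.bundle 1 z ∧
      TensorProduct.map (α.val 1) (β.val 1) z =
        TensorProduct.map (α.val g) (β.val g) x * star (TensorProduct.map (α.val g) (β.val g) y) := by
  induction x with
  | zero => exact ⟨0, by simp⟩
  | add x x' h h' =>
    obtain ⟨z, hz, hz'⟩ := h
    obtain ⟨w, hw, hw'⟩ := h'
    exact ⟨z + w, by simp only [map_add, add_mul, hz, hw], by simp only [map_add, add_mul, hz', hw']⟩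
  | tmul a b =>
    induction y with
    | zero => exact ⟨0, by simp⟩
    | add x x' h h' =>
      obtain ⟨z, hz, hz'⟩ := h
      obtain ⟨w, hw, hw'⟩ := h'
      exact ⟨z + w, by simp only [map_add, star_add, mul_add, hz, hw],
        by simp only [map_add, star_add, mul_add, hz', hw']⟩
    | tmul a' b' =>
      refine ⟨_, (congrArg _ (FellBundle.tensorIncl_star μ α.bundle β.bundle rfl a' b')).trans
        (FellBundle.tensorIncl_mul μ α.bundle β.bundle (mul_inv_cancel g) _ _ _ _), ?_⟩
      simp only [TensorProduct.map_tmul, val_mulMap_starMap, TensorProduct.star_tmul,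
        Algebra.TensorProduct.tmul_mul_tmul]

theorem exists_star_mul_tensorIncl {g : G} (x y : α.bundle.fiber g⁻¹ ⊗[ℂ] β.bundle.fiber g⁻¹) :
    ∃ z, star (FellBundle.tensorIncl μ α.bundle β.bundle g⁻¹ x) *
        FellBundle.tensorIncl μ α.bundle β.bundle g⁻¹ y =
          FellBundle.tensorIncl μ α.bundle β.bundle 1 z ∧
      TensorProduct.map (α.val 1) (β.val 1) z =
        star (TensorProduct.map (α.actVal g) (β.actVal g) x) *
          TensorProduct.map (α.actVal g) (β.actVal g) y := by
  induction x with
  | zero => exact ⟨0, by simp⟩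
  | add x x' h h' =>
    obtain ⟨z, hz, hz'⟩ := h
    obtain ⟨w, hw, hw'⟩ := h'
    exact ⟨z + w, by simp only [map_add, star_add, add_mul, hz, hw],
      by simp only [map_add, star_add, add_mul, hz', hw']⟩
  | tmul a b =>
    induction y with
    | zero => exact ⟨0, by simp⟩
    | add x x' h h' =>
      obtain ⟨z, hz, hz'⟩ := h
      obtain ⟨w, hw, hw'⟩ := h'
      exact ⟨z + w, by simp only [map_add, mul_add, hz, hw],
        by simp only [map_add, mul_add, hz', hw']⟩
    | tmul a' b' =>
      refine ⟨_, (congrArg (· * _)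
        (FellBundle.tensorIncl_star μ α.bundle β.bundle (inv_inv g) a b)).trans
        (FellBundle.tensorIncl_mul μ α.bundle β.bundle (mul_inv_cancel g) _ _ _ _), ?_⟩
      simp only [TensorProduct.map_tmul, val_starMap_mulMap, TensorProduct.star_tmul,
        Algebra.TensorProduct.tmul_mul_tmul]

theorem norm_tensorIncl_one (z : α.bundle.fiber 1 ⊗[ℂ] β.bundle.fiber 1) :
    ‖FellBundle.tensorIncl μ α.bundle β.bundle 1 z‖ =
      tensorNorm A B μ (TensorProduct.map (α.val 1) (β.val 1) z) :=
  (FellBundle.norm_tensorMk_one μ α.bundle β.bundle z).trans (tensorNorm_val_one α β μ z).symm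

/-- Both norms are determined by `x x*`, which lies in the unit fibre, where the norm of the bundle
is that of `A ⊗_μ B`. -/
theorem tensorNorm_val {g : G} (x : α.bundle.fiber g ⊗[ℂ] β.bundle.fiber g) :
    tensorNorm A B μ (TensorProduct.map (α.val g) (β.val g) x) =
      ‖FellBundle.tensorIncl μ α.bundle β.bundle g x‖ := by
  obtain ⟨z, hz, hz'⟩ := exists_tensorIncl_mul_star α β μ x x
  refine (mul_self_inj_of_nonneg (CStarSeminorm.nonneg _ _) (norm_nonneg _)).mp ?_
  rw [← CStarRing.norm_self_mul_star, hz, norm_tensorIncl_one, hz', CStarSeminorm.mul_star_self]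

/-- For the element `X` of the fibre at `g⁻¹` given by `x`, `X X*` computes the norm of `x` and `X*
X` that of `(α_g ⊗ β_g)(x)`. In a C*-algebra both products have norm `‖X‖²`, so the two norms agree,
for `max` as well as for `min`. -/
theorem tensorNorm_actVal {g : G} (x : α.bundle.fiber g⁻¹ ⊗[ℂ] β.bundle.fiber g⁻¹) :
    tensorNorm A B μ (TensorProduct.map (α.actVal g) (β.actVal g) x) =
      tensorNorm A B μ (TensorProduct.map (α.val g⁻¹) (β.val g⁻¹) x) := by
  obtain ⟨z, hz, hz'⟩ := exists_star_mul_tensorIncl α β μ x x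
  rw [tensorNorm_val]
  refine (mul_self_inj_of_nonneg (CStarSeminorm.nonneg _ _) (norm_nonneg _)).mp ?_
  rw [← CStarRing.norm_star_mul_self, hz, norm_tensorIncl_one, hz']
  exact ((tensorNorm A B μ).star_mul_self' _).symm

end Norm

end PartialAction

/-- A bounded map that is linear on a subspace `N` and maps `s ⊆ N` into a closed subspace `M` maps
the elements of `N` in the closed linear span of `s` into `M`. -/
theorem map_mem_of_mem_closure_span {V W : Type*} [NormedAddCommGroup V] [NormedSpace ℂ V]
    [NormedAddCommGroup W] [NormedSpace ℂ W] {f : V → W}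
    {N : Submodule ℂ V} {M : Submodule ℂ W} (hM : IsClosed (M : Set W)) {K : ℝ}
    (hadd : ∀ x ∈ N, ∀ y ∈ N, f (x + y) = f x + f y)
    (hsmul : ∀ (c : ℂ), ∀ x ∈ N, f (c • x) = c • f x) (hb : ∀ x ∈ N, ‖f x‖ ≤ K * ‖x‖)
    {s : Set V} (hs : s ⊆ N) (h : ∀ x ∈ s, f x ∈ M) {x : V}
    (hx : x ∈ closure (Submodule.span ℂ s : Set V)) (hxN : x ∈ N) : f x ∈ M := by
  have hspan : ∀ y ∈ Submodule.span ℂ s, y ∈ N ∧ f y ∈ M := by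
    intro y hy
    induction hy using Submodule.span_induction with
    | mem y hy => exact ⟨hs hy, h y hy⟩
    | zero =>
      refine ⟨zero_mem _, ?_⟩
      have := hsmul 0 0 (zero_mem _)
      rw [zero_smul, zero_smul] at this
      rw [this]
      exact zero_mem _
    | add y z _ _ hy hz =>
      exact ⟨add_mem hy.1 hz.1, by rw [hadd _ hy.1 _ hz.1]; exact add_mem hy.2 hz.2⟩
    | smul c y _ hy => exact ⟨N.smul_mem c hy.1, by rw [hsmul c _ hy.1]; exact M.smul_mem c hy.2⟩
  rw [← SetLike.mem_coe, ← hM.closure_eq, Metric.mem_closure_iff]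
  intro ε hε
  obtain ⟨y, hy, hxy⟩ := Metric.mem_closure_iff.mp hx (ε / (|K| + 1)) (by positivity)
  obtain ⟨hyN, hyM⟩ := hspan y hy
  refine ⟨f y, hyM, ?_⟩
  rw [lt_div_iff₀ (by positivity), dist_eq_norm] at hxy
  have h1 : f x = f (x - y) + f y := by rw [← hadd _ (sub_mem hxN hyN) _ hyN, sub_add_cancel]
  rw [dist_eq_norm, h1, add_sub_cancel_right]
  have h2 := (hb _ (sub_mem hxN hyN)).trans
    (mul_le_mul_of_nonneg_right (le_abs_self K) (norm_nonneg (x - y)))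
  nlinarith [norm_nonneg (x - y)]

/-- Two bounded maps that are linear on a subspace `N` and coincide on `s ⊆ N` coincide on the
elements of `N` in the closed linear span of `s`. -/
theorem eq_of_mem_closure_span {V W : Type*} [NormedAddCommGroup V] [NormedSpace ℂ V]
    [NormedAddCommGroup W] [NormedSpace ℂ W] {f g : V → W} {N : Submodule ℂ V}
    (hadd : ∀ x ∈ N, ∀ y ∈ N, f (x + y) = f x + f y)
    (hsmul : ∀ (c : ℂ), ∀ x ∈ N, f (c • x) = c • f x) (hb : ∀ x ∈ N, ‖f x‖ ≤ ‖x‖)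
    (hadd' : ∀ x ∈ N, ∀ y ∈ N, g (x + y) = g x + g y)
    (hsmul' : ∀ (c : ℂ), ∀ x ∈ N, g (c • x) = c • g x) (hb' : ∀ x ∈ N, ‖g x‖ ≤ ‖x‖)
    {s : Set V} (hs : s ⊆ N) (h : ∀ x ∈ s, f x = g x) {x : V}
    (hx : x ∈ closure (Submodule.span ℂ s : Set V)) (hxN : x ∈ N) : f x = g x := by
  have key := map_mem_of_mem_closure_span (f := fun x => f x - g x) (N := N)
    (M := (⊥ : Submodule ℂ W)) (K := 2) isClosed_singleton
    (fun x hx y hy => by rw [hadd x hx y hy, hadd' x hx y hy]; abel)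
    (fun c x hx => by rw [hsmul c x hx, hsmul' c x hx, smul_sub])
    (fun x hx => (norm_sub_le _ _).trans (by linarith [hb x hx, hb' x hx])) hs
    (fun x hx => by rw [Submodule.mem_bot, sub_eq_zero]; exact h x hx) hx hxN
  exact sub_eq_zero.mp key

/-! ### Closed spans of elementary tensors -/

section Elementary

variable {A B : Type u} [NonUnitalCStarAlgebra A] [NonUnitalCStarAlgebra B] {μ : TensorKind}

theorem CStarTensor.mk_mul (a a' : A) (b b' : B) :
    CStarTensor.mk μ a b * CStarTensor.mk μ a' b' = CStarTensor.mk μ (a * a') (b * b') := by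
  rw [CStarTensor.mk, CStarTensor.mk, ← CStarSeminorm.toAlg_mul,
    Algebra.TensorProduct.tmul_mul_tmul]
  rfl

theorem CStarTensor.star_mk (a : A) (b : B) :
    star (CStarTensor.mk μ a b) = CStarTensor.mk μ (star a) (star b) := by
  rw [CStarTensor.mk, ← CStarSeminorm.toAlg_star, TensorProduct.star_tmul]
  rfl

theorem CStarTensor.norm_mk_le (a : A) (b : B) : ‖CStarTensor.mk μ a b‖ ≤ ‖a‖ * ‖b‖ := by
  rw [CStarTensor.mk, CStarSeminorm.norm_toAlg]
  exact tensorNorm_isSubcross μ a b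

variable (μ) in
/-- The closed linear span of the elements `a ⊗ b` with `a ∈ S` and `b ∈ T`. -/
def closedSpanTensor (S : Set A) (T : Set B) : Submodule ℂ (CStarTensor A B μ) :=
  (Submodule.span ℂ {x | ∃ a ∈ S, ∃ b ∈ T, x = CStarTensor.mk μ a b}).topologicalClosure

theorem mk_mem_closedSpanTensor {S : Set A} {T : Set B} {a : A} {b : B} (ha : a ∈ S) (hb : b ∈ T) :
    CStarTensor.mk μ a b ∈ closedSpanTensor μ S T :=
  Submodule.le_topologicalClosure _ (Submodule.subset_span ⟨a, ha, b, hb, rfl⟩)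

theorem closedSpanTensor_mono {S S' : Set A} {T T' : Set B} (hS : S ⊆ S') (hT : T ⊆ T') :
    closedSpanTensor μ S T ≤ closedSpanTensor μ S' T' :=
  Submodule.topologicalClosure_mono (Submodule.span_mono
    fun _ ⟨a, ha, b, hb, h⟩ => ⟨a, hS ha, b, hT hb, h⟩)

theorem mul_mem_closedSpanTensor {S S' S'' : Set A} {T T' T'' : Set B}
    (hS : ∀ a ∈ S, ∀ a' ∈ S', a * a' ∈ S'') (hT : ∀ b ∈ T, ∀ b' ∈ T', b * b' ∈ T'')
    {x y : CStarTensor A B μ} (hx : x ∈ closedSpanTensor μ S T)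
    (hy : y ∈ closedSpanTensor μ S' T') : x * y ∈ closedSpanTensor μ S'' T'' := by
  refine map_mem_closure₂ continuous_mul hx hy fun x hx y hy => ?_
  rw [SetLike.mem_coe] at hx hy
  induction hx, hy using Submodule.span_induction₂ with
  | mem_mem x y hx hy =>
    obtain ⟨a, ha, b, hb, rfl⟩ := hx
    obtain ⟨a', ha', b', hb', rfl⟩ := hy
    exact Submodule.subset_span ⟨_, hS a ha a' ha', _, hT b hb b' hb', CStarTensor.mk_mul ..⟩
  | zero_left => rw [zero_mul]; exact zero_mem _
  | zero_right => rw [mul_zero]; exact zero_mem _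
  | add_left _ _ _ _ _ _ h h' => rw [add_mul]; exact add_mem h h'
  | add_right _ _ _ _ _ _ h h' => rw [mul_add]; exact add_mem h h'
  | smul_left c x y _ _ h => rw [smul_mul_assoc]; exact Submodule.smul_mem _ c h
  | smul_right c x y _ _ h => rw [mul_smul_comm]; exact Submodule.smul_mem _ c h

theorem star_mem_closedSpanTensor {S : Set A} {T : Set B} (hS : ∀ a ∈ S, star a ∈ S)
    (hT : ∀ b ∈ T, star b ∈ T) {x : CStarTensor A B μ} (hx : x ∈ closedSpanTensor μ S T) :
    star x ∈ closedSpanTensor μ S T := by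
  refine map_mem_closure continuous_star hx fun x hx => ?_
  rw [SetLike.mem_coe] at hx
  induction hx using Submodule.span_induction with
  | mem x hx =>
    obtain ⟨a, ha, b, hb, rfl⟩ := hx
    exact Submodule.subset_span ⟨_, hS a ha, _, hT b hb, CStarTensor.star_mk ..⟩
  | zero => rw [star_zero]; exact zero_mem _
  | add x y _ _ h h' => rw [star_add]; exact add_mem h h'
  | smul c x _ h => rw [star_smul]; exact Submodule.smul_mem _ _ h

theorem mem_closedSpanTensor_univ (x : CStarTensor A B μ) :
    x ∈ closedSpanTensor μ Set.univ Set.univ := by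
  refine closure_mono ?_ ((tensorNorm A B μ).denseRange_toAlg x)
  rintro _ ⟨y, rfl⟩
  rw [SetLike.mem_coe]
  induction y with
  | zero => rw [map_zero]; exact zero_mem _
  | add x y h h' => rw [map_add]; exact add_mem h h'
  | tmul a b => exact Submodule.subset_span ⟨a, trivial, b, trivial, rfl⟩

/-- For *-subalgebras `I`, `J`, the closed *-subalgebra `I ⊗_μ J`. -/
def closedTensor (μ : TensorKind) (I : NonUnitalStarSubalgebra ℂ A)
    (J : NonUnitalStarSubalgebra ℂ B) : NonUnitalStarSubalgebra ℂ (CStarTensor A B μ) where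
  carrier := closedSpanTensor μ (I : Set A) (J : Set B)
  add_mem' := add_mem
  zero_mem' := zero_mem _
  smul_mem' c _ h := Submodule.smul_mem _ c h
  mul_mem' h h' := mul_mem_closedSpanTensor (fun _ h _ h' => mul_mem h h')
    (fun _ h _ h' => mul_mem h h') h h'
  star_mem' h := star_mem_closedSpanTensor (fun _ h => star_mem h) (fun _ h => star_mem h) h

theorem isClosed_closedTensor (I : NonUnitalStarSubalgebra ℂ A) (J : NonUnitalStarSubalgebra ℂ B) :
    IsClosed (closedTensor μ I J : Set (CStarTensor A B μ)) :=
  Submodule.isClosed_topologicalClosure _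

theorem mem_closedTensor {I : NonUnitalStarSubalgebra ℂ A} {J : NonUnitalStarSubalgebra ℂ B}
    {x : CStarTensor A B μ} :
    x ∈ closedTensor μ I J ↔ x ∈ closedSpanTensor μ (I : Set A) (J : Set B) := Iff.rfl

/-- The C*-algebra `I ⊗_μ J` has an approximate unit, so `x` is a limit of products `e x`, whose
factors are approximated by sums of elementary tensors from `I`, `J` and from `S`, `T`. -/
theorem closedSpanTensor_of_mem_of_mem {I : NonUnitalStarSubalgebra ℂ A}
    {J : NonUnitalStarSubalgebra ℂ B} {S S' : Set A} {T T' : Set B}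
    (hS : ∀ a ∈ I, ∀ a' ∈ S, a * a' ∈ S') (hT : ∀ b ∈ J, ∀ b' ∈ T, b * b' ∈ T')
    {x : CStarTensor A B μ} (hx : x ∈ closedTensor μ I J) (hx' : x ∈ closedSpanTensor μ S T) :
    x ∈ closedSpanTensor μ S' T' := by
  have := isClosed_closedTensor (μ := μ) I J
  obtain ⟨l, _, -, hl, -⟩ := exists_approximateUnit (closedTensor μ I J)
  refine (Submodule.isClosed_topologicalClosure _).mem_of_tendsto
    ((continuous_subtype_val.tendsto _).comp (hl ⟨x, hx⟩)) (Filter.Eventually.of_forall fun e => ?_)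
  exact mul_mem_closedSpanTensor hS hT (mem_closedTensor.mp e.2) hx'

end Elementary

/-! ### Construction of the diagonal partial action -/

namespace PartialAction

variable {G A B : Type u} [Group G] [NonUnitalCStarAlgebra A] [NonUnitalCStarAlgebra B]
  (α : PartialAction G A) (β : PartialAction G B) (μ : TensorKind)

/-- The ideal `A_g ⊗_μ B_g`. -/
def diagDom (g : G) : NonUnitalStarSubalgebra ℂ (CStarTensor A B μ) :=
  closedTensor μ (α.dom g) (β.dom g)

instance (g : G) : IsClosed (diagDom α β μ g : Set (CStarTensor A B μ)) :=
  isClosed_closedTensor _ _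

variable {α β μ} in
theorem mk_mem_diagDom {g : G} {a : A} {b : B} (ha : a ∈ α.dom g) (hb : b ∈ β.dom g) :
    CStarTensor.mk μ a b ∈ diagDom α β μ g := mk_mem_closedSpanTensor ha hb

/-- The canonical map `A_g ⊗ B_g → A_g ⊗_μ B_g`. -/
def diagMk (g : G) : α.bundle.fiber g ⊗[ℂ] β.bundle.fiber g →ₗ[ℂ] diagDom α β μ g :=
  ((tensorNorm A B μ).toAlg ∘ₗ TensorProduct.map (α.val g) (β.val g)).codRestrict
    (diagDom α β μ g).toSubmodule fun x => by
      induction x with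
      | zero => rw [map_zero]; exact zero_mem _
      | add x y h h' => rw [map_add]; exact add_mem h h'
      | tmul a b => exact mk_mem_diagDom (α.val_mem g a) (β.val_mem g b)

theorem denseRange_diagMk (g : G) : DenseRange (diagMk α β μ g) := by
  refine Subtype.dense_iff.mpr fun x hx => closure_mono ?_ hx
  intro y hy
  rw [SetLike.mem_coe] at hy
  suffices h : Submodule.span ℂ {x | ∃ a ∈ α.dom g, ∃ b ∈ β.dom g, x = CStarTensor.mk μ a b} ≤
      LinearMap.range ((diagDom α β μ g).toSubmodule.subtype ∘ₗ diagMk α β μ g) by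
    obtain ⟨z, rfl⟩ := h hy
    exact ⟨_, ⟨z, rfl⟩, rfl⟩
  refine Submodule.span_le.mpr ?_
  rintro _ ⟨a, ha, b, hb, rfl⟩
  obtain ⟨a, rfl⟩ := α.exists_val_eq ha
  obtain ⟨b, rfl⟩ := β.exists_val_eq hb
  exact ⟨a ⊗ₜ b, rfl⟩

end PartialAction

namespace PartialAction

variable {G A B : Type u} [Group G] [NonUnitalCStarAlgebra A] [NonUnitalCStarAlgebra B]
  (α : PartialAction G A) (β : PartialAction G B) (μ : TensorKind)

/-- The canonical map `A_g ⊗ B_g → A_g ⊗_μ B_g` as a *-homomorphism. -/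
def diagMkHom (g : G) : α.dom g ⊗[ℂ] β.dom g →⋆ₙₐ[ℂ] diagDom α β μ g :=
  tensorStarHom (diagMk α β μ g)
    (fun a b a' b' => Subtype.ext (CStarTensor.mk_mul (μ := μ) (a : A) (a' : A) (b : B) b').symm)
    (fun a b => Subtype.ext (CStarTensor.star_mk (μ := μ) (a : A) (b : B)).symm)

theorem actVal_mul (g : G) (a a' : α.dom g⁻¹) :
    α.actVal g (a * a' : α.dom g⁻¹) = α.actVal g a * α.actVal g a' := α.app_mul a.2 a'.2

theorem actVal_star (g : G) (a : α.dom g⁻¹) :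
    α.actVal g (star a : α.dom g⁻¹) = star (α.actVal g a) := α.app_star a.2

/-- The map `α_g ⊗ β_g` on the algebraic tensor product. -/
def diagActHom (g : G) : α.dom g⁻¹ ⊗[ℂ] β.dom g⁻¹ →⋆ₙₐ[ℂ] CStarTensor A B μ :=
  tensorStarHom ((tensorNorm A B μ).toAlg ∘ₗ TensorProduct.map (α.actVal g) (β.actVal g))
    (fun a b a' b' => by
      change CStarTensor.mk μ (α.actVal g _) (β.actVal g _) =
        CStarTensor.mk μ (α.actVal g a) (β.actVal g b) *
          CStarTensor.mk μ (α.actVal g a') (β.actVal g b')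
      rw [CStarTensor.mk_mul, ← actVal_mul, ← actVal_mul])
    (fun a b => by
      change CStarTensor.mk μ (α.actVal g _) (β.actVal g _) =
        star (CStarTensor.mk μ (α.actVal g a) (β.actVal g b))
      rw [CStarTensor.star_mk, ← actVal_star, ← actVal_star])

theorem norm_diagActHom (g : G) (x : α.dom g⁻¹ ⊗[ℂ] β.dom g⁻¹) :
    ‖diagActHom α β μ g x‖ = ‖diagMkHom α β μ g⁻¹ x‖ := by
  change ‖(tensorNorm A B μ).toAlg (TensorProduct.map (α.actVal g) (β.actVal g) x)‖ =
    ‖(tensorNorm A B μ).toAlg (TensorProduct.map (α.val g⁻¹) (β.val g⁻¹) x)‖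
  rw [CStarSeminorm.norm_toAlg, CStarSeminorm.norm_toAlg]
  exact tensorNorm_actVal α β μ x

theorem exists_diagHom (g : G) : ∃ F : diagDom α β μ g⁻¹ →⋆ₙₐ[ℂ] CStarTensor A B μ,
    ∀ x, F (diagMkHom α β μ g⁻¹ x) = diagActHom α β μ g x :=
  exists_starAlgHom_extend (diagMkHom α β μ g⁻¹) (denseRange_diagMk α β μ g⁻¹)
    (diagActHom α β μ g) fun x => (norm_diagActHom α β μ g x).le

/-- The *-homomorphism `α_g ⊗ β_g` on `A_{g⁻¹} ⊗_μ B_{g⁻¹}`. -/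
def diagHom (g : G) : diagDom α β μ g⁻¹ →⋆ₙₐ[ℂ] CStarTensor A B μ :=
  (exists_diagHom α β μ g).choose

theorem diagHom_diagMkHom (g : G) (x : α.dom g⁻¹ ⊗[ℂ] β.dom g⁻¹) :
    diagHom α β μ g (diagMkHom α β μ g⁻¹ x) = diagActHom α β μ g x :=
  (exists_diagHom α β μ g).choose_spec x

theorem norm_diagHom (g : G) (x : diagDom α β μ g⁻¹) : ‖diagHom α β μ g x‖ = ‖x‖ := by
  have hc : Continuous (diagHom α β μ g) :=
    AddMonoidHomClass.continuous_of_bound (diagHom α β μ g) 1 fun x => by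
      rw [one_mul]; exact NonUnitalStarAlgHom.norm_apply_le _ x
  refine (denseRange_diagMk α β μ g⁻¹).induction_on (p := fun x => ‖diagHom α β μ g x‖ = ‖x‖) x
    (isClosed_eq hc.norm continuous_norm) fun y => ?_
  exact (congrArg norm (diagHom_diagMkHom α β μ g y)).trans (norm_diagActHom α β μ g y)

open Classical in
/-- The map `α_g ⊗ β_g` on `A_{g⁻¹} ⊗_μ B_{g⁻¹}`, with the value `0` elsewhere. -/
def diagApp (g : G) (x : CStarTensor A B μ) : CStarTensor A B μ :=
  if hx : x ∈ diagDom α β μ g⁻¹ then diagHom α β μ g ⟨x, hx⟩ else 0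

theorem diagApp_of_mem {g : G} {x : CStarTensor A B μ} (hx : x ∈ diagDom α β μ g⁻¹) :
    diagApp α β μ g x = diagHom α β μ g ⟨x, hx⟩ := dif_pos hx

theorem diagApp_add {g : G} {x y : CStarTensor A B μ} (hx : x ∈ diagDom α β μ g⁻¹)
    (hy : y ∈ diagDom α β μ g⁻¹) :
    diagApp α β μ g (x + y) = diagApp α β μ g x + diagApp α β μ g y := by
  rw [diagApp_of_mem α β μ hx, diagApp_of_mem α β μ hy, diagApp_of_mem α β μ (add_mem hx hy)]
  exact map_add (diagHom α β μ g) ⟨x, hx⟩ ⟨y, hy⟩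

theorem diagApp_smul {g : G} (c : ℂ) {x : CStarTensor A B μ} (hx : x ∈ diagDom α β μ g⁻¹) :
    diagApp α β μ g (c • x) = c • diagApp α β μ g x := by
  rw [diagApp_of_mem α β μ hx, diagApp_of_mem α β μ (SMulMemClass.smul_mem c hx)]
  exact map_smul (diagHom α β μ g) c ⟨x, hx⟩

theorem norm_diagApp {g : G} {x : CStarTensor A B μ} (hx : x ∈ diagDom α β μ g⁻¹) :
    ‖diagApp α β μ g x‖ = ‖x‖ := by
  rw [diagApp_of_mem α β μ hx, norm_diagHom]
  rfl

theorem diagApp_mk {g : G} {a : A} {b : B} (ha : a ∈ α.dom g⁻¹) (hb : b ∈ β.dom g⁻¹) :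
    diagApp α β μ g (CStarTensor.mk μ a b) = CStarTensor.mk μ (α.app g a) (β.app g b) := by
  rw [diagApp_of_mem α β μ (mk_mem_diagDom ha hb)]
  exact diagHom_diagMkHom α β μ g ((⟨a, ha⟩ : α.dom g⁻¹) ⊗ₜ (⟨b, hb⟩ : β.dom g⁻¹))

theorem mem_diagDom_one (x : CStarTensor A B μ) : x ∈ diagDom α β μ 1 :=
  closedSpanTensor_mono (fun a _ => α.mem_dom_one a) (fun b _ => β.mem_dom_one b)
    (mem_closedSpanTensor_univ x)

variable {α β μ} in
-- For the ideals of partial actions, the intersection of `A_g ⊗_μ B_g` and `A_h ⊗_μ B_h` is spanned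
-- by elementary tensors from the intersections. This is what reduces the axioms of a partial action
-- to elementary tensors.
theorem mem_closedSpanTensor_inter {g h : G} {x : CStarTensor A B μ} (hx : x ∈ diagDom α β μ g)
    (hx' : x ∈ diagDom α β μ h) :
    x ∈ closedSpanTensor μ (α.dom g ∩ α.dom h : Set A) (β.dom g ∩ β.dom h : Set B) :=
  closedSpanTensor_of_mem_of_mem (S := (α.dom h : Set A)) (T := (β.dom h : Set B))
    (S' := (α.dom g ∩ α.dom h : Set A)) (T' := (β.dom g ∩ β.dom h : Set B))
    (fun a ha a' ha' => ⟨α.mul_mem_dom_right g a a' ha, α.mul_mem_dom_left h a a' ha'⟩)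
    (fun b hb b' hb' => ⟨β.mul_mem_dom_right g b b' hb, β.mul_mem_dom_left h b b' hb'⟩) hx hx'

/-- By `mem_closedSpanTensor_inter` it is enough to treat `a ⊗ b` with `a` and `b` in the
intersections of the ideals, where the axiom for `α` and `β` applies. -/
theorem diagApp_mem_mul {g h k : G} (e : g * h = k) {x : CStarTensor A B μ}
    (hx : x ∈ diagDom α β μ g⁻¹) (hx' : x ∈ diagDom α β μ h) :
    diagApp α β μ g x ∈ diagDom α β μ k := by
  refine map_mem_of_mem_closure_span (N := (diagDom α β μ g⁻¹).toSubmodule)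
    (M := (diagDom α β μ k).toSubmodule) (K := 1) (isClosed_closedTensor _ _)
    (fun x hx y hy => diagApp_add α β μ hx hy) (fun c x hx => diagApp_smul α β μ c hx)
    (fun x hx => by rw [one_mul, norm_diagApp α β μ hx]) ?_ ?_
    (mem_closedSpanTensor_inter hx hx') hx
  · rintro _ ⟨a, ha, b, hb, rfl⟩
    exact mk_mem_diagDom ha.1 hb.1
  · rintro _ ⟨a, ha, b, hb, rfl⟩
    rw [diagApp_mk α β μ ha.1 hb.1]
    exact mk_mem_diagDom (α.app_mem_mul e ha.1 ha.2) (β.app_mem_mul e hb.1 hb.2)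

theorem diagApp_mem {g : G} {x : CStarTensor A B μ} (hx : x ∈ diagDom α β μ g⁻¹) :
    diagApp α β μ g x ∈ diagDom α β μ g :=
  diagApp_mem_mul α β μ (mul_one g) hx (mem_diagDom_one α β μ x)

theorem diagApp_one (x : CStarTensor A B μ) : diagApp α β μ 1 x = x := by
  have h1 : ∀ x, x ∈ diagDom α β μ 1⁻¹ := fun x => by
    rw [inv_one]; exact mem_diagDom_one α β μ x
  refine eq_of_mem_closure_span (g := fun x => x) (N := (diagDom α β μ 1⁻¹).toSubmodule)
    (fun x hx y hy => diagApp_add α β μ hx hy) (fun c x hx => diagApp_smul α β μ c hx)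
    (fun x hx => (norm_diagApp α β μ hx).le) (fun _ _ _ _ => rfl) (fun _ _ _ => rfl)
    (fun _ _ => le_rfl) (fun x _ => h1 x) ?_ (h1 x) (h1 x)
  rintro _ ⟨a, ha, b, hb, rfl⟩
  rw [diagApp_mk α β μ ha hb, α.app_one, β.app_one]

/-- Both sides are isometric and linear on the intersection of the two domains, so they need only
agree on elementary tensors spanning it. -/
theorem diagApp_diagApp {g h k : G} (e : g * h = k) {x : CStarTensor A B μ}
    (hx : x ∈ diagDom α β μ h⁻¹) (hx' : x ∈ diagDom α β μ k⁻¹) :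
    diagApp α β μ g (diagApp α β μ h x) = diagApp α β μ k x := by
  have hm : ∀ x ∈ (diagDom α β μ h⁻¹).toSubmodule ⊓ (diagDom α β μ k⁻¹).toSubmodule,
      diagApp α β μ h x ∈ diagDom α β μ g⁻¹ := fun x hx =>
    diagApp_mem_mul α β μ (by subst e; group) hx.1 hx.2
  refine eq_of_mem_closure_span (f := fun x => diagApp α β μ g (diagApp α β μ h x))
    (N := (diagDom α β μ h⁻¹).toSubmodule ⊓ (diagDom α β μ k⁻¹).toSubmodule)
    (fun x hx y hy => ?_) (fun c x hx => ?_) (fun x hx => ?_)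
    (fun x hx y hy => diagApp_add α β μ hx.2 hy.2) (fun c x hx => diagApp_smul α β μ c hx.2)
    (fun x hx => (norm_diagApp α β μ hx.2).le) ?_ ?_ (mem_closedSpanTensor_inter hx hx') ⟨hx, hx'⟩
  · rw [diagApp_add α β μ hx.1 hy.1, diagApp_add α β μ (hm x hx) (hm y hy)]
  · rw [diagApp_smul α β μ c hx.1, diagApp_smul α β μ c (hm x hx)]
  · rw [norm_diagApp α β μ (hm x hx), norm_diagApp α β μ hx.1]
  · rintro _ ⟨a, ha, b, hb, rfl⟩
    exact ⟨mk_mem_diagDom ha.1 hb.1, mk_mem_diagDom ha.2 hb.2⟩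
  · rintro _ ⟨a, ha, b, hb, rfl⟩
    rw [diagApp_mk α β μ ha.1 hb.1, diagApp_mk α β μ ha.2 hb.2, diagApp_mk α β μ
      (α.app_mem_mul (by subst e; group) ha.1 ha.2) (β.app_mem_mul (by subst e; group) hb.1 hb.2),
      α.app_app e ha.1 ha.2, β.app_app e hb.1 hb.2]

/-- The *-homomorphism `α_g ⊗ β_g : A_{g⁻¹} ⊗_μ B_{g⁻¹} → A_g ⊗_μ B_g`. -/
def diagActAux (g : G) : diagDom α β μ g⁻¹ →⋆ₙₐ[ℂ] diagDom α β μ g :=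
  NonUnitalStarAlgHom.codRestrict (diagHom α β μ g) (diagDom α β μ g) fun x => by
    rw [← diagApp_of_mem α β μ x.2]
    exact diagApp_mem α β μ x.2

theorem coe_diagActAux (g : G) (x : diagDom α β μ g⁻¹) :
    (diagActAux α β μ g x : CStarTensor A B μ) = diagApp α β μ g x :=
  (diagApp_of_mem α β μ x.2).symm

theorem diagActAux_bijective (g : G) : Function.Bijective (diagActAux α β μ g) := by
  refine ⟨(injective_iff_map_eq_zero _).mpr fun x hx => ?_, fun y => ?_⟩
  · have h : ‖diagActAux α β μ g x‖ = ‖x‖ := norm_diagHom α β μ g x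
    rwa [hx, norm_zero, eq_comm, norm_eq_zero] at h
  · have hy : (y : CStarTensor A B μ) ∈ diagDom α β μ g⁻¹⁻¹ := by rw [inv_inv]; exact y.2
    -- The preimage is given by `α_{g⁻¹} ⊗ β_{g⁻¹}`.
    refine ⟨⟨diagApp α β μ g⁻¹ y, diagApp_mem α β μ hy⟩, Subtype.ext ?_⟩
    rw [coe_diagActAux, diagApp_diagApp α β μ (mul_inv_cancel g) hy
      (by rw [inv_one]; exact mem_diagDom_one α β μ _), diagApp_one]

/-- The diagonal partial action `α ⊗ β`. -/
def diag : PartialAction G (CStarTensor A B μ) where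
  dom := diagDom α β μ
  isClosed_dom g := isClosed_closedTensor _ _
  mul_mem_dom_left g _ _ h := mul_mem_closedSpanTensor (fun a _ a' h => α.mul_mem_dom_left g a a' h)
    (fun b _ b' h => β.mul_mem_dom_left g b b' h) (mem_closedSpanTensor_univ _) h
  mul_mem_dom_right g _ _ h := mul_mem_closedSpanTensor
    (fun a h a' _ => α.mul_mem_dom_right g a a' h)
    (fun b h b' _ => β.mul_mem_dom_right g b b' h) h (mem_closedSpanTensor_univ _)
  act g := StarAlgEquiv.ofBijective (diagActAux α β μ g) (diagActAux_bijective α β μ g)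
  dom_one := eq_top_iff.mpr fun x _ => mem_diagDom_one α β μ x
  act_one x := (coe_diagActAux α β μ 1 x).trans (diagApp_one α β μ x)
  act_mem g h x hx := by
    change (diagActAux α β μ g x : CStarTensor A B μ) ∈ _
    rw [coe_diagActAux]
    exact diagApp_mem_mul α β μ rfl x.2 hx
  act_act g h x hx hx' hb := by
    change (diagActAux α β μ g ⟨(diagActAux α β μ h ⟨x, hx⟩ : CStarTensor A B μ), _⟩ :
      CStarTensor A B μ) = diagActAux α β μ (g * h) ⟨x, hx'⟩
    rw [coe_diagActAux, coe_diagActAux, coe_diagActAux]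
    exact diagApp_diagApp α β μ rfl hx hx'

theorem isDiagonal_diag : IsDiagonal α β μ (diag α β μ) := by
  refine ⟨fun g => rfl, fun g a b => ⟨mk_mem_diagDom a.2 b.2, ?_⟩⟩
  refine (coe_diagActAux α β μ g _).trans ((diagApp_mk α β μ a.2 b.2).trans ?_)
  rw [α.app_of_mem a.2, β.app_of_mem b.2]

end PartialAction

/-! ### Uniqueness of the diagonal action and its semidirect product bundle -/

namespace PartialAction

variable {G A B : Type u} [Group G] [NonUnitalCStarAlgebra A] [NonUnitalCStarAlgebra B]

theorem ext_of_app {γ γ' : PartialAction G A} (hdom : γ.dom = γ'.dom)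
    (h : ∀ g, ∀ x ∈ γ.dom g⁻¹, γ.app g x = γ'.app g x) : γ = γ' := by
  obtain ⟨dom, h1, h2, h3, act, h4, h5, h6, h7⟩ := γ
  obtain ⟨dom', h1', h2', h3', act', h4', h5', h6', h7'⟩ := γ'
  change dom = dom' at hdom
  subst hdom
  have : act = act' := by
    funext g
    refine StarAlgEquiv.ext fun x => Subtype.ext ?_
    have := h g x x.2
    rwa [app_of_mem _ x.2, app_of_mem _ x.2] at this
  subst this
  rfl

namespace IsDiagonal

variable {α : PartialAction G A} {β : PartialAction G B} {μ : TensorKind}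
  {γ : PartialAction G (CStarTensor A B μ)} (hγ : IsDiagonal α β μ γ)
include hγ

theorem mk_mem {g : G} {a : A} {b : B} (ha : a ∈ α.dom g) (hb : b ∈ β.dom g) :
    CStarTensor.mk μ a b ∈ γ.dom g := by
  rw [← SetLike.mem_coe, hγ.1 g]
  exact mk_mem_closedSpanTensor ha hb

theorem app_mk {g : G} {a : A} {b : B} (ha : a ∈ α.dom g⁻¹) (hb : b ∈ β.dom g⁻¹) :
    γ.app g (CStarTensor.mk μ a b) = CStarTensor.mk μ (α.app g a) (β.app g b) := by
  obtain ⟨h, h'⟩ := hγ.2 g ⟨a, ha⟩ ⟨b, hb⟩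
  rw [γ.app_of_mem h, α.app_of_mem ha, β.app_of_mem hb, h']

/-- The maps of any partial action are isometric, hence are determined by their values on the
elementary tensors that span the ideals. -/
theorem eq {γ' : PartialAction G (CStarTensor A B μ)} (hγ' : IsDiagonal α β μ γ') : γ = γ' := by
  have hdom : γ.dom = γ'.dom := funext fun g => SetLike.coe_injective ((hγ.1 g).trans (hγ'.1 g).symm)
  refine ext_of_app hdom fun g x hx => ?_
  have hx' : x ∈ closure (Submodule.span ℂ {x | ∃ a ∈ α.dom g⁻¹, ∃ b ∈ β.dom g⁻¹,
      x = CStarTensor.mk μ a b} : Set (CStarTensor A B μ)) := by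
    rw [← hγ.1 g⁻¹]
    exact hx
  have hle : ∀ y ∈ (γ.dom g⁻¹).toSubmodule, y ∈ γ'.dom g⁻¹ := fun y hy => hdom ▸ hy
  refine eq_of_mem_closure_span (N := (γ.dom g⁻¹).toSubmodule)
    (fun x hx y hy => γ.app_add hx hy) (fun c x hx => γ.app_smul c hx)
    (fun x hx => (γ.norm_app hx).le) (fun x hx y hy => γ'.app_add (hle x hx) (hle y hy))
    (fun c x hx => γ'.app_smul c (hle x hx)) (fun x hx => (γ'.norm_app (hle x hx)).le) ?_ ?_ hx' hx
  · rintro _ ⟨a, ha, b, hb, rfl⟩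
    exact hγ.mk_mem ha hb
  · rintro _ ⟨a, ha, b, hb, rfl⟩
    rw [hγ.app_mk ha hb, hγ'.app_mk ha hb]

/-- The canonical map `A_g ⊗ B_g → A_g ⊗_μ B_g` into the fibre of the semidirect product bundle. -/
def bundleMk (g : G) : α.bundle.fiber g ⊗[ℂ] β.bundle.fiber g →ₗ[ℂ] γ.bundle.fiber g :=
  ((tensorNorm A B μ).toAlg ∘ₗ TensorProduct.map (α.val g) (β.val g)).codRestrict
    (γ.dom g).toSubmodule fun x => by
      induction x with
      | zero => rw [map_zero]; exact zero_mem _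
      | add x y h h' => rw [map_add]; exact add_mem h h'
      | tmul a b => exact hγ.mk_mem (α.val_mem g a) (β.val_mem g b)

theorem val_bundleMk_tmul (g : G) (a : α.bundle.fiber g) (b : β.bundle.fiber g) :
    γ.val g (hγ.bundleMk g (a ⊗ₜ b)) = CStarTensor.mk μ (α.val g a) (β.val g b) := rfl

theorem denseRange_bundleMk (g : G) : DenseRange (hγ.bundleMk g) := by
  refine Subtype.dense_iff (s := (γ.dom g : Set (CStarTensor A B μ))).mpr fun x hx => ?_
  rw [hγ.1 g] at hx
  refine closure_mono ?_ hx
  intro y hy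
  have hle : Submodule.span ℂ {x | ∃ a ∈ α.dom g, ∃ b ∈ β.dom g, x = CStarTensor.mk μ a b} ≤
      LinearMap.range (γ.val g ∘ₗ hγ.bundleMk g) := by
    refine Submodule.span_le.mpr ?_
    rintro _ ⟨a, ha, b, hb, rfl⟩
    obtain ⟨a, rfl⟩ := α.exists_val_eq ha
    obtain ⟨b, rfl⟩ := β.exists_val_eq hb
    exact ⟨a ⊗ₜ b, rfl⟩
  obtain ⟨z, rfl⟩ := hle hy
  exact ⟨_, ⟨z, rfl⟩, rfl⟩

/-- The algebraic tensor products of the fibres map densely into the fibres of the semidirect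
product bundle of `γ`, compatibly with products and adjoints, so `FellBundle.HasAP.of_tensor`
applies without identifying this bundle with a tensor product bundle. -/
theorem hasAP (hα : α.HasAP) : γ.HasAP := by
  refine FellBundle.HasAP.of_tensor (ℬ := β.bundle) hα hγ.bundleMk (fun {g h k} e a b a' b' => ?_)
    (fun {g h} e a b => ?_) (fun g a b => ?_) hγ.denseRange_bundleMk
  · have ha := α.val_mem g a
    have hb := β.val_mem g b
    refine γ.val_injective k ?_
    rw [val_mulMap, val_bundleMk_tmul, val_bundleMk_tmul, val_bundleMk_tmul, val_mulMap, val_mulMap,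
      hγ.app_mk (by rwa [inv_inv]) (by rwa [inv_inv]), CStarTensor.mk_mul,
      hγ.app_mk (α.mul_mem_dom_right _ _ _ (α.app_inv_mem ha))
        (β.mul_mem_dom_right _ _ _ (β.app_inv_mem hb))]
  · have ha := star_mem (α.val_mem g a)
    have hb := star_mem (β.val_mem g b)
    refine γ.val_injective h ?_
    rw [val_starMap, val_bundleMk_tmul, val_bundleMk_tmul, val_starMap, val_starMap,
      CStarTensor.star_mk, hγ.app_mk (by rwa [inv_inv]) (by rwa [inv_inv])]
  · rw [← norm_val, val_bundleMk_tmul, ← norm_val, ← norm_val]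
    exact CStarTensor.norm_mk_le _ _

end IsDiagonal

/-- The unit fibre is a copy of `A ⊗_μ B`, whose norm dominates the minimal one on `A ⊗ B`, whatever
`μ` is. -/
theorem isNuclear_bundle_fiber_one {μ : TensorKind}
    (γ : PartialAction G (CStarTensor A B μ)) (hA : IsNuclear A)
    (hB : IsNuclear B) : IsNuclear (γ.bundle.fiber 1) := by
  refine IsNuclear.of_tensor hA hB (γ.oneValHom.comp (tensorNorm A B μ).toAlgHom) ?_ (fun x => ?_)
    (fun a b => CStarTensor.norm_mk_le a b)
  · refine Subtype.dense_iff (s := (γ.dom 1 : Set (CStarTensor A B μ))).mpr fun x _ => ?_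
    refine closure_mono ?_ ((tensorNorm A B μ).denseRange_toAlg x)
    rintro _ ⟨y, rfl⟩
    exact ⟨_, ⟨y, rfl⟩, rfl⟩
  · change _ ≤ ‖(tensorNorm A B μ).toAlg x‖
    rw [CStarSeminorm.norm_toAlg]
    exact min_le_tensorNorm μ x

end PartialAction

end

/-! ### The Proposition and the Corollary -/

theorem mainTheorem10 {G : Type u} [Group G] :
    (∀ (𝒜 ℬ : FellBundle G) (μ : TensorKind),
      (∀ x : 𝒜.fiber 1 ⊗[ℂ] ℬ.fiber 1,
        ‖FellBundle.tensorMk μ 𝒜 ℬ 1 x‖ = tensorNorm (𝒜.fiber 1) (ℬ.fiber 1) μ x) ∧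
      (𝒜.HasAP →
        (FellBundle.tensor μ 𝒜 ℬ).HasAP ∧
        Function.Bijective (FellBundle.tensor μ 𝒜 ℬ).regularRep ∧
        (IsNuclear (𝒜.fiber 1) → IsNuclear (ℬ.fiber 1) →
          IsNuclear (FellBundle.tensor μ 𝒜 ℬ).FullAlg))) ∧
    (∀ (A B : Type u) [NonUnitalCStarAlgebra A] [NonUnitalCStarAlgebra B]
      (α : PartialAction G A) (β : PartialAction G B) (μ : TensorKind),
      ∃ γ : PartialAction G (CStarTensor A B μ),
        (∀ γ', PartialAction.IsDiagonal α β μ γ' ↔ γ' = γ) ∧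
        (α.HasAP →
          γ.HasAP ∧
          Function.Bijective γ.regularRep ∧
          (IsNuclear A → IsNuclear B → IsNuclear γ.CrossedProduct))) := by
  refine ⟨fun 𝒜 ℬ μ => ⟨FellBundle.norm_tensorMk_one μ 𝒜 ℬ, fun hA => ?_⟩,
    fun A B _ _ α β μ => ?_⟩
  · have hT := hA.tensor μ ℬ
    exact ⟨hT, hT.bijective_regularRep,
      fun h𝒜 hℬ => hT.isNuclear (FellBundle.isNuclear_tensor_fiber_one μ h𝒜 hℬ)⟩
  · have hγ := PartialAction.isDiagonal_diag α β μ
    refine ⟨PartialAction.diag α β μ, fun γ' => ⟨fun h => h.eq hγ, fun h => h ▸ hγ⟩, fun hα => ?_⟩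
    have hT := hγ.hasAP hα
    exact ⟨hT, hT.bijective_regularRep, fun hA hB =>
      hT.isNuclear (PartialAction.isNuclear_bundle_fiber_one _ hA hB)⟩
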